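/- Let $W$ be a random variable with $W>0$ a.s., $\mathbf E[W]=1$, $\mathbf E[W\log_2 W]<1$ and $\mathbf E[W^{-s}]<\infty$ for all $s\in[0,1)$. For $n\ge 0$ let $\mathcal I_n$ be the set of dyadic intervals $[k2^{-n},(k+1)2^{-n}]$, $0\le k<2^n$, and let $W_I$, $I\in\bigcup_{n\ge 0}\mathcal I_n$, be independent random variables, each with the law of $W$. For $x\in[0,1]$ let $I_j(x)$ be the interval of $\mathcal I_j$ containing $x$ (if there are two, the one whose maximum is $x$). Let $\mu_n$ be the measure on $[0,1]$ with density $w_n(x)=\prod_{j=0}^{n-1}W_{I_j(x)}$ with respect to Lebesgue measure, and let $\mu$ be the weak limit of $\mu_n$ as $n\to\infty$. Set $\rho(x,y)=\rho(y,x)=\mu[x,y]$ for $0\le x\le y\le 1$. Let $K\subset[0,1]$ be a deterministic nonempty analytic (Suslin) set, for example a Borel set, with Euclidean Hausdorff dimension $\zeta_0$. Then almost surely the weak limit $\mu$ exists, $\rho$ is a metric on $[0,1]$, and the Hausdorff dimension $\zeta$ of $K$ with respect to $\rho$ is the unique solution in $[0,1]$ of $$2^{\zeta_0}=\frac{2^{\zeta}}{\mathbf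 E[W^{\zeta}]},$$ that is, the unique $\zeta\in[0,1]$ with $\zeta_0=\varphi(\zeta)$, where $\varphi(s)=s-\log_2\mathbf E[W^s]$. -/

import Mathlib

open MeasureTheory ProbabilityTheory Filter Topology unitInterval
open scoped NNReal ENNReal

noncomputable section

/-- The index set of the dyadic subintervals of `[0,1]`: the pair `⟨n, k⟩` with `k < 2 ^ n` stands
for the closed interval `[k * 2⁻ⁿ, (k + 1) * 2⁻ⁿ]`. The pair `⟨0, 0⟩` is `[0,1]` itself. -/
abbrev DyadicIndex : Type := (n : ℕ) × Fin (2 ^ n)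

lemma ceil_sub_one_lt_two_pow (n : ℕ) (x : I) : ⌈(x : ℝ) * 2 ^ n⌉₊ - 1 < 2 ^ n := by
  have h : ⌈(x : ℝ) * 2 ^ n⌉₊ ≤ 2 ^ n := by
    apply Nat.ceil_le.2
    push_cast
    exact mul_le_of_le_one_left (by positivity) x.2.2
  have h2 : 0 < 2 ^ n := by positivity
  omega

/-- The dyadic interval of length `2⁻ⁿ` which contains `x`; if there are two of them, the one whose
maximum is `x`. -/
def dyadicAt (n : ℕ) (x : I) : DyadicIndex :=
  ⟨n, ⟨⌈(x : ℝ) * 2 ^ n⌉₊ - 1, ceil_sub_one_lt_two_pow n x⟩⟩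

/-- The density `w_n(x) = ∏_{j < n} w(I_j(x))` attached to a family `w` of weights. -/
def cascadeDensity (w : DyadicIndex → ℝ) (n : ℕ) (x : I) : ℝ :=
  ∏ j ∈ Finset.range n, w (dyadicAt j x)

lemma cascadeDensity_le (w : DyadicIndex → ℝ) (n : ℕ) (x : I) :
    cascadeDensity w n x ≤ ∏ j ∈ Finset.range n, ∑ k : Fin (2 ^ j), |w ⟨j, k⟩| := by
  refine (le_abs_self _).trans ?_
  rw [cascadeDensity, Finset.abs_prod]
  refine Finset.prod_le_prod (fun _ _ => abs_nonneg _) fun j _ => ?_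
  exact Finset.single_le_sum (f := fun k : Fin (2 ^ j) => |w ⟨j, k⟩|)
    (fun _ _ => abs_nonneg _) (Finset.mem_univ (dyadicAt j x).2)

lemma isFiniteMeasure_cascade (w : DyadicIndex → ℝ) (n : ℕ) :
    IsFiniteMeasure
      ((volume : Measure I).withDensity fun x => ENNReal.ofReal (cascadeDensity w n x)) := by
  apply isFiniteMeasure_withDensity
  refine ne_of_lt (lt_of_le_of_lt
    (lintegral_mono fun x => ENNReal.ofReal_le_ofReal (cascadeDensity_le w n x)) ?_)
  simp

/-- The `n`-th measure `μ_n = w_n μ_0` of the cascade with weights `w`, where `μ_0` is Lebesgue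
measure on `[0,1]`. -/
def cascadeApprox (w : DyadicIndex → ℝ) (n : ℕ) : FiniteMeasure I :=
  ⟨(volume : Measure I).withDensity fun x => ENNReal.ofReal (cascadeDensity w n x),
    isFiniteMeasure_cascade w n⟩

/-- The cascade measure `μ`: the limit of `μ_n` in the topology of weak convergence of finite
measures on `[0,1]` (an arbitrary measure if there is no limit). -/
def cascadeMeasure (w : DyadicIndex → ℝ) : FiniteMeasure I :=
  limUnder atTop fun n => cascadeApprox w n

/-- The distance `ρ(x, y) = μ[x, y]` for `x ≤ y`, extended symmetrically. -/
def cascadeDist (w : DyadicIndex → ℝ) (x y : I) : ℝ :=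
  (cascadeMeasure w : Measure I).real (Set.uIcc x y)

/-- The function `φ(s) = s - log₂ E[W ^ s]`. -/
def cascadePhi {Ω : Type*} [MeasurableSpace Ω] (P : Measure Ω) (W : Ω → ℝ) (s : ℝ) : ℝ :=
  s - Real.logb 2 (∫ ω, W ω ^ s ∂P)

end

/-! The dyadic intervals are the nodes of the binary tree. Under the product law the root weight and
the two subtrees are independent, and each subtree has the law of the whole tree (`map_glue_prod`).
Hence the total mass satisfies `Y = (W / 2) (Y' + Y'')` with `Y'`, `Y''` independent copies of `Y`,
and most estimates are expectations of this recursion. Let `φ = cascadePhi`, so that `growth` at `s`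
is `2 ^ φ(s)`.

The measure. The masses of the approximations form nonnegative martingales and converge in every
subtree (`ae_isRegular`). The limit is nonzero because `E[W log₂ W] < 1` bounds `E[√Y_n]` from below
(`le_lintegral_sqrt_lebApprox`); the recursion then yields `Y > 0`, `E[Y ^ (-s)] < ∞` for `0 ≤ s <
1`, and absence of atoms. So the distribution function `F` of `μ` is strictly increasing, `ρ(x, y) =
|F x - F y|`, and the dimension sought is the Euclidean dimension of `F '' K`.

Upper bound (`ae_dimH_le`). A node of level `n` has `E[μ(I) ^ s] ≤ 2 ^ (-n φ(s))`. If `dim K < t ≤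
φ(s)`, then `K` has dyadic coverings with arbitrarily small `∑ |I| ^ t`, so along a suitable
sequence of coverings `∑ μ(I) ^ s → 0` almost surely.

Lower bound (`ae_le_dimH`). If `φ(s) < t < dim K`, Frostman's lemma gives a flow `ν` with `ν(I) ≤ 2
^ (-t n)` on a compact subset of `K`. It is multiplied by the cascade with the tilted weights `W ^ s
/ E[W ^ s]`, built from the same `W`. The tilt is chosen so that `(W ^ s / E[W ^ s]) (W / 2) ^ (-s)
= 2 ^ φ(s)` is deterministic: in the second moments of the new flow `θ` divided by `μ ^ s`, each
generation costs `2 ^ φ(s)` and the decay of `ν` gains `2 ^ (-t)`. This gives finite `s`-energy with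
respect to `ρ` (`ae_energy`), where `ρ(x, y)` is bounded below by the mass of a cell lying between
`x` and `y`. A weighted second moment bound shows that `θ` survives (`ae_limitMass_ne_zero`), and
the energy method concludes (`le_dimH_image_of_energy`).

Finally `φ` is continuous and strictly increasing on `[0, 1]` from `0` to `1`, so the two bounds
meet at the solution of `φ(ζ) = ζ₀`. -/

noncomputable section

/-! ### The binary tree and the law of independent weights -/

namespace Cascade

/-- The space of families of weights indexed by the nodes of the binary tree. -/
abbrev Weights : Type := List Bool → ℝ≥0∞

/-- The subtree of a family which hangs at the child `b` of the root. -/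
def sub {α : Type*} (b : Bool) (w : List Bool → α) : List Bool → α := fun l => w (b :: l)

/-- The subtree of a family which hangs at the node `l`. -/
def subAt {α : Type*} (l : List Bool) (w : List Bool → α) : List Bool → α := fun l' => w (l ++ l')

/-- The family with a prescribed root and prescribed subtrees. -/
def glue {α : Type*} (a : α) (u v : List Bool → α) : List Bool → α
  | [] => a
  | false :: l => u l
  | true :: l => v l

@[simp] lemma sub_eq {α : Type*} (b : Bool) (w : List Bool → α) (l : List Bool) :
    sub b w l = w (b :: l) := rfl

@[simp] lemma subAt_apply {α : Type*} (l l' : List Bool) (w : List Bool → α) :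
    subAt l w l' = w (l ++ l') := rfl

@[simp] lemma subAt_nil {α : Type*} (w : List Bool → α) : subAt [] w = w := rfl

@[simp] lemma subAt_cons {α : Type*} (b : Bool) (l : List Bool) (w : List Bool → α) :
    subAt (b :: l) w = subAt l (sub b w) := rfl

lemma sub_subAt {α : Type*} (l : List Bool) (b : Bool) (w : List Bool → α) :
    sub b (subAt l w) = subAt (l ++ [b]) w := by
  funext k; simp [sub, subAt]

@[simp] lemma glue_nil {α : Type*} (a : α) (u v : List Bool → α) : glue a u v [] = a := rfl

@[simp] lemma sub_false_glue {α : Type*} (a : α) (u v : List Bool → α) :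
    sub false (glue a u v) = u := rfl

@[simp] lemma sub_true_glue {α : Type*} (a : α) (u v : List Bool → α) :
    sub true (glue a u v) = v := rfl

lemma glue_sub {α : Type*} (w : List Bool → α) : glue (w []) (sub false w) (sub true w) = w := by
  funext l
  rcases l with _ | ⟨_ | _, l⟩ <;> rfl

@[fun_prop] lemma measurable_sub (b : Bool) : Measurable (sub b : Weights → Weights) :=
  measurable_pi_lambda _ fun _ => measurable_pi_apply _

@[fun_prop] lemma measurable_glue {β : Type*} [MeasurableSpace β] {a : β → ℝ≥0∞} {u v : β → Weights}
    (ha : Measurable a) (hu : Measurable u) (hv : Measurable v) :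
    Measurable (fun x => (glue (a x) (u x) (v x) : Weights)) := by
  refine measurable_pi_lambda _ fun l => ?_
  rcases l with _ | ⟨_ | _, l⟩
  · exact ha
  · exact (measurable_pi_apply l).comp hu
  · exact (measurable_pi_apply l).comp hv

/-- The law of a family of independent weights with common law `lam`. -/
def treeLaw (lam : Measure ℝ≥0∞) [IsProbabilityMeasure lam] : Measure Weights :=
  Measure.infinitePi fun _ : List Bool => lam

section
variable (lam : Measure ℝ≥0∞) [IsProbabilityMeasure lam]

instance : IsProbabilityMeasure (treeLaw lam) := by
  unfold treeLaw; infer_instance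

lemma prod_words (s : Finset (List Bool)) (h : List Bool → ℝ≥0∞) :
    ∏ l ∈ s, h l = (if [] ∈ s then h [] else 1) *
      ((∏ l ∈ s.preimage (List.cons false) (List.cons_injective.injOn), h (false :: l)) *
        ∏ l ∈ s.preimage (List.cons true) (List.cons_injective.injOn), h (true :: l)) := by
  classical
  rw [Finset.prod_preimage' (List.cons false) s List.cons_injective.injOn h,
    Finset.prod_preimage' (List.cons true) s List.cons_injective.injOn h]
  have h0 : (if [] ∈ s then h [] else 1) = ∏ l ∈ s with l = [], h l := by
    rw [Finset.filter_eq' s]; split_ifs <;> simp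
  rw [h0, ← Finset.prod_filter_mul_prod_filter_not s (fun l => l = []) h]
  congr 1
  rw [← Finset.prod_filter_mul_prod_filter_not (s.filter fun l => ¬ l = [])
    (fun l => l ∈ Set.range (List.cons false)) h, Finset.filter_filter, Finset.filter_filter]
  congr 1 <;> refine Finset.prod_congr (Finset.filter_congr fun l _ => ?_) fun _ _ => rfl
  · rcases l with _ | ⟨_ | _, l⟩ <;> simp
  · rcases l with _ | ⟨_ | _, l⟩ <;> simp

/-- The branching property. A box over finitely many words pulls back to a box in the root and the
two subtrees, and values on boxes determine an infinite product measure. -/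
lemma map_glue_prod :
    (lam.prod ((treeLaw lam).prod (treeLaw lam))).map (fun p => glue p.1 p.2.1 p.2.2) =
      treeLaw lam := by
  classical
  refine Measure.eq_infinitePi _ fun s t ht => ?_
  have hm : Measurable fun p : ℝ≥0∞ × Weights × Weights => glue p.1 p.2.1 p.2.2 := by fun_prop
  rw [Measure.map_apply hm (MeasurableSet.pi s.countable_toSet fun i _ => ht i)]
  have h : (fun p : ℝ≥0∞ × Weights × Weights => glue p.1 p.2.1 p.2.2) ⁻¹' (Set.pi s t) =
      (if [] ∈ s then t [] else Set.univ) ×ˢ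
        ((Set.pi (s.preimage (List.cons false) (List.cons_injective.injOn)) (sub false t)) ×ˢ
          (Set.pi (s.preimage (List.cons true) (List.cons_injective.injOn)) (sub true t))) := by
    ext ⟨a, u, v⟩
    simp only [Set.mem_preimage, Set.mem_pi, Set.mem_prod, Finset.mem_coe, Finset.mem_preimage]
    constructor
    · intro h
      refine ⟨?_, fun l hl => h _ hl, fun l hl => h _ hl⟩
      split_ifs with h0
      · exact h _ h0
      · trivial
    · rintro ⟨h1, h2, h3⟩ l hl
      rcases l with _ | ⟨_ | _, l⟩
      · simpa [hl] using h1
      · exact h2 _ hl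
      · exact h3 _ hl
  rw [h, Measure.prod_prod, Measure.prod_prod, treeLaw, Measure.infinitePi_pi, Measure.infinitePi_pi,
    prod_words s fun l => lam (t l)]
  · congr 1
    split_ifs <;> simp
  · exact fun _ _ => ht _
  · exact fun _ _ => ht _

lemma lintegral_tree {f : ℝ≥0∞ → Weights → Weights → ℝ≥0∞}
    (hf : Measurable fun p : ℝ≥0∞ × Weights × Weights => f p.1 p.2.1 p.2.2) :
    ∫⁻ w, f (w []) (sub false w) (sub true w) ∂treeLaw lam =
      ∫⁻ a, ∫⁻ u, ∫⁻ v, f a u v ∂treeLaw lam ∂treeLaw lam ∂lam := by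
  have hm : Measurable fun p : ℝ≥0∞ × Weights × Weights => glue p.1 p.2.1 p.2.2 := by fun_prop
  have hf' : Measurable fun w : Weights => f (w []) (sub false w) (sub true w) :=
    hf.comp (((measurable_pi_apply []).prodMk
      ((measurable_sub false).prodMk (measurable_sub true))))
  conv_lhs => rw [← map_glue_prod lam]
  rw [lintegral_map hf' hm]
  simp only [glue_nil, sub_false_glue, sub_true_glue]
  rw [lintegral_prod _ hf.aemeasurable]
  refine lintegral_congr fun a => ?_
  rw [lintegral_prod]
  exact (hf.comp measurable_prodMk_left).aemeasurable

lemma lintegral_tree_mul {f : ℝ≥0∞ → ℝ≥0∞} {g h : Weights → ℝ≥0∞}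
    (hf : Measurable f) (hg : Measurable g) (hh : Measurable h) :
    ∫⁻ w, f (w []) * (g (sub false w) * h (sub true w)) ∂treeLaw lam =
      (∫⁻ a, f a ∂lam) * ((∫⁻ w, g w ∂treeLaw lam) * ∫⁻ w, h w ∂treeLaw lam) := by
  rw [lintegral_tree lam (f := fun a u v => f a * (g u * h v)) (by fun_prop)]
  have h1 : ∀ a u, ∫⁻ v, f a * (g u * h v) ∂treeLaw lam
      = (f a * g u) * ∫⁻ v, h v ∂treeLaw lam := by
    intro a u
    simp_rw [← mul_assoc]
    exact lintegral_const_mul _ hh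
  simp_rw [h1]
  have h2 : ∀ a, ∫⁻ u, (f a * g u) * ∫⁻ v, h v ∂treeLaw lam ∂treeLaw lam =
      f a * ((∫⁻ w, g w ∂treeLaw lam) * ∫⁻ w, h w ∂treeLaw lam) := by
    intro a
    rw [lintegral_mul_const _ (by fun_prop), lintegral_const_mul _ hg, mul_assoc]
  simp_rw [h2]
  rw [lintegral_mul_const _ hf]

lemma lintegral_tree_mul_sub {f : ℝ≥0∞ → ℝ≥0∞} {g : Weights → ℝ≥0∞}
    (hf : Measurable f) (hg : Measurable g) (b : Bool) :
    ∫⁻ w, f (w []) * g (sub b w) ∂treeLaw lam = (∫⁻ a, f a ∂lam) * ∫⁻ w, g w ∂treeLaw lam := by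
  cases b
  · simpa using lintegral_tree_mul lam hf hg (h := fun _ => 1) measurable_const
  · simpa using lintegral_tree_mul lam hf (g := fun _ => 1) measurable_const hg

lemma lintegral_tree_mul_sub_sub {f : ℝ≥0∞ → ℝ≥0∞} {g h : Weights → ℝ≥0∞}
    (hf : Measurable f) (hg : Measurable g) (hh : Measurable h) (b : Bool) :
    ∫⁻ w, f (w []) * (g (sub b w) * h (sub (!b) w)) ∂treeLaw lam =
      (∫⁻ a, f a ∂lam) * ((∫⁻ w, g w ∂treeLaw lam) * ∫⁻ w, h w ∂treeLaw lam) := by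
  cases b
  · exact lintegral_tree_mul lam hf hg hh
  · simp_rw [mul_comm (g _)]
    rw [mul_comm (∫⁻ w, g w ∂_)]
    exact lintegral_tree_mul lam hf hh hg

lemma measurePreserving_root :
    MeasurePreserving (fun w : Weights => w []) (treeLaw lam) lam :=
  measurePreserving_eval_infinitePi (fun _ : List Bool => lam) []

lemma measurePreserving_sub (b : Bool) :
    MeasurePreserving (sub b : Weights → Weights) (treeLaw lam) (treeLaw lam) := by
  refine ⟨measurable_sub b, Measure.ext fun s hs => ?_⟩
  rw [Measure.map_apply (measurable_sub b) hs, ← lintegral_indicator_one hs,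
    ← lintegral_indicator_one (hs.preimage (measurable_sub b))]
  have := lintegral_tree_mul_sub lam (f := fun _ => 1) measurable_const
    (g := s.indicator 1) (measurable_one.indicator hs) b
  simp only [one_mul, lintegral_const, measure_univ] at this
  exact this

lemma ae_subAt {p : Weights → Prop} (h : ∀ᵐ w ∂treeLaw lam, p w) (l : List Bool) :
    ∀ᵐ w ∂treeLaw lam, p (subAt l w) := by
  induction l with
  | nil => exact h
  | cons b l ih => exact (measurePreserving_sub lam b).quasiMeasurePreserving.ae ih

lemma ae_forall_subAt {p : List Bool → Weights → Prop} (h : ∀ l, ∀ᵐ w ∂treeLaw lam, p l w) :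
    ∀ᵐ w ∂treeLaw lam, ∀ l, p l (subAt l w) :=
  ae_all_iff.2 fun l => ae_subAt lam (h l) l

lemma ae_forall_weight {p : ℝ≥0∞ → Prop} (h : ∀ᵐ a ∂lam, p a) :
    ∀ᵐ w ∂treeLaw lam, ∀ l, p (w l) := by
  filter_upwards [ae_forall_subAt lam fun _ =>
    (measurePreserving_root lam).quasiMeasurePreserving.ae h] with w hw l
  simpa using hw l

end

end Cascade

/-! ### Cascades acting on flows: martingales and limits -/

namespace Cascade

/-- A flow on the binary tree: the mass of a node is the sum of the masses of its children. -/
def IsFlow (ν : List Bool → ℝ≥0∞) : Prop := ∀ l, ν l = ν (l ++ [false]) + ν (l ++ [true])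

lemma IsFlow.sub {ν : List Bool → ℝ≥0∞} (h : IsFlow ν) (b : Bool) : IsFlow (sub b ν) :=
  fun l => h (b :: l)

lemma IsFlow.subAt {ν : List Bool → ℝ≥0∞} (h : IsFlow ν) (l : List Bool) : IsFlow (subAt l ν) :=
  fun l' => by simpa [Cascade.subAt] using h (l ++ l')

lemma IsFlow.root {ν : List Bool → ℝ≥0∞} (h : IsFlow ν) :
    ν [] = Cascade.sub false ν [] + Cascade.sub true ν [] := h []

/-- The total mass of the `n`-th approximation of the cascade with weights `g (w l)` applied to the
flow `ν`. -/
def approxMass (g : ℝ≥0∞ → ℝ≥0∞) : (List Bool → ℝ≥0∞) → ℕ → Weights → ℝ≥0∞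
  | ν, 0, _ => ν []
  | ν, n + 1, w => g (w []) *
      (approxMass g (sub false ν) n (sub false w) + approxMass g (sub true ν) n (sub true w))

/-- The total mass of the limit of the cascade. -/
def limitMass (g : ℝ≥0∞ → ℝ≥0∞) (ν : List Bool → ℝ≥0∞) (w : Weights) : ℝ≥0∞ :=
  liminf (fun n => approxMass g ν n w) atTop

/-- The mass which the limit of the cascade gives to a node. -/
def nodeMass (g : ℝ≥0∞ → ℝ≥0∞) : (List Bool → ℝ≥0∞) → Weights → List Bool → ℝ≥0∞
  | ν, w, [] => limitMass g ν w
  | ν, w, b :: l => g (w []) * nodeMass g (sub b ν) (sub b w) l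

section
variable {g : ℝ≥0∞ → ℝ≥0∞} {ν : List Bool → ℝ≥0∞}

lemma measurable_approxMass (hg : Measurable g) (ν : List Bool → ℝ≥0∞) (n : ℕ) :
    Measurable (approxMass g ν n) := by
  induction n generalizing ν with
  | zero => exact measurable_const
  | succ n ih =>
    exact (hg.comp (measurable_pi_apply _)).mul
      (((ih _).comp (measurable_sub _)).add ((ih _).comp (measurable_sub _)))

lemma measurable_limitMass (hg : Measurable g) (ν : List Bool → ℝ≥0∞) :
    Measurable (limitMass g ν) :=
  Measurable.liminf fun n => measurable_approxMass hg ν n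

lemma measurable_nodeMass (hg : Measurable g) (ν : List Bool → ℝ≥0∞) (l : List Bool) :
    Measurable fun w => nodeMass g ν w l := by
  induction l generalizing ν with
  | nil => exact measurable_limitMass hg ν
  | cons b l ih =>
    exact (hg.comp (measurable_pi_apply _)).mul ((ih _).comp (measurable_sub _))

lemma approxMass_const_mul (g : ℝ≥0∞ → ℝ≥0∞) (c : ℝ≥0∞) (ν : List Bool → ℝ≥0∞) (n : ℕ)
    (w : Weights) : approxMass g (fun l => c * ν l) n w = c * approxMass g ν n w := by
  induction n generalizing ν w with
  | zero => rfl
  | succ n ih =>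
    have := fun b => ih (sub b ν) (sub b w)
    simp only [approxMass]
    rw [show sub false (fun l => c * ν l) = fun l => c * sub false ν l from rfl,
      show sub true (fun l => c * ν l) = fun l => c * sub true ν l from rfl, this, this]
    ring

/-- The weights below level `n`. -/
def trunc (n : ℕ) (w : Weights) : Weights := fun l => if l.length < n then w l else 0

lemma sub_trunc (b : Bool) (n : ℕ) (w : Weights) : sub b (trunc (n + 1) w) = trunc n (sub b w) := by
  funext l; simp [trunc]

lemma trunc_zero (w : Weights) : trunc 0 w = 0 := by
  funext l; simp [trunc]

lemma trunc_succ (n : ℕ) (w : Weights) :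
    trunc (n + 1) w = glue (w []) (trunc n (sub false w)) (trunc n (sub true w)) := by
  conv_lhs => rw [← glue_sub (trunc (n + 1) w)]
  rw [sub_trunc, sub_trunc]
  simp [trunc]

lemma trunc_trunc {n m : ℕ} (h : n ≤ m) (w : Weights) : trunc n (trunc m w) = trunc n w := by
  funext l
  simp only [trunc]
  split_ifs <;> first | rfl | omega

@[fun_prop] lemma measurable_trunc (n : ℕ) : Measurable (trunc n) := by
  refine measurable_pi_lambda _ fun l => ?_
  simp only [trunc]
  split_ifs
  · exact measurable_pi_apply l
  · exact measurable_const

lemma approxMass_trunc (g : ℝ≥0∞ → ℝ≥0∞) (ν : List Bool → ℝ≥0∞) (n : ℕ) (w : Weights) :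
    approxMass g ν n (trunc n w) = approxMass g ν n w := by
  induction n generalizing ν w with
  | zero => rfl
  | succ n ih =>
    simp only [approxMass, sub_trunc, ih]
    simp [trunc]

/-- The filtration generated by the levels of the tree. -/
def levelFiltration : Filtration ℕ (inferInstance : MeasurableSpace Weights) where
  seq n := MeasurableSpace.comap (trunc n) inferInstance
  mono' n m h := by
    have : trunc n = trunc n ∘ trunc m := by funext w; exact (trunc_trunc h w).symm
    change MeasurableSpace.comap (trunc n) _ ≤ _
    rw [this, ← MeasurableSpace.comap_comp]
    exact MeasurableSpace.comap_mono (measurable_trunc n).comap_le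
  le' n := (measurable_trunc n).comap_le

end

section
variable (lam : Measure ℝ≥0∞) [IsProbabilityMeasure lam] {g : ℝ≥0∞ → ℝ≥0∞}
  {ν : List Bool → ℝ≥0∞}

lemma lintegral_approxMass (hg : Measurable g) (hg1 : ∫⁻ a, g a ∂lam = 1) (hν : IsFlow ν) (n : ℕ) :
    ∫⁻ w, approxMass g ν n w ∂treeLaw lam = ν [] := by
  induction n generalizing ν with
  | zero => simp [approxMass]
  | succ n ih =>
    simp only [approxMass, mul_add]
    have hm := fun b => measurable_approxMass hg (sub b ν) n
    have hm0 := hm false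
    have hm1 := hm true
    rw [lintegral_add_left (by fun_prop),
      lintegral_tree_mul_sub lam hg (hm _), lintegral_tree_mul_sub lam hg (hm _),
      ih (hν.sub _), ih (hν.sub _), hg1, one_mul, one_mul, hν.root]

lemma lintegral_limitMass_le (hg : Measurable g) (hg1 : ∫⁻ a, g a ∂lam = 1) (hν : IsFlow ν) :
    ∫⁻ w, limitMass g ν w ∂treeLaw lam ≤ ν [] := by
  refine (lintegral_liminf_le fun n => measurable_approxMass hg ν n).trans ?_
  simp [lintegral_approxMass lam hg hg1 hν]

/-- The martingale property, tested against functions of the first `n` levels. Fubini freezes the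
root and one subtree, so that the induction hypothesis acts on the other one; `H` is arbitrary
because freezing changes it. -/
lemma lintegral_trunc_mul_approxMass_succ (hg : Measurable g) (hg1 : ∫⁻ a, g a ∂lam = 1)
    (hν : IsFlow ν) (n : ℕ) {H : Weights → ℝ≥0∞} (hH : Measurable H) :
    ∫⁻ w, H (trunc n w) * approxMass g ν (n + 1) w ∂treeLaw lam =
      ∫⁻ w, H (trunc n w) * approxMass g ν n w ∂treeLaw lam := by
  induction n generalizing ν H with
  | zero =>
    simp only [trunc_zero]
    rw [lintegral_const_mul _ (measurable_approxMass hg _ _),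
      lintegral_const_mul _ (measurable_approxMass hg _ _), lintegral_approxMass lam hg hg1 hν,
      lintegral_approxMass lam hg hg1 hν]
  | succ n ih =>
    have hm := fun b k => measurable_approxMass hg (sub b ν) k
    have key : ∀ k, ∫⁻ w, H (trunc (n + 1) w) * approxMass g ν (k + 1) w ∂treeLaw lam =
        ∫⁻ a, g a * ((∫⁻ v, ∫⁻ u, H (glue a (trunc n u) (trunc n v)) *
            approxMass g (sub false ν) k u ∂treeLaw lam ∂treeLaw lam) +
          ∫⁻ u, ∫⁻ v, H (glue a (trunc n u) (trunc n v)) *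
            approxMass g (sub true ν) k v ∂treeLaw lam ∂treeLaw lam) ∂lam := by
      intro k
      have hm0 := hm false k
      have hm1 := hm true k
      simp only [trunc_succ, approxMass]
      rw [lintegral_tree lam (f := fun a u v => H (glue a (trunc n u) (trunc n v)) *
        (g a * (approxMass g (sub false ν) k u + approxMass g (sub true ν) k v))) (by fun_prop)]
      refine lintegral_congr fun a => ?_
      rw [lintegral_lintegral_swap (f := fun v u => H (glue a (trunc n u) (trunc n v)) *
            approxMass g (sub false ν) k u) (Measurable.aemeasurable (by fun_prop)),
        ← lintegral_add_left (by fun_prop), ← lintegral_const_mul _ (by fun_prop)]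
      refine lintegral_congr fun u => ?_
      rw [← lintegral_add_left (by fun_prop), ← lintegral_const_mul _ (by fun_prop)]
      refine lintegral_congr fun v => ?_
      ring
    rw [key, key]
    refine lintegral_congr fun a => ?_
    congr 2
    · refine lintegral_congr fun v => ?_
      exact ih (hν.sub _) (H := fun u => H (glue a u (trunc n v))) (by fun_prop)
    · refine lintegral_congr fun u => ?_
      exact ih (hν.sub _) (H := fun v => H (glue a (trunc n u) v)) (by fun_prop)

lemma ae_approxMass_lt_top (hg : Measurable g) (hg1 : ∫⁻ a, g a ∂lam = 1)
    (hν : IsFlow ν) (hν' : ν [] ≠ ∞) : ∀ᵐ w ∂treeLaw lam, ∀ n, approxMass g ν n w < ∞ :=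
  ae_all_iff.2 fun n => ae_lt_top (measurable_approxMass hg ν n)
    (by rw [lintegral_approxMass lam hg hg1 hν]; exact hν')

lemma martingale_approxMass (hg : Measurable g) (hg1 : ∫⁻ a, g a ∂lam = 1)
    (hν : IsFlow ν) (hν' : ν [] ≠ ∞) :
    Martingale (fun n w => (approxMass g ν n w).toReal) levelFiltration (treeLaw lam) := by
  have hfin := ae_all_iff.1 (ae_approxMass_lt_top lam hg hg1 hν hν')
  have hm := measurable_approxMass hg ν
  refine martingale_of_setIntegral_eq_succ ?_ ?_ ?_
  · intro n
    have : (fun w => (approxMass g ν n w).toReal) =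
        (fun w => (approxMass g ν n w).toReal) ∘ trunc n := by
      funext w; simp [approxMass_trunc]
    have h2 : Measurable[MeasurableSpace.comap (trunc n) inferInstance]
        ((fun w => (approxMass g ν n w).toReal) ∘ trunc n) :=
      (hm n).ennreal_toReal.comp (comap_measurable (trunc n))
    rw [← this] at h2
    exact Measurable.stronglyMeasurable h2
  · intro n
    exact integrable_toReal_of_lintegral_ne_top (hm n).aemeasurable
      (by rw [lintegral_approxMass lam hg hg1 hν]; exact hν')
  · rintro n s ⟨t, ht, rfl⟩
    have hs : MeasurableSet (trunc n ⁻¹' t) := ht.preimage (measurable_trunc n)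
    rw [integral_toReal (hm n).aemeasurable (ae_restrict_of_ae (hfin n)),
      integral_toReal (hm (n + 1)).aemeasurable (ae_restrict_of_ae (hfin (n + 1)))]
    congr 1
    have h := fun k => lintegral_indicator hs (μ := treeLaw lam) (approxMass g ν k)
    rw [← h, ← h]
    have := lintegral_trunc_mul_approxMass_succ lam hg hg1 hν n
      (H := t.indicator 1) (measurable_one.indicator ht)
    have e : ∀ k w, (trunc n ⁻¹' t).indicator (approxMass g ν k) w =
        t.indicator 1 (trunc n w) * approxMass g ν k w := by
      intro k w
      by_cases hw : trunc n w ∈ t <;> simp [Set.indicator, hw]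
    simp_rw [e]
    exact this.symm

/-- The martingale is bounded in `L¹` by `ν []`, so it converges almost surely to a finite limit,
which must be the lower limit used as definition. -/
lemma ae_tendsto_approxMass (hg : Measurable g) (hg1 : ∫⁻ a, g a ∂lam = 1)
    (hν : IsFlow ν) (hν' : ν [] ≠ ∞) :
    ∀ᵐ w ∂treeLaw lam, limitMass g ν w < ∞ ∧
      Tendsto (fun n => approxMass g ν n w) atTop (𝓝 (limitMass g ν w)) := by
  have h := (martingale_approxMass lam hg hg1 hν hν').submartingale.exists_ae_tendsto_of_bdd
    (R := (ν []).toNNReal) fun n => by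
      rw [eLpNorm_one_eq_lintegral_enorm, ENNReal.coe_toNNReal hν',
        ← lintegral_approxMass lam hg hg1 hν n]
      refine lintegral_mono fun w => ?_
      rw [Real.enorm_eq_ofReal ENNReal.toReal_nonneg]
      exact ENNReal.ofReal_toReal_le
  filter_upwards [h, ae_approxMass_lt_top lam hg hg1 hν hν'] with w ⟨c, hw⟩ hfin
  have h2 := (ENNReal.continuous_ofReal.tendsto _).comp hw
  simp only [Function.comp_def, ENNReal.ofReal_toReal (hfin _).ne] at h2
  rw [limitMass, h2.liminf_eq]
  exact ⟨ENNReal.ofReal_lt_top, h2⟩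

/-- The weights for which the cascade converges in all subtrees. -/
structure IsRegular (g : ℝ≥0∞ → ℝ≥0∞) (ν : List Bool → ℝ≥0∞) (w : Weights) : Prop where
  weight_lt_top : ∀ l, g (w l) < ∞
  mass_lt_top : ∀ l, limitMass g (subAt l ν) (subAt l w) < ∞
  tendsto : ∀ l, Tendsto (fun n => approxMass g (subAt l ν) n (subAt l w)) atTop
    (𝓝 (limitMass g (subAt l ν) (subAt l w)))

lemma IsFlow.ne_top {ν : List Bool → ℝ≥0∞} (hν : IsFlow ν) (hν' : ν [] ≠ ∞) (l : List Bool) :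
    ν l ≠ ∞ := by
  induction l using List.reverseRecOn with
  | nil => exact hν'
  | append_singleton l b ih =>
    rw [hν l, ENNReal.add_ne_top] at ih
    cases b
    · exact ih.1
    · exact ih.2

lemma ae_isRegular (hg : Measurable g) (hg1 : ∫⁻ a, g a ∂lam = 1)
    (hν : IsFlow ν) (hν' : ν [] ≠ ∞) : ∀ᵐ w ∂treeLaw lam, IsRegular g ν w := by
  have h1 : ∀ᵐ w ∂treeLaw lam, ∀ l, g (w l) < ∞ :=
    ae_forall_weight lam (ae_lt_top hg (by simp [hg1]))
  filter_upwards [h1, ae_forall_subAt lam fun l =>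
    ae_tendsto_approxMass lam hg hg1 (hν.subAt l) (by simpa using hν.ne_top hν' l)] with w hw1 hw2
  exact ⟨hw1, fun l => (hw2 l).1, fun l => (hw2 l).2⟩

end

section
variable {g : ℝ≥0∞ → ℝ≥0∞} {ν : List Bool → ℝ≥0∞} {w : Weights}

lemma IsRegular.sub (h : IsRegular g ν w) (b : Bool) : IsRegular g (sub b ν) (sub b w) :=
  ⟨fun l => h.1 (b :: l), fun l => h.2 (b :: l), fun l => h.3 (b :: l)⟩

lemma IsRegular.limitMass_eq (h : IsRegular g ν w) :
    limitMass g ν w = g (w []) * (limitMass g (Cascade.sub false ν) (Cascade.sub false w) +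
      limitMass g (Cascade.sub true ν) (Cascade.sub true w)) := by
  have h0 := (tendsto_add_atTop_iff_nat 1).2 (h.3 [])
  have h1 := ENNReal.Tendsto.const_mul ((h.3 [false]).add (h.3 [true])) (Or.inr (h.1 []).ne)
  exact tendsto_nhds_unique h0 h1

lemma IsRegular.isFlow_nodeMass (h : IsRegular g ν w) : IsFlow (nodeMass g ν w) := by
  intro l
  induction l generalizing ν w with
  | nil => simp only [List.nil_append, nodeMass]; rw [h.limitMass_eq]; ring
  | cons b l ih => simp only [List.cons_append, nodeMass]; rw [ih (h.sub b)]; ring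

lemma IsRegular.nodeMass_lt_top (h : IsRegular g ν w) (l : List Bool) : nodeMass g ν w l < ∞ := by
  induction l generalizing ν w with
  | nil => exact h.2 []
  | cons b l ih => exact ENNReal.mul_lt_top (h.1 []) (ih (h.sub b))

end

end Cascade

/-! ### Non-degeneracy of the cascade started from Lebesgue measure -/

namespace Cascade

/-- The flow of Lebesgue measure: a node of level `n` has mass `2⁻ⁿ`. -/
def leb : List Bool → ℝ≥0∞ := fun l => 2⁻¹ ^ l.length

lemma isFlow_leb : IsFlow leb := by
  intro l
  simp only [leb, List.length_append, List.length_cons, List.length_nil, zero_add, pow_succ]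
  rw [← mul_add, ENNReal.inv_two_add_inv_two, mul_one]

lemma sub_leb (b : Bool) : sub b leb = fun l => 2⁻¹ * leb l := by
  funext l; simp [leb, pow_succ, mul_comm]

lemma limitMass_const_mul (g : ℝ≥0∞ → ℝ≥0∞) {c : ℝ≥0∞} (hc : c ≠ ∞) (ν : List Bool → ℝ≥0∞)
    (w : Weights) : limitMass g (fun l => c * ν l) w = c * limitMass g ν w := by
  simp only [limitMass, approxMass_const_mul]
  exact ENNReal.liminf_const_mul_of_ne_top hc

lemma nodeMass_const_mul (g : ℝ≥0∞ → ℝ≥0∞) {c : ℝ≥0∞} (hc : c ≠ ∞) (ν : List Bool → ℝ≥0∞)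
    (w : Weights) (l : List Bool) : nodeMass g (fun l => c * ν l) w l = c * nodeMass g ν w l := by
  induction l generalizing ν w with
  | nil => exact limitMass_const_mul g hc ν w
  | cons b l ih =>
    simp only [nodeMass]
    rw [show sub b (fun l => c * ν l) = fun l => c * sub b ν l from rfl, ih]
    ring

/-- The total mass of the `n`-th approximation of the cascade started from Lebesgue measure. -/
def lebApprox (n : ℕ) (w : Weights) : ℝ≥0∞ := approxMass id leb n w

/-- The total mass of the cascade started from Lebesgue measure. -/
def lebMass (w : Weights) : ℝ≥0∞ := limitMass id leb w

/-- The mass of a node in the cascade started from Lebesgue measure. -/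
def lebNode (w : Weights) (l : List Bool) : ℝ≥0∞ := nodeMass id leb w l

@[fun_prop] lemma measurable_lebApprox (n : ℕ) : Measurable (lebApprox n) :=
  measurable_approxMass measurable_id _ _

@[fun_prop] lemma measurable_lebMass : Measurable lebMass := measurable_limitMass measurable_id _

lemma measurable_lebNode (l : List Bool) : Measurable fun w => lebNode w l :=
  measurable_nodeMass measurable_id _ _

lemma lebNode_nil (w : Weights) : lebNode w [] = lebMass w := rfl

lemma lebNode_cons (w : Weights) (b : Bool) (l : List Bool) :
    lebNode w (b :: l) = w [] * 2⁻¹ * lebNode (sub b w) l := by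
  simp only [lebNode, nodeMass, sub_leb, id]
  rw [nodeMass_const_mul _ (by simp), mul_assoc]

lemma lebApprox_zero (w : Weights) : lebApprox 0 w = 1 := by simp [lebApprox, approxMass, leb]

lemma lebApprox_succ (n : ℕ) (w : Weights) : lebApprox (n + 1) w =
    w [] * 2⁻¹ * (lebApprox n (sub false w) + lebApprox n (sub true w)) := by
  simp only [lebApprox, approxMass, sub_leb, approxMass_const_mul, id]
  ring

lemma lebMass_eq {w : Weights} (h : IsRegular id leb w) :
    lebMass w = w [] * 2⁻¹ * (lebMass (sub false w) + lebMass (sub true w)) := by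
  rw [lebMass, h.limitMass_eq]
  simp only [lebMass, sub_leb, id]
  rw [limitMass_const_mul _ (by simp), limitMass_const_mul _ (by simp)]
  ring

lemma lintegral_rpow_le {α : Type*} [MeasurableSpace α] (μ : Measure α) [IsProbabilityMeasure μ]
    {f : α → ℝ≥0∞} (hf : Measurable f) {h : ℝ} (h0 : 0 ≤ h) (h1 : h ≤ 1) :
    ∫⁻ x, f x ^ h ∂μ ≤ (∫⁻ x, f x ∂μ) ^ h := by
  have := ENNReal.lintegral_mul_norm_pow_le (μ := μ) hf.aemeasurable
    (g := fun _ => 1) aemeasurable_const h0 (sub_nonneg.2 h1) (by ring)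
  simpa using this

lemma tendsto_rpow_one (x : ℝ≥0∞) {h : ℕ → ℝ} (hh : Tendsto h atTop (𝓝 1)) (h0 : ∀ k, 0 < h k) :
    Tendsto (fun k => x ^ h k) atTop (𝓝 x) := by
  rcases eq_or_ne x ∞ with rfl | hx
  · simp [ENNReal.top_rpow_of_pos (h0 _)]
  rcases eq_or_ne x 0 with rfl | hx0
  · simp [ENNReal.zero_rpow_of_pos (h0 _)]
  have hr := ENNReal.toReal_pos hx0 hx
  have h1 := (tendsto_const_nhds (x := x.toReal)).rpow hh (Or.inl hr.ne')
  rw [Real.rpow_one] at h1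
  have h2 := ENNReal.tendsto_ofReal h1
  rw [ENNReal.ofReal_toReal hx] at h2
  refine h2.congr fun k => ?_
  rw [← ENNReal.ofReal_rpow_of_pos hr, ENNReal.ofReal_toReal hx]

/-- One has `p ^ h - p ≤ (1 - h) p ^ h (-log p)`. One factor `p ^ (h / 2)` absorbs the logarithm:
from `-log p ≤ 4 (p ^ (-1/4) - 1)` and `p ^ (h / 2) ≤ p ^ (1/4)` it follows that `p ^ (h / 2) (-log
p) ≤ 4 (1 - p ^ (1/4)) ≤ 4 (1 - p) ^ (h / 2)`. -/
lemma rpow_sub_self_le {p h : ℝ} (hp : 0 ≤ p) (hp1 : p ≤ 1) (h0 : 1 / 2 ≤ h) (h1 : h ≤ 1) :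
    p ^ h ≤ p + 4 * (1 - h) * (p * (1 - p)) ^ (h / 2) := by
  rcases hp.eq_or_lt with rfl | hp
  · rw [Real.zero_rpow (by linarith)]
    simp only [zero_mul, zero_add]
    exact mul_nonneg (by linarith) (Real.rpow_nonneg le_rfl _)
  have e1 : p ^ h - p ≤ p ^ h * ((1 - h) * -Real.log p) := by
    have : p = p ^ h * Real.exp ((1 - h) * Real.log p) := by
      rw [Real.rpow_def_of_pos hp, ← Real.exp_add]
      rw [show Real.log p * h + (1 - h) * Real.log p = Real.log p by ring, Real.exp_log hp]
    have h3 := Real.add_one_le_exp ((1 - h) * Real.log p)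
    have h4 : 0 ≤ p ^ h := Real.rpow_nonneg hp.le _
    nlinarith
  have e2 : -Real.log p ≤ 4 * (p ^ (-(1 / 4) : ℝ) - 1) := by
    have := Real.log_le_sub_one_of_pos (Real.rpow_pos_of_pos hp (-(1 / 4)))
    rw [Real.log_rpow hp] at this
    linarith
  have e3 : p ^ (h / 2) * (p ^ (-(1 / 4) : ℝ) - 1) ≤ (1 - p) ^ (h / 2) := by
    have a1 : p ^ (h / 2) ≤ p ^ (1 / 4 : ℝ) :=
      Real.rpow_le_rpow_of_exponent_ge hp hp1 (by linarith)
    have a2 : 1 ≤ p ^ (-(1 / 4) : ℝ) :=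
      Real.one_le_rpow_of_pos_of_le_one_of_nonpos hp hp1 (by norm_num)
    have a3 : p ^ (1 / 4 : ℝ) * p ^ (-(1 / 4) : ℝ) = 1 := by
      rw [← Real.rpow_add hp]; norm_num
    have a4 : p ≤ p ^ (1 / 4 : ℝ) := by
      simpa using Real.rpow_le_rpow_of_exponent_ge hp hp1 (show (1 / 4 : ℝ) ≤ 1 by norm_num)
    have a5 : 1 - p ≤ (1 - p) ^ (h / 2) := by
      simpa using Real.rpow_le_rpow_of_exponent_ge' (sub_nonneg.2 hp1) (by linarith)
        (show 0 ≤ h / 2 by linarith) (show h / 2 ≤ 1 by linarith)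
    nlinarith
  have e4 : p ^ h = p ^ (h / 2) * p ^ (h / 2) := by rw [← Real.rpow_add hp]; ring_nf
  rw [Real.mul_rpow hp.le (sub_nonneg.2 hp1)]
  have hq : 0 ≤ p ^ (h / 2) := Real.rpow_nonneg hp.le _
  have e5 : p ^ h * ((1 - h) * -Real.log p) ≤ p ^ h * ((1 - h) * (4 * (p ^ (-(1 / 4) : ℝ) - 1))) :=
    mul_le_mul_of_nonneg_left (mul_le_mul_of_nonneg_left e2 (by linarith))
      (Real.rpow_nonneg hp.le _)
  have e6 : p ^ h * ((1 - h) * (4 * (p ^ (-(1 / 4) : ℝ) - 1))) ≤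
      4 * (1 - h) * (p ^ (h / 2) * (1 - p) ^ (h / 2)) := by
    rw [e4]
    have := mul_le_mul_of_nonneg_left e3 (mul_nonneg (show 0 ≤ 4 * (1 - h) by linarith) hq)
    linarith
  linarith

/-- The defect of additivity of `t ↦ t ^ h` is of order `1 - h`, with a coefficient that factorizes
and hence becomes a product of expectations for independent `x`, `y`. By homogeneity one may take `x
+ y = 1` and apply `rpow_sub_self_le` to both terms. -/
lemma rpow_add_rpow_le_real {x y h : ℝ} (hx : 0 ≤ x) (hy : 0 ≤ y) (h0 : 1 / 2 ≤ h) (h1 : h ≤ 1) :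
    x ^ h + y ^ h ≤ (x + y) ^ h + 8 * (1 - h) * (x ^ (h / 2) * y ^ (h / 2)) := by
  rcases (add_nonneg hx hy).eq_or_lt with hs | hs
  · have hx0 : x = 0 := by linarith
    have hy0 : y = 0 := by linarith
    subst hx0 hy0
    rw [Real.zero_rpow (by linarith), Real.zero_rpow (by linarith)]
    simp [Real.zero_rpow (show h ≠ 0 by linarith)]
  set S := x + y
  have hp0 : 0 ≤ x / S := by positivity
  have hq0 : 0 ≤ y / S := by positivity
  have hpq : x / S + y / S = 1 := by rw [← add_div, div_self hs.ne']
  have a1 := rpow_sub_self_le hp0 (by linarith) h0 h1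
  have a2 := rpow_sub_self_le hq0 (by linarith) h0 h1
  rw [show 1 - x / S = y / S by linarith] at a1
  rw [show 1 - y / S = x / S by linarith, mul_comm (y / S)] at a2
  have hxS : x ^ h = S ^ h * (x / S) ^ h := by
    rw [← Real.mul_rpow hs.le hp0, mul_div_cancel₀ _ hs.ne']
  have hyS : y ^ h = S ^ h * (y / S) ^ h := by
    rw [← Real.mul_rpow hs.le hq0, mul_div_cancel₀ _ hs.ne']
  have hxy : x ^ (h / 2) * y ^ (h / 2) = S ^ h * (x / S * (y / S)) ^ (h / 2) := by
    rw [show S ^ h = (S * S) ^ (h / 2) by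
      rw [Real.mul_rpow hs.le hs.le, ← Real.rpow_add hs]; ring_nf,
      ← Real.mul_rpow hx hy, ← Real.mul_rpow (by positivity) (by positivity)]
    congr 1
    field_simp
  rw [hxy, hxS, hyS]
  have := mul_le_mul_of_nonneg_left (add_le_add a1 a2) (Real.rpow_nonneg hs.le h)
  have h9 : S ^ h * (x / S) + S ^ h * (y / S) = S ^ h := by rw [← mul_add, hpq, mul_one]
  linarith

lemma rpow_add_rpow_le (x y : ℝ≥0∞) {h : ℝ} (h0 : 1 / 2 ≤ h) (h1 : h ≤ 1) :
    x ^ h + y ^ h ≤ (x + y) ^ h + ENNReal.ofReal (8 * (1 - h)) * (x ^ (h / 2) * y ^ (h / 2)) := by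
  have hh : 0 < h := by linarith
  rcases eq_or_ne x ∞ with rfl | hx
  · simp [hh]
  rcases eq_or_ne y ∞ with rfl | hy
  · simp [hh]
  rw [← ENNReal.ofReal_toReal hx, ← ENNReal.ofReal_toReal hy]
  have hx0 := ENNReal.toReal_nonneg (a := x)
  have hy0 := ENNReal.toReal_nonneg (a := y)
  have h2 : 0 ≤ h / 2 := by linarith
  rw [← ENNReal.ofReal_add hx0 hy0, ENNReal.ofReal_rpow_of_nonneg hx0 hh.le,
    ENNReal.ofReal_rpow_of_nonneg hy0 hh.le, ENNReal.ofReal_rpow_of_nonneg (by positivity) hh.le,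
    ENNReal.ofReal_rpow_of_nonneg hx0 h2, ENNReal.ofReal_rpow_of_nonneg hy0 h2,
    ← ENNReal.ofReal_mul (by positivity), ← ENNReal.ofReal_mul (by linarith),
    ← ENNReal.ofReal_add (by positivity) (by positivity),
    ← ENNReal.ofReal_add (by positivity)
      (mul_nonneg (by linarith) (by positivity))]
  exact ENNReal.ofReal_le_ofReal (rpow_add_rpow_le_real hx0 hy0 h0 h1)

section
variable (lam : Measure ℝ≥0∞) [IsProbabilityMeasure lam]

lemma lintegral_lebApprox (h1 : ∫⁻ a, a ∂lam = 1) (n : ℕ) :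
    ∫⁻ w, lebApprox n w ∂treeLaw lam = 1 := by
  simpa [leb, lebApprox] using lintegral_approxMass lam measurable_id h1 isFlow_leb n

lemma lintegral_lebMass_le (h1 : ∫⁻ a, a ∂lam = 1) : ∫⁻ w, lebMass w ∂treeLaw lam ≤ 1 := by
  simpa [leb, lebMass] using lintegral_limitMass_le lam measurable_id h1 isFlow_leb

lemma ae_isRegular_leb (h1 : ∫⁻ a, a ∂lam = 1) : ∀ᵐ w ∂treeLaw lam, IsRegular id leb w :=
  ae_isRegular lam measurable_id h1 isFlow_leb (by simp [leb])

/-- Jensen's inequality for the martingale and the concave function `t ↦ t ^ h`. The affine form `a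
* Y + b` lets the induction replace level `n + 1` by level `n` in one subtree at a time, the other
being part of the constant `b`. -/
lemma lintegral_rpow_lebApprox_succ_le (h1 : ∫⁻ a, a ∂lam = 1) {h : ℝ} (hh0 : 0 ≤ h) (hh1 : h ≤ 1)
    (n : ℕ) (a b : ℝ≥0∞) :
    ∫⁻ w, (a * lebApprox (n + 1) w + b) ^ h ∂treeLaw lam ≤
      ∫⁻ w, (a * lebApprox n w + b) ^ h ∂treeLaw lam := by
  induction n generalizing a b with
  | zero =>
    refine (lintegral_rpow_le _ (by fun_prop) hh0 hh1).trans ?_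
    rw [lintegral_add_right _ (by fun_prop), lintegral_const_mul _ (by fun_prop),
      lintegral_lebApprox lam h1]
    simp [lebApprox_zero]
  | succ n ih =>
    have key : ∀ k, ∫⁻ w, (a * lebApprox (k + 1) w + b) ^ h ∂treeLaw lam =
        ∫⁻ x, ∫⁻ u, ∫⁻ v, (a * (x * 2⁻¹ * (lebApprox k u + lebApprox k v)) + b) ^ h
          ∂treeLaw lam ∂treeLaw lam ∂lam := by
      intro k
      simp only [lebApprox_succ]
      exact lintegral_tree lam
        (f := fun x u v => (a * (x * 2⁻¹ * (lebApprox k u + lebApprox k v)) + b) ^ h) (by fun_prop)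
    rw [key, key]
    refine lintegral_mono fun x => ?_
    have e : ∀ p q : ℝ≥0∞, a * (x * 2⁻¹ * (p + q)) + b =
        a * (x * 2⁻¹) * q + (a * (x * 2⁻¹) * p + b) := fun p q => by ring
    have e' : ∀ p q : ℝ≥0∞, a * (x * 2⁻¹ * (p + q)) + b =
        a * (x * 2⁻¹) * p + (a * (x * 2⁻¹) * q + b) := fun p q => by ring
    calc _ ≤ ∫⁻ u, ∫⁻ v, (a * (x * 2⁻¹ * (lebApprox (n + 1) u + lebApprox n v)) + b) ^ h
          ∂treeLaw lam ∂treeLaw lam := by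
          refine lintegral_mono fun u => ?_
          simp only [e]
          exact ih _ _
      _ = ∫⁻ v, ∫⁻ u, (a * (x * 2⁻¹ * (lebApprox (n + 1) u + lebApprox n v)) + b) ^ h
          ∂treeLaw lam ∂treeLaw lam := lintegral_lintegral_swap (by fun_prop)
      _ ≤ ∫⁻ v, ∫⁻ u, (a * (x * 2⁻¹ * (lebApprox n u + lebApprox n v)) + b) ^ h
          ∂treeLaw lam ∂treeLaw lam := by
          refine lintegral_mono fun v => ?_
          simp only [e']
          exact ih _ _
      _ = _ := lintegral_lintegral_swap (by fun_prop)

/-- Write `E`, `D`, `c` for the moments of `Y_n` of orders `h`, `h / 2`, `1 / 2`, and `S` for the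
moment of order `h` of a sum of two independent copies. Near-additivity gives `2E ≤ S + 8(1 - h)D²`,
while `E[W ^ h] 2 ^ (-h) S = E[Y_{n+1} ^ h] ≤ E` and the entropy bound give `S ≤ 2 · 2 ^ (-(1 - h)κ)
E`. The terms `2E` cancel to first order in `1 - h`, leaving `κ E ≤ 8 D² ≤ 8c`. Then `h → 1` turns
`E` into the mean `1`. -/
lemma le_lintegral_sqrt_lebApprox (h1 : ∫⁻ a, a ∂lam = 1) {κ : ℝ} (hκ0 : 0 < κ) (hκ1 : κ ≤ 1)
    (hκ : ∀ h : ℝ, 0 < h → h < 1 →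
      ENNReal.ofReal (2 ^ (-((1 - h) * (1 - κ)))) ≤ ∫⁻ a, a ^ h ∂lam) (n : ℕ) :
    ENNReal.ofReal κ ≤ 8 * ∫⁻ w, lebApprox n w ^ (1 / 2 : ℝ) ∂treeLaw lam := by
  set c := ∫⁻ w, lebApprox n w ^ (1 / 2 : ℝ) ∂treeLaw lam with hc
  have hle : ∀ h : ℝ, 0 ≤ h → h ≤ 1 → ∫⁻ w, lebApprox n w ^ h ∂treeLaw lam ≤ 1 := by
    intro h h0 h1'
    refine (lintegral_rpow_le _ (by fun_prop) h0 h1').trans ?_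
    simp [lintegral_lebApprox lam h1]
  have hc1 : c ≤ 1 := hle _ (by norm_num) (by norm_num)
  have key : ∀ h : ℝ, 1 / 2 < h → h < 1 →
      ENNReal.ofReal κ * ∫⁻ w, lebApprox n w ^ h ∂treeLaw lam ≤ 8 * c := by
    intro h hh0 hh1
    set E := ∫⁻ w, lebApprox n w ^ h ∂treeLaw lam with hE
    set D := ∫⁻ w, lebApprox n w ^ (h / 2) ∂treeLaw lam with hD
    set S := ∫⁻ u, ∫⁻ v, (lebApprox n u + lebApprox n v) ^ h ∂treeLaw lam ∂treeLaw lam with hS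
    have hE1 : E ≤ 1 := hle _ (by linarith) (by linarith)
    have hD1 : D ≤ 1 := hle _ (by linarith) (by linarith)
    -- Jensen gives `D ≤ c ^ h`; since `c ≤ 1` and `2h ≥ 1`, squaring gives `D² ≤ c`.
    have hDc : D * D ≤ c := by
      have h2 : D ≤ c ^ h := by
        rw [hD, hc]
        convert lintegral_rpow_le (treeLaw lam) (f := fun w => lebApprox n w ^ (1 / 2 : ℝ))
          (by fun_prop) (h := h) (by linarith) hh1.le using 3 with w
        rw [← ENNReal.rpow_mul]; ring_nf
      calc D * D ≤ c ^ h * c ^ h := mul_le_mul' h2 h2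
        _ = c ^ (h + h) := (ENNReal.rpow_add_of_nonneg _ _ (by linarith) (by linarith)).symm
        _ ≤ c ^ (1 : ℝ) := ENNReal.rpow_le_rpow_of_exponent_ge hc1 (by linarith)
        _ = c := ENNReal.rpow_one c
    have hES : 2 * E ≤ S + ENNReal.ofReal (8 * (1 - h)) * (D * D) := by
      calc 2 * E = ∫⁻ u, ∫⁻ v, (lebApprox n u ^ h + lebApprox n v ^ h)
            ∂treeLaw lam ∂treeLaw lam := by
            simp_rw [lintegral_add_left (measurable_const)]
            rw [lintegral_add_left (by fun_prop)]
            simp [← hE, two_mul]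
        _ ≤ ∫⁻ u, ∫⁻ v, ((lebApprox n u + lebApprox n v) ^ h + ENNReal.ofReal (8 * (1 - h)) *
              (lebApprox n u ^ (h / 2) * lebApprox n v ^ (h / 2))) ∂treeLaw lam ∂treeLaw lam :=
            lintegral_mono fun u => lintegral_mono fun v => rpow_add_rpow_le _ _ hh0.le hh1.le
        _ = S + ∫⁻ u, ∫⁻ v, ENNReal.ofReal (8 * (1 - h)) *
              (lebApprox n u ^ (h / 2) * lebApprox n v ^ (h / 2)) ∂treeLaw lam ∂treeLaw lam := by
            rw [hS, ← lintegral_add_left (by fun_prop)]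
            refine lintegral_congr fun u => ?_
            rw [lintegral_add_left (by fun_prop)]
        _ = _ := by
            congr 1
            have : ∀ u, ∫⁻ v, ENNReal.ofReal (8 * (1 - h)) *
                (lebApprox n u ^ (h / 2) * lebApprox n v ^ (h / 2)) ∂treeLaw lam =
                ENNReal.ofReal (8 * (1 - h)) * (lebApprox n u ^ (h / 2) * D) := by
              intro u
              rw [lintegral_const_mul _ (by fun_prop), lintegral_const_mul _ (by fun_prop)]
            simp_rw [this]
            rw [lintegral_const_mul _ (by fun_prop), lintegral_mul_const _ (by fun_prop)]
    have hSE : ENNReal.ofReal (2 ^ (-((1 - h) * (1 - κ)))) * (ENNReal.ofReal (2 ^ (-h)) * S) ≤ E := by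
      have e1 : ∫⁻ w, lebApprox (n + 1) w ^ h ∂treeLaw lam =
          (∫⁻ a, a ^ h ∂lam) * (ENNReal.ofReal (2 ^ (-h)) * S) := by
        simp only [lebApprox_succ]
        rw [lintegral_tree lam (f := fun a u v => (a * 2⁻¹ * (lebApprox n u + lebApprox n v)) ^ h)
          (by fun_prop), ← lintegral_mul_const _ (by fun_prop)]
        refine lintegral_congr fun a => ?_
        rw [hS, ← mul_assoc, ← lintegral_const_mul _ (by fun_prop)]
        refine lintegral_congr fun u => ?_
        rw [← lintegral_const_mul _ (by fun_prop)]
        refine lintegral_congr fun v => ?_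
        rw [ENNReal.mul_rpow_of_nonneg _ _ (by linarith),
          ENNReal.mul_rpow_of_nonneg _ _ (by linarith), Real.rpow_neg (by norm_num),
          ENNReal.ofReal_inv_of_pos (by positivity), ENNReal.inv_rpow,
          ← ENNReal.ofReal_rpow_of_pos (by norm_num)]
        simp
      have e2 := lintegral_rpow_lebApprox_succ_le lam h1 (h := h) (by linarith) hh1.le n 1 0
      simp only [one_mul, add_zero] at e2
      rw [e1] at e2
      exact (mul_le_mul_left (hκ h (by linarith) hh1) _).trans e2
    have hSfin : S ≠ ∞ := by
      intro hS'
      rw [hS', ENNReal.mul_top (by simp; positivity), ENNReal.mul_top (by simp; positivity)] at hSE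
      exact absurd (hSE.trans hE1) (by simp)
    have hEfin : E ≠ ∞ := (hE1.trans_lt ENNReal.one_lt_top).ne
    have hDfin : D ≠ ∞ := (hD1.trans_lt ENNReal.one_lt_top).ne
    refine le_trans ?_ (mul_le_mul_right hDc 8)
    clear_value E D S
    lift E to ℝ≥0 using hEfin
    lift D to ℝ≥0 using hDfin
    lift S to ℝ≥0 using hSfin
    have hκh : 0 ≤ 8 * (1 - h) := by linarith
    have r1 : 2 * (E : ℝ) ≤ S + 8 * (1 - h) * (D * D) := by
      have := (ENNReal.toReal_le_toReal (by finiteness) (by finiteness)).2 hES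
      rw [ENNReal.toReal_add (by finiteness) (by finiteness),
        ENNReal.toReal_mul (a := ENNReal.ofReal _), ENNReal.toReal_ofReal hκh] at this
      simpa using this
    have r2 : (2 : ℝ) ^ (-((1 - h) * (1 - κ))) * (2 ^ (-h) * S) ≤ E := by
      have := (ENNReal.toReal_le_toReal (by finiteness) (by finiteness)).2 hSE
      rw [ENNReal.toReal_mul, ENNReal.toReal_mul, ENNReal.toReal_ofReal (by positivity),
        ENNReal.toReal_ofReal (by positivity)] at this
      simpa using this
    have r3 : (S : ℝ) ≤ 2 * 2 ^ (-((1 - h) * κ)) * E := by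
      rw [← mul_assoc, ← Real.rpow_add (by norm_num)] at r2
      have h2 : (0 : ℝ) < 2 ^ (-((1 - h) * (1 - κ)) + -h) := by positivity
      have h3 : (2 : ℝ) * 2 ^ (-((1 - h) * κ)) * 2 ^ (-((1 - h) * (1 - κ)) + -h) = 1 := by
        rw [mul_assoc, ← Real.rpow_add (by norm_num),
          show -((1 - h) * κ) + (-((1 - h) * (1 - κ)) + -h) = -1 by ring]
        norm_num [Real.rpow_neg_one]
      have h4 : (0 : ℝ) < 2 * 2 ^ (-((1 - h) * κ)) := by positivity
      nlinarith [mul_le_mul_of_nonneg_left r2 h4.le]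
    have hx0 : 0 ≤ (1 - h) * κ := by nlinarith
    have hx1 : (1 - h) * κ ≤ 1 := by nlinarith
    -- Bernoulli: `(1 / 2) ^ x ≤ 1 - x / 2` for `x = (1 - h) κ` in `[0, 1]`. This gains the linear
    -- term in `1 - h` against the defect.
    have r4 : (2 : ℝ) ^ (-((1 - h) * κ)) ≤ 1 - (1 - h) * κ / 2 := by
      have hb := rpow_one_add_le_one_add_mul_self (s := (-(1 / 2) : ℝ)) (by norm_num) hx0 hx1
      rw [Real.rpow_neg (by norm_num), ← Real.inv_rpow (by norm_num)]
      norm_num at hb ⊢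
      linarith
    have r5 : κ * E ≤ 8 * (D * D) := by
      have hE0 : (0 : ℝ) ≤ E := E.2
      have : (1 - h) * (κ * E) ≤ (1 - h) * (8 * (D * D)) := by nlinarith
      exact le_of_mul_le_mul_left this (by linarith)
    have := ENNReal.ofReal_le_ofReal r5
    rw [ENNReal.ofReal_mul hκ0.le, ENNReal.ofReal_mul (by norm_num),
      ENNReal.ofReal_mul (NNReal.coe_nonneg D)] at this
    simpa using this
  -- Fatou along exponents increasing to `1`; the shift by `3` keeps them above `1 / 2`.
  have hlim : ∫⁻ w, lebApprox n w ∂treeLaw lam ≤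
      liminf (fun k : ℕ => ∫⁻ w, lebApprox n w ^ (1 - 1 / ((k : ℝ) + 3)) ∂treeLaw lam) atTop := by
    have ht : Tendsto (fun k : ℕ => 1 - 1 / ((k : ℝ) + 3)) atTop (𝓝 1) := by
      have := (tendsto_const_div_atTop_nhds_zero_nat (1 : ℝ)).comp (tendsto_add_atTop_nat 3)
      simpa using (tendsto_const_nhds (x := (1 : ℝ))).sub this
    refine le_trans (le_of_eq ?_) (lintegral_liminf_le fun k => by fun_prop)
    refine lintegral_congr fun w => (Tendsto.liminf_eq (tendsto_rpow_one _ ht fun k => ?_)).symm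
    rw [sub_pos, div_lt_one (by positivity)]
    linarith [(Nat.cast_nonneg k : (0 : ℝ) ≤ k)]
  have hfin := hlim.trans (liminf_le_of_frequently_le' (x := 8 * c / ENNReal.ofReal κ)
    (Frequently.of_forall fun k => by
      rw [ENNReal.le_div_iff_mul_le (by simp [hκ0]) (by simp), mul_comm]
      have hk : (0 : ℝ) ≤ k := Nat.cast_nonneg k
      refine key _ ?_ ?_
      · have : 1 / ((k : ℝ) + 3) ≤ 1 / 3 := by
          apply one_div_le_one_div_of_le <;> linarith
        linarith
      · have : 0 < 1 / ((k : ℝ) + 3) := by positivity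
        linarith))
  rw [lintegral_lebApprox lam h1, ENNReal.le_div_iff_mul_le (by simp [hκ0]) (by simp),
    one_mul] at hfin
  exact hfin

end

end Cascade

/-! ### Positivity, negative moments and absence of atoms -/

namespace Cascade

lemma rpow_neg_le_rpow_neg {x y : ℝ≥0∞} (h : x ≤ y) {s : ℝ} (hs : 0 ≤ s) :
    y ^ (-s) ≤ x ^ (-s) := by
  rw [ENNReal.rpow_neg, ENNReal.rpow_neg, ENNReal.inv_le_inv]
  exact ENNReal.rpow_le_rpow h hs

/-- The conditions on the law of the weights. -/
structure IsCascadeLaw (lam : Measure ℝ≥0∞) : Prop where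
  ae_pos : ∀ᵐ a ∂lam, 0 < a
  mean : ∫⁻ a, a ∂lam = 1
  -- What `E[W log₂ W] ≤ 1 - κ` yields by Jensen's inequality under the measure with density `W`; a
  -- statement about moments fits the recursion.
  entropy : ∃ κ : ℝ, 0 < κ ∧ κ ≤ 1 ∧ ∀ h : ℝ, 0 < h → h < 1 →
      ENNReal.ofReal (2 ^ (-((1 - h) * (1 - κ)))) ≤ ∫⁻ a, a ^ h ∂lam
  neg_moment : ∀ s : ℝ, 0 ≤ s → s < 1 → ∫⁻ a, a ^ (-s) ∂lam ≠ ∞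

lemma IsCascadeLaw.ae_lt_top {lam : Measure ℝ≥0∞} (h : IsCascadeLaw lam) : ∀ᵐ a ∂lam, a < ∞ :=
  MeasureTheory.ae_lt_top measurable_id (by simp [h.mean])

section
variable {lam : Measure ℝ≥0∞} [IsProbabilityMeasure lam]

lemma rpow_half_le (x : ℝ≥0∞) {R : ℝ≥0∞} (hR : R ≠ 0) (hR' : R ≠ ∞) :
    x ^ (1 / 2 : ℝ) ≤ min (x ^ (1 / 2 : ℝ)) R + x / R := by
  have hx : x = x ^ (1 / 2 : ℝ) * x ^ (1 / 2 : ℝ) := by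
    rw [← ENNReal.rpow_add_of_nonneg _ _ (by norm_num) (by norm_num)]; norm_num
  rcases le_total (x ^ (1 / 2 : ℝ)) R with h | h
  · rw [min_eq_left h]; exact le_self_add
  · refine le_add_of_nonneg_of_le zero_le ?_
    rw [ENNReal.le_div_iff_mul_le (Or.inl hR) (Or.inl hR')]
    conv_rhs => rw [hx]
    exact mul_le_mul_right h _

/-- If the limit vanished, the truncations of `√Y_n` at `R` would have expectation tending to zero,
while by `rpow_half_le` the truncated part costs at most `E[Y_n] / R = 1 / R`. This contradicts the
uniform lower bound for `E[√Y_n]`. -/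
lemma IsCascadeLaw.not_ae_lebMass_eq_zero (h : IsCascadeLaw lam) :
    ¬ ∀ᵐ w ∂treeLaw lam, lebMass w = 0 := by
  intro h0
  obtain ⟨κ, hκ0, hκ1, hκ⟩ := h.entropy
  have hlow := le_lintegral_sqrt_lebApprox lam h.mean hκ0 hκ1 hκ
  -- With this `R` the tail contributes `8 / R = κ / 2`, strictly less than `κ`.
  set R : ℝ≥0∞ := ENNReal.ofReal (16 / κ) with hRdef
  have hR : R ≠ 0 := by simp [hRdef]; positivity
  have hR' : R ≠ ∞ := ENNReal.ofReal_ne_top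
  have hlim : Tendsto (fun n => ∫⁻ w, min (lebApprox n w ^ (1 / 2 : ℝ)) R ∂treeLaw lam) atTop
      (𝓝 (∫⁻ _w, 0 ∂treeLaw lam)) := by
    refine tendsto_lintegral_of_dominated_convergence (fun _ => R) (fun n => by fun_prop)
      (fun n => Eventually.of_forall fun w => min_le_right _ _) (by simp [hR']) ?_
    filter_upwards [h0, ae_isRegular_leb lam h.mean] with w hw hreg
    have h1 : Tendsto (fun n => lebApprox n w) atTop (𝓝 0) := by
      rw [← hw]; exact hreg.3 []
    have h2 := ((ENNReal.continuous_rpow_const (y := 1 / 2)).tendsto 0).comp h1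
    have h3 := h2.min (tendsto_const_nhds (x := R))
    simpa using h3
  have hbound : ∀ n, ENNReal.ofReal κ ≤
      8 * (∫⁻ w, min (lebApprox n w ^ (1 / 2 : ℝ)) R ∂treeLaw lam + 1 / R) := by
    intro n
    refine (hlow n).trans (mul_le_mul_right ?_ 8)
    calc _ ≤ ∫⁻ w, (min (lebApprox n w ^ (1 / 2 : ℝ)) R + lebApprox n w / R) ∂treeLaw lam :=
          lintegral_mono fun w => rpow_half_le _ hR hR'
      _ = _ := by
          rw [lintegral_add_left (by fun_prop)]
          simp_rw [div_eq_mul_inv]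
          rw [lintegral_mul_const _ (by fun_prop), lintegral_lebApprox lam h.mean]
  have h1 := le_of_tendsto' (f := fun _ : ℕ => ENNReal.ofReal κ) tendsto_const_nhds (x := atTop)
    (b := ENNReal.ofReal κ) (fun _ => le_rfl)
  have h2 := ge_of_tendsto' (ENNReal.Tendsto.const_mul (hlim.add (tendsto_const_nhds (x := 1 / R)))
    (Or.inr (by simp : (8 : ℝ≥0∞) ≠ ∞))) hbound
  rw [lintegral_zero, zero_add, hRdef, one_div, ← ENNReal.ofReal_inv_of_pos (by positivity),
    show (8 : ℝ≥0∞) = ENNReal.ofReal 8 by simp, ← ENNReal.ofReal_mul (by norm_num),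
    ENNReal.ofReal_le_ofReal_iff (by positivity)] at h2
  have : 8 * (16 / κ)⁻¹ = κ / 2 := by field_simp; norm_num
  linarith

/-- If a set of weights is, up to a null set, the set of all families both of whose subtrees are in
the set, then it has probability `0` or `1`. -/
lemma measure_eq_zero_or_one {s : Set Weights} (hs : MeasurableSet s)
    (h : ∀ᵐ w ∂treeLaw lam, w ∈ s ↔ sub false w ∈ s ∧ sub true w ∈ s) :
    treeLaw lam s = 0 ∨ treeLaw lam s = 1 := by
  have h1 : treeLaw lam s = treeLaw lam s * treeLaw lam s := by
    have hm : Measurable (s.indicator (1 : Weights → ℝ≥0∞)) := measurable_one.indicator hs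
    have h2 := lintegral_tree_mul lam (f := fun _ => 1) measurable_const hm hm
    rw [lintegral_indicator_one hs, lintegral_one, measure_univ, one_mul] at h2
    conv_lhs => rw [← lintegral_indicator_one hs]
    rw [← h2]
    refine lintegral_congr_ae ?_
    filter_upwards [h] with w hw
    by_cases a : sub false w ∈ s <;> by_cases b : sub true w ∈ s <;>
      simp [Set.indicator, hw, a, b]
  rcases eq_or_ne (treeLaw lam s) 0 with h0 | h0
  · exact Or.inl h0
  · right
    have := (ENNReal.mul_right_inj h0 (measure_ne_top _ _) (b := 1)
      (c := treeLaw lam s)).1 (by rw [mul_one]; exact h1)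
    exact this.symm

/-- Since the weights are positive, the mass vanishes exactly when it vanishes in both subtrees, so
the zero-one dichotomy applies and non-degeneracy selects probability zero. -/
lemma IsCascadeLaw.ae_lebMass_pos (h : IsCascadeLaw lam) : ∀ᵐ w ∂treeLaw lam, 0 < lebMass w := by
  have hs : MeasurableSet {w : Weights | lebMass w = 0} :=
    measurable_lebMass (measurableSet_singleton 0)
  have h01 := measure_eq_zero_or_one (lam := lam) hs (by
    filter_upwards [ae_isRegular_leb lam h.mean, ae_forall_weight lam h.ae_pos] with w hw hpos
    have := (hpos []).ne'
    simp [lebMass_eq hw, this])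
  rcases h01 with h0 | h0
  · refine (ae_iff.2 ?_)
    simpa using h0
  · exact absurd ((prob_compl_eq_zero_iff hs).2 h0) fun hc => h.not_ae_lebMass_eq_zero hc

lemma exists_measure_gt_le {α : Type*} [MeasurableSpace α] {μ : Measure α} [IsFiniteMeasure μ]
    {f : α → ℝ≥0∞} (hf : Measurable f) (hfin : ∀ᵐ x ∂μ, f x < ∞) {ε : ℝ≥0∞} (hε : 0 < ε) :
    ∃ n : ℕ, μ {x | (n : ℝ≥0∞) < f x} ≤ ε := by
  have hm : ∀ n : ℕ, MeasurableSet {x | (n : ℝ≥0∞) < f x} := fun n =>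
    measurableSet_lt measurable_const hf
  have h := tendsto_measure_iInter_atTop (μ := μ) (fun n => (hm n).nullMeasurableSet)
    (fun a b hab x (hx : (b : ℝ≥0∞) < f x) => lt_of_le_of_lt (by exact_mod_cast hab) hx)
    ⟨0, measure_ne_top _ _⟩
  have h0 : μ (⋂ n : ℕ, {x | (n : ℝ≥0∞) < f x}) = 0 := by
    refine measure_mono_null (fun x hx => ?_) (ae_iff.1 hfin)
    simp only [Set.mem_iInter, Set.mem_ofPred_eq, not_lt, top_le_iff] at hx ⊢
    by_contra hne
    obtain ⟨n, hn⟩ := ENNReal.exists_nat_gt hne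
    exact absurd (hx n) hn.not_gt
  rw [h0] at h
  obtain ⟨n, hn⟩ := (h.eventually_le_const hε).exists
  exact ⟨n, hn⟩

lemma tendsto_min_nat (x : ℝ≥0∞) : Tendsto (fun n : ℕ => min x n) atTop (𝓝 x) := by
  have := (tendsto_const_nhds (x := x)).min ENNReal.tendsto_nat_nhds_top
  simpa using this

lemma min_mul_le_max_one_mul (c m T : ℝ≥0∞) : min (c * m) T ≤ max 1 c * min m T := by
  rcases le_total m T with h | h
  · rw [min_eq_left h]
    exact (min_le_left _ _).trans (mul_le_mul_left (le_max_right _ _) _)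
  · rw [min_eq_right h]
    refine (min_le_right _ _).trans ?_
    calc T = 1 * T := (one_mul T).symm
      _ ≤ _ := mul_le_mul_left (le_max_left _ _) _

/-- In `Y = (W / 2)(Y' + Y'')` the power `(Y' + Y'') ^ (-s)` is at most `B` unless `Y'' ^ (-s) > B`,
and on that event, which is independent of `Y'`, it is at most `Y' ^ (-s)`. If `B` makes the event
rarer than `1 / (2D)`, the truncated moment `A` satisfies `A ≤ D B + A / 2`. Truncation makes `A`
finite, so it can be absorbed; the resulting bound does not depend on the truncation level. -/
lemma IsCascadeLaw.lintegral_lebMass_rpow_neg_ne_top (h : IsCascadeLaw lam) {s : ℝ} (hs0 : 0 ≤ s)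
    (hs1 : s < 1) : ∫⁻ w, lebMass w ^ (-s) ∂treeLaw lam ≠ ∞ := by
  -- The maximum with `1` is what lets a factor be pulled out of a truncated quantity, as in
  -- `min_mul_le_max_one_mul`.
  set D := ∫⁻ a, max 1 ((a * 2⁻¹) ^ (-s)) ∂lam with hD
  have hDfin : D ≠ ∞ := by
    refine ne_top_of_le_ne_top (b := 1 + (∫⁻ a, a ^ (-s) ∂lam) * 2⁻¹ ^ (-s)) ?_ ?_
    · refine ENNReal.add_ne_top.2 ⟨by simp, ENNReal.mul_ne_top (h.neg_moment s hs0 hs1) ?_⟩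
      exact ENNReal.rpow_ne_top_of_ne_zero (by simp) (by simp)
    · rw [hD, ← lintegral_mul_const _ (by fun_prop)]
      calc _ ≤ ∫⁻ a, (1 + a ^ (-s) * 2⁻¹ ^ (-s)) ∂lam := by
            refine lintegral_mono_ae ?_
            filter_upwards [h.ae_pos] with a ha
            rw [ENNReal.mul_rpow_of_ne_zero ha.ne' (by simp)]
            exact max_le le_self_add le_add_self
        _ = _ := by rw [lintegral_add_left measurable_const]; simp
  have hD1 : D ≠ 0 := by
    have : (1 : ℝ≥0∞) ≤ D := by
      calc (1 : ℝ≥0∞) = ∫⁻ _a, 1 ∂lam := by simp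
        _ ≤ D := lintegral_mono fun a => le_max_left _ _
    exact (lt_of_lt_of_le zero_lt_one this).ne'
  have hYfin : ∀ᵐ w ∂treeLaw lam, lebMass w ^ (-s) < ∞ := by
    filter_upwards [h.ae_lebMass_pos, ae_isRegular_leb lam h.mean] with w hw hreg
    exact (ENNReal.rpow_ne_top_of_ne_zero hw.ne' (hreg.2 []).ne).lt_top
  obtain ⟨B, hB⟩ := exists_measure_gt_le (μ := treeLaw lam) (by fun_prop) hYfin
    (ε := (2 * D)⁻¹) (by simp [ENNReal.mul_eq_top, hDfin])
  set S := {w : Weights | (B : ℝ≥0∞) < lebMass w ^ (-s)} with hSdef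
  have hS : MeasurableSet S := measurableSet_lt measurable_const (by fun_prop)
  have hA : ∀ T : ℕ, ∫⁻ w, min (lebMass w ^ (-s)) T ∂treeLaw lam ≤ 2 * (D * B) := by
    intro T
    set A := ∫⁻ w, min (lebMass w ^ (-s)) T ∂treeLaw lam with hAdef
    have hAfin : A ≠ ∞ := by
      refine ne_top_of_le_ne_top (b := T) (by simp) ?_
      calc A ≤ ∫⁻ _w, (T : ℝ≥0∞) ∂treeLaw lam := lintegral_mono fun w => min_le_right _ _
        _ = T := by simp
    have hmain : A ≤ D * B + D * (A * treeLaw lam S) := by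
      have hmf : Measurable fun a : ℝ≥0∞ => max 1 ((a * 2⁻¹) ^ (-s)) := by fun_prop
      have hmS : Measurable (S.indicator (1 : Weights → ℝ≥0∞)) := measurable_one.indicator hS
      have e2 := lintegral_tree_mul lam hmf (g := fun w => min (lebMass w ^ (-s)) T)
        (by fun_prop) hmS
      have e1 := lintegral_tree_mul lam hmf (g := fun _ => (B : ℝ≥0∞)) measurable_const
        (h := fun _ => 1) measurable_const
      rw [lintegral_indicator_one hS] at e2
      simp only [mul_one, lintegral_const, measure_univ] at e1
      rw [← hD] at e1 e2
      rw [← hAdef] at e2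
      rw [← e1, ← e2, ← lintegral_add_left (by fun_prop)]
      refine lintegral_mono_ae ?_
      filter_upwards [ae_isRegular_leb lam h.mean, ae_forall_weight lam h.ae_pos,
        ae_subAt lam h.ae_lebMass_pos [false], ae_subAt lam h.ae_lebMass_pos [true]]
        with w hw hpos hL hR
      change 0 < lebMass (sub false w) at hL
      change 0 < lebMass (sub true w) at hR
      rw [lebMass_eq hw, ENNReal.mul_rpow_of_ne_zero (by simp [(hpos []).ne'])
        (by simp [hL.ne'])]
      refine (min_mul_le_max_one_mul _ _ _).trans ?_
      rw [← mul_add]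
      refine mul_le_mul_right ?_ _
      by_cases hRS : sub true w ∈ S
      · simp only [Set.indicator_of_mem hRS, Pi.one_apply, mul_one]
        refine le_add_of_nonneg_of_le zero_le (min_le_min ?_ le_rfl)
        exact rpow_neg_le_rpow_neg le_self_add hs0
      · simp only [Set.indicator_of_notMem hRS, mul_zero, add_zero]
        refine (min_le_left _ _).trans (le_trans ?_ (not_lt.1 hRS))
        exact rpow_neg_le_rpow_neg le_add_self hs0
    have hhalf : D * (A * treeLaw lam S) ≤ A / 2 := by
      calc D * (A * treeLaw lam S) ≤ D * (A * (2 * D)⁻¹) := by gcongr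
        _ = A / 2 * (D * D⁻¹) := by
            rw [ENNReal.mul_inv (by simp) (by simp), div_eq_mul_inv]; ring
        _ = A / 2 := by rw [ENNReal.mul_inv_cancel hD1 hDfin, mul_one]
    have h3 : A / 2 + A / 2 ≤ D * B + A / 2 := by
      rw [ENNReal.add_halves]; exact hmain.trans (add_le_add_right hhalf _)
    have h4 := (ENNReal.add_le_add_iff_right (ENNReal.div_ne_top hAfin (by simp))).1 h3
    calc A = 2 * (A / 2) := (ENNReal.mul_div_cancel (by simp) (by simp)).symm
      _ ≤ _ := mul_le_mul_right h4 2
  refine ne_top_of_le_ne_top (b := 2 * (D * B)) (by finiteness) ?_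
  calc ∫⁻ w, lebMass w ^ (-s) ∂treeLaw lam
      = ∫⁻ w, liminf (fun T : ℕ => min (lebMass w ^ (-s)) T) atTop ∂treeLaw lam :=
        lintegral_congr fun w => (tendsto_min_nat _).liminf_eq.symm
    _ ≤ liminf (fun T : ℕ => ∫⁻ w, min (lebMass w ^ (-s)) T ∂treeLaw lam) atTop :=
        lintegral_liminf_le fun T => by fun_prop
    _ ≤ 2 * (D * B) := liminf_le_of_frequently_le' (Frequently.of_forall hA)

/-- The largest mass of a node of level `n`. -/
def maxNode : ℕ → Weights → ℝ≥0∞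
  | 0, w => lebMass w
  | n + 1, w => w [] * 2⁻¹ * max (maxNode n (sub false w)) (maxNode n (sub true w))

@[fun_prop] lemma measurable_maxNode (n : ℕ) : Measurable (maxNode n) := by
  induction n with
  | zero => exact measurable_lebMass
  | succ n ih =>
    change Measurable fun w : Weights =>
      w [] * 2⁻¹ * max (maxNode n (sub false w)) (maxNode n (sub true w))
    fun_prop

lemma lebNode_le_maxNode (w : Weights) (l : List Bool) : lebNode w l ≤ maxNode l.length w := by
  induction l generalizing w with
  | nil => exact le_rfl
  | cons b l ih =>
    rw [lebNode_cons, List.length_cons, maxNode]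
    refine mul_le_mul_right ((ih _).trans ?_) _
    cases b
    · exact le_max_left _ _
    · exact le_max_right _ _

lemma maxNode_succ_le {w : Weights} (hw : IsRegular id leb w)
    (hsub : ∀ l, IsRegular id leb (subAt l w)) (n : ℕ) :
    maxNode (n + 1) w ≤ maxNode n w := by
  induction n generalizing w with
  | zero =>
    simp only [maxNode]
    rw [lebMass_eq hw]
    exact mul_le_mul_right (max_le le_self_add le_add_self) _
  | succ n ih =>
    rw [maxNode, maxNode]
    exact mul_le_mul_right (max_le_max (ih (hsub [false]) fun l => hsub (false :: l))
      (ih (hsub [true]) fun l => hsub (true :: l))) _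

/-- The limit `A` of the largest node masses satisfies `A = (W / 2) max(A', A'')`. Since `max = A' +
A'' - min` and `E[W / 2] (E A' + E A'') = E A < ∞`, the expectation of `(W / 2) min(A', A'')` is
zero. Thus `A' A'' = 0` almost surely, and independence gives `(E A)² = 0`. -/
lemma IsCascadeLaw.ae_tendsto_maxNode (h : IsCascadeLaw lam) :
    ∀ᵐ w ∂treeLaw lam, Tendsto (fun n => maxNode n w) atTop (𝓝 0) := by
  set A : Weights → ℝ≥0∞ := fun w => ⨅ n, maxNode n w with hA
  have hAm : Measurable A := Measurable.iInf fun n => by fun_prop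
  have hreg : ∀ᵐ w ∂treeLaw lam, ∀ l, IsRegular id leb (subAt l w) :=
    ae_forall_subAt lam fun _ => ae_isRegular_leb lam h.mean
  have hanti : ∀ w : Weights, (∀ l, IsRegular id leb (subAt l w)) →
      Tendsto (fun n => maxNode n w) atTop (𝓝 (A w)) := fun w hw =>
    tendsto_atTop_iInf (antitone_nat_of_succ_le fun n => maxNode_succ_le (hw []) hw n)
  have hAE : ∫⁻ w, A w ∂treeLaw lam ≠ ∞ := by
    refine ne_top_of_le_ne_top ENNReal.one_ne_top
      (le_trans (lintegral_mono fun w => ?_) (lintegral_lebMass_le lam h.mean))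
    exact iInf_le (fun n => maxNode n w) 0
  have hrec : ∀ᵐ w ∂treeLaw lam, A w = w [] * 2⁻¹ * max (A (sub false w)) (A (sub true w)) := by
    filter_upwards [hreg] with w hw
    have h1 := (tendsto_add_atTop_iff_nat 1).2 (hanti w hw)
    have h2 := (hanti (sub false w) fun l => hw (false :: l)).max
      (hanti (sub true w) fun l => hw (true :: l))
    have hfin : w [] * 2⁻¹ ≠ ∞ := ENNReal.mul_ne_top ((hw []).1 []).ne (by simp)
    exact tendsto_nhds_unique h1 (ENNReal.Tendsto.const_mul h2 (Or.inr hfin))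
  have hmul : ∀ b, ∫⁻ w, w [] * 2⁻¹ * A (sub b w) ∂treeLaw lam =
      2⁻¹ * ∫⁻ w, A w ∂treeLaw lam := by
    intro b
    rw [lintegral_tree_mul_sub lam (f := fun a => a * 2⁻¹) (by fun_prop) hAm,
      lintegral_mul_const _ (by fun_prop), h.mean, one_mul]
  have hA0 := hAm.comp (measurable_sub false)
  have hA1 := hAm.comp (measurable_sub true)
  simp only [Function.comp_def] at hA0 hA1
  have hsum : ∫⁻ w, A w ∂treeLaw lam + ∫⁻ w, w [] * 2⁻¹ * min (A (sub false w)) (A (sub true w))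
      ∂treeLaw lam = ∫⁻ w, A w ∂treeLaw lam := by
    rw [← lintegral_add_left hAm]
    calc _ = ∫⁻ w, (w [] * 2⁻¹ * A (sub false w) + w [] * 2⁻¹ * A (sub true w)) ∂treeLaw lam := by
          refine lintegral_congr_ae ?_
          filter_upwards [hrec] with w hw
          rw [hw, ← mul_add, ← mul_add, max_add_min]
      _ = 2⁻¹ * ∫⁻ w, A w ∂treeLaw lam + 2⁻¹ * ∫⁻ w, A w ∂treeLaw lam := by
          rw [lintegral_add_left (by fun_prop), hmul, hmul]
      _ = _ := by rw [← add_mul, ENNReal.inv_two_add_inv_two, one_mul]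
  have hmin : ∫⁻ w, w [] * 2⁻¹ * min (A (sub false w)) (A (sub true w)) ∂treeLaw lam = 0 :=
    (ENNReal.add_right_inj hAE).1 (by rw [hsum, add_zero])
  have hmin' := (lintegral_eq_zero_iff (by fun_prop)).1 hmin
  have hprod : ∫⁻ w, 1 * (A (sub false w) * A (sub true w)) ∂treeLaw lam = 0 := by
    rw [lintegral_eq_zero_iff (by fun_prop)]
    filter_upwards [hmin', ae_forall_weight lam h.ae_pos] with w hw hpos
    simp only [Pi.zero_apply, mul_eq_zero, (hpos []).ne', ENNReal.inv_eq_zero,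
      ENNReal.ofNat_ne_top, false_or, or_false] at hw
    rcases min_choice (A (sub false w)) (A (sub true w)) with hc | hc <;> rw [hc] at hw <;> simp [hw]
  rw [lintegral_tree_mul lam (f := fun _ => 1) measurable_const hAm hAm] at hprod
  simp only [lintegral_const, measure_univ, mul_one, one_mul, mul_self_eq_zero] at hprod
  filter_upwards [(lintegral_eq_zero_iff hAm).1 hprod, hreg] with w hw hr
  have := hanti w hr
  rwa [hw] at this

end

end Cascade

/-! ### Moments of node masses in the original and in the tilted cascade -/

namespace Cascade

/-- The words of length `n`, that is, the nodes of level `n`. -/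
def words : ℕ → Finset (List Bool)
  | 0 => {[]}
  | n + 1 => ((words n).map ⟨List.cons false, List.cons_injective⟩).disjUnion
      ((words n).map ⟨List.cons true, List.cons_injective⟩)
      (by simp [Finset.disjoint_left])

@[simp] lemma mem_words {n : ℕ} {l : List Bool} : l ∈ words n ↔ l.length = n := by
  induction n generalizing l with
  | zero => simp [words, List.length_eq_zero_iff]
  | succ n ih => rcases l with _ | ⟨_ | _, l⟩ <;> simp [words, ih]

lemma sum_words_succ {M : Type*} [AddCommMonoid M] (n : ℕ) (f : List Bool → M) :
    ∑ l ∈ words (n + 1), f l = ∑ l ∈ words n, f (false :: l) + ∑ l ∈ words n, f (true :: l) := by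
  rw [words, Finset.sum_disjUnion]
  simp

lemma IsFlow.sum_words {ν : List Bool → ℝ≥0∞} (hν : IsFlow ν) (n : ℕ) :
    ∑ l ∈ words n, ν l = ν [] := by
  induction n generalizing ν with
  | zero => simp [words]
  | succ n ih =>
    rw [sum_words_succ, hν.root]
    exact congrArg₂ (· + ·) (ih (hν.sub false)) (ih (hν.sub true))

lemma tsum_words (f : List Bool → ℝ≥0∞) : ∑' l, f l = ∑' n, ∑ l ∈ words n, f l := by
  rw [← (Equiv.sigmaFiberEquiv (List.length : List Bool → ℕ)).tsum_eq, ENNReal.tsum_sigma']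
  refine tsum_congr fun n => ?_
  rw [← Finset.tsum_subtype]
  have e : {l : List Bool // l.length = n} ≃ {l // l ∈ words n} :=
    Equiv.subtypeEquivRight fun l => mem_words.symm
  exact (Equiv.subtypeEquivRight fun l : List Bool => (mem_words (n := n)).symm).tsum_eq
    fun l : {l // l ∈ words n} => f l

lemma IsFlow.tsum_mul_pow {ν : List Bool → ℝ≥0∞} (hν : IsFlow ν) (r : ℝ≥0∞) :
    ∑' l, r ^ l.length * ν l = (1 - r)⁻¹ * ν [] := by
  rw [tsum_words, ← ENNReal.tsum_geometric, ← ENNReal.tsum_mul_right]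
  refine tsum_congr fun n => ?_
  rw [← hν.sum_words n, Finset.mul_sum]
  exact Finset.sum_congr rfl fun l hl => by rw [mem_words.1 hl]

section
variable (lam : Measure ℝ≥0∞)

/-- The moment of order `s`. -/
def moment (s : ℝ) : ℝ≥0∞ := ∫⁻ a, a ^ s ∂lam

/-- The weight `a ^ s`, normalized to mean one. -/
def powWeight (s : ℝ) (a : ℝ≥0∞) : ℝ≥0∞ := a ^ s * (moment lam s)⁻¹

/-- The number `2 ^ s / E[W ^ s]`. -/
def growth (s : ℝ) : ℝ≥0∞ := 2 ^ s * (moment lam s)⁻¹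

@[fun_prop] lemma measurable_powWeight (s : ℝ) : Measurable (powWeight lam s) := by
  unfold powWeight; fun_prop

variable {lam} {s : ℝ}

lemma half_rpow_neg (s : ℝ) : (2⁻¹ : ℝ≥0∞) ^ (-s) = 2 ^ s := by
  rw [ENNReal.rpow_neg, ENNReal.inv_rpow, inv_inv]

/-- The reason for tilting by `a ^ s`: dividing by the `s`-th power of the contribution `a / 2` to
the node mass leaves a constant, so each common ancestor costs exactly one factor `growth`. -/
lemma powWeight_mul_rpow_neg {a : ℝ≥0∞} (ha : 0 < a) (ha' : a < ∞) :
    powWeight lam s a * (a * 2⁻¹) ^ (-s) = growth lam s := by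
  rw [ENNReal.mul_rpow_of_ne_zero ha.ne' (by simp), half_rpow_neg, powWeight, growth]
  have : a ^ s * a ^ (-s) = 1 := by
    rw [← ENNReal.rpow_add _ _ ha.ne' ha'.ne]; simp
  calc _ = (a ^ s * a ^ (-s)) * (2 ^ s * (moment lam s)⁻¹) := by ring
    _ = _ := by rw [this, one_mul]

variable [IsProbabilityMeasure lam]

lemma IsCascadeLaw.moment_le_one (h : IsCascadeLaw lam) (hs0 : 0 ≤ s) (hs1 : s ≤ 1) :
    moment lam s ≤ 1 := by
  refine (lintegral_rpow_le lam measurable_id hs0 hs1).trans ?_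
  simp [h.mean]

lemma IsCascadeLaw.moment_ne_top (h : IsCascadeLaw lam) (hs0 : 0 ≤ s) (hs1 : s ≤ 1) :
    moment lam s ≠ ∞ := ne_top_of_le_ne_top ENNReal.one_ne_top (h.moment_le_one hs0 hs1)

lemma IsCascadeLaw.moment_ne_zero (h : IsCascadeLaw lam) : moment lam s ≠ 0 := by
  intro h0
  rw [moment, lintegral_eq_zero_iff (by fun_prop)] at h0
  have : ∀ᵐ _a ∂lam, False := by
    filter_upwards [h0, h.ae_pos, h.ae_lt_top] with a ha hpos hlt
    exact (ENNReal.rpow_pos hpos hlt.ne).ne' ha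
  exact this.exists.elim fun _ h => h

lemma IsCascadeLaw.growth_ne_top (h : IsCascadeLaw lam) : growth lam s ≠ ∞ :=
  ENNReal.mul_ne_top (ENNReal.rpow_ne_top_of_ne_zero (by simp) (by simp))
    (ENNReal.inv_ne_top.2 h.moment_ne_zero)

lemma IsCascadeLaw.lintegral_powWeight (h : IsCascadeLaw lam) (hs0 : 0 ≤ s) (hs1 : s ≤ 1) :
    ∫⁻ a, powWeight lam s a ∂lam = 1 := by
  simp only [powWeight]
  rw [lintegral_mul_const _ (by fun_prop)]
  exact ENNReal.mul_inv_cancel h.moment_ne_zero (h.moment_ne_top hs0 hs1)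

lemma IsCascadeLaw.lintegral_powWeight_mul (h : IsCascadeLaw lam) :
    ∫⁻ a, powWeight lam s a * (a * 2⁻¹) ^ (-s) ∂lam = growth lam s := by
  rw [lintegral_congr_ae (g := fun _ => growth lam s)]
  · simp
  · filter_upwards [h.ae_pos, h.ae_lt_top] with a ha ha'
    exact powWeight_mul_rpow_neg ha ha'

lemma IsCascadeLaw.lintegral_powWeight_mul_powWeight_mul (h : IsCascadeLaw lam) (hs0 : 0 ≤ s)
    (hs1 : s ≤ 1) :
    ∫⁻ a, powWeight lam s a * powWeight lam s a * (a * 2⁻¹) ^ (-s) ∂lam = growth lam s := by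
  rw [lintegral_congr_ae (g := fun a => growth lam s * powWeight lam s a)]
  · rw [lintegral_const_mul _ (by fun_prop), h.lintegral_powWeight hs0 hs1, mul_one]
  · filter_upwards [h.ae_pos, h.ae_lt_top] with a ha ha'
    rw [mul_assoc, powWeight_mul_rpow_neg ha ha', mul_comm]

/-- Each proper ancestor contributes the independent factor `E[(W / 2) ^ s]`, which is the inverse
of `growth`; the remaining subtree mass has `s`-th moment at most `1` by Jensen. -/
lemma IsCascadeLaw.lintegral_lebNode_rpow_le (h : IsCascadeLaw lam) (hs0 : 0 ≤ s) (hs1 : s ≤ 1)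
    (l : List Bool) : ∫⁻ w, lebNode w l ^ s ∂treeLaw lam ≤ ((growth lam s)⁻¹) ^ l.length := by
  induction l with
  | nil =>
    refine (lintegral_rpow_le _ measurable_lebMass hs0 hs1).trans ?_
    simpa using ENNReal.rpow_le_one (lintegral_lebMass_le lam h.mean) hs0
  | cons b l ih =>
    have e : ∀ w : Weights, lebNode w (b :: l) ^ s =
        (w [] * 2⁻¹) ^ s * (fun u => lebNode u l ^ s) (sub b w) := fun w => by
      rw [lebNode_cons, ENNReal.mul_rpow_of_nonneg _ _ hs0]
    simp_rw [e]
    have hm := measurable_lebNode l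
    rw [lintegral_tree_mul_sub lam (f := fun a => (a * 2⁻¹) ^ s) (by fun_prop)
      (g := fun u => lebNode u l ^ s) (by fun_prop), List.length_cons, pow_succ']
    refine mul_le_mul' (le_of_eq ?_) ih
    simp_rw [ENNReal.mul_rpow_of_nonneg _ _ hs0]
    rw [lintegral_mul_const _ (by fun_prop), growth, ENNReal.mul_inv (Or.inl (by simp))
      (Or.inl (ENNReal.rpow_ne_top_of_ne_zero (by simp) (by simp))), inv_inv, ENNReal.inv_rpow,
      mul_comm, moment]

lemma IsCascadeLaw.ae_lebNode_pos (h : IsCascadeLaw lam) :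
    ∀ᵐ w ∂treeLaw lam, ∀ l, 0 < lebNode w l := by
  filter_upwards [ae_forall_weight lam h.ae_pos, ae_forall_subAt lam fun _ => h.ae_lebMass_pos]
    with w hw hm l
  induction l generalizing w with
  | nil => exact hm []
  | cons b l ih =>
    rw [lebNode_cons]
    exact ENNReal.mul_pos (mul_ne_zero (hw []).ne' (by simp))
      (ih (sub b w) (fun l => hw (b :: l)) (fun l => hm (b :: l))).ne'

lemma IsCascadeLaw.ae_lebNode_cons_rpow (h : IsCascadeLaw lam) (b : Bool) (l : List Bool) (t : ℝ) :
    ∀ᵐ w ∂treeLaw lam, lebNode w (b :: l) ^ t = (w [] * 2⁻¹) ^ t * lebNode (sub b w) l ^ t := by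
  filter_upwards [ae_forall_weight lam h.ae_pos, ae_subAt lam h.ae_lebNode_pos [b]] with w hw hm
  change ∀ l, 0 < lebNode (sub b w) l at hm
  rw [lebNode_cons, ENNReal.mul_rpow_of_ne_zero (mul_ne_zero (hw []).ne' (by simp)) (hm l).ne']

/-- The mass of a node in the cascade with weights `powWeight lam s`. -/
abbrev powNode (lam : Measure ℝ≥0∞) [IsProbabilityMeasure lam] (s : ℝ) (ν : List Bool → ℝ≥0∞)
    (w : Weights) (l : List Bool) : ℝ≥0∞ := nodeMass (powWeight lam s) ν w l

lemma measurable_powNode (ν : List Bool → ℝ≥0∞) (l : List Bool) :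
    Measurable fun w => powNode lam s ν w l := measurable_nodeMass (by fun_prop) ν l

variable {ν : List Bool → ℝ≥0∞}

lemma IsCascadeLaw.lintegral_powNode_le (h : IsCascadeLaw lam) (hs0 : 0 ≤ s) (hs1 : s ≤ 1)
    (hν : IsFlow ν) (l : List Bool) : ∫⁻ w, powNode lam s ν w l ∂treeLaw lam ≤ ν l := by
  induction l generalizing ν with
  | nil => exact lintegral_limitMass_le lam (by fun_prop) (h.lintegral_powWeight hs0 hs1) hν
  | cons b l ih =>
    simp only [powNode, nodeMass]
    rw [lintegral_tree_mul_sub lam (by fun_prop) (measurable_powNode _ l),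
      h.lintegral_powWeight hs0 hs1, one_mul]
    exact ih (hν.sub b)

/-- The node and its sibling have exactly `p` and the ancestors of `p` in common, `p.length + 1`
nodes in all, each contributing `growth`. Below `p` the two factors live in different subtrees and
are independent. -/
lemma IsCascadeLaw.lintegral_powNode_mul_lebNode_le (h : IsCascadeLaw lam) (hs0 : 0 ≤ s)
    (hs1 : s ≤ 1) (hν : IsFlow ν) (p : List Bool) (b : Bool) :
    ∫⁻ w, powNode lam s ν w (p ++ [b]) * lebNode w (p ++ [!b]) ^ (-s) ∂treeLaw lam ≤
      growth lam s ^ (p.length + 1) *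
        (ν (p ++ [b]) * ∫⁻ w, lebMass w ^ (-s) ∂treeLaw lam) := by
  have hf : Measurable fun a : ℝ≥0∞ => powWeight lam s a * (a * 2⁻¹) ^ (-s) := by fun_prop
  induction p generalizing ν with
  | nil =>
    calc _ = ∫⁻ w, (powWeight lam s (w []) * (w [] * 2⁻¹) ^ (-s)) *
          (powNode lam s (sub b ν) (sub b w) [] * lebMass (sub (!b) w) ^ (-s)) ∂treeLaw lam := by
          refine lintegral_congr_ae ?_
          filter_upwards [h.ae_lebNode_cons_rpow (!b) [] (-s)] with w hw
          simp only [List.nil_append]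
          rw [hw, powNode, nodeMass, lebNode_nil]
          ring
      _ = growth lam s * ((∫⁻ w, powNode lam s (sub b ν) w [] ∂treeLaw lam) *
            ∫⁻ w, lebMass w ^ (-s) ∂treeLaw lam) := by
          rw [lintegral_tree_mul_sub_sub lam hf (measurable_powNode _ [])
            (h := fun u => lebMass u ^ (-s)) (by fun_prop), h.lintegral_powWeight_mul]
      _ ≤ _ := by
          simp only [List.length_nil, zero_add, pow_one]
          gcongr
          exact h.lintegral_powNode_le hs0 hs1 (hν.sub b) []
  | cons c p ih =>
    have hm := measurable_powNode (lam := lam) (s := s) (sub c ν) (p ++ [b])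
    have hm' := measurable_lebNode (p ++ [!b])
    calc _ = ∫⁻ w, (powWeight lam s (w []) * (w [] * 2⁻¹) ^ (-s)) *
          (fun u => powNode lam s (sub c ν) u (p ++ [b]) * lebNode u (p ++ [!b]) ^ (-s))
            (sub c w) ∂treeLaw lam := by
          refine lintegral_congr_ae ?_
          filter_upwards [h.ae_lebNode_cons_rpow c (p ++ [!b]) (-s)] with w hw
          simp only [List.cons_append]
          rw [hw, powNode, nodeMass]
          ring
      _ ≤ _ := by
          refine (lintegral_tree_mul_sub lam hf (g := fun u => powNode lam s (sub c ν) u (p ++ [b]) * lebNode u (p ++ [!b]) ^ (-s))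
            (by fun_prop) c).trans_le ?_
          rw [h.lintegral_powWeight_mul, List.length_cons, pow_succ', mul_assoc]
          exact mul_le_mul_right (ih (hν.sub c)) _

/-- As long as `q` follows the branch of `p`, a common ancestor contributes the square of the tilted
weight times `(a / 2) ^ (-s)`, whose mean is again `growth`. Where `q` branches off, its factor
becomes independent and contributes at most its mean, and the other branch is covered by
`lintegral_powNode_mul_lebNode_le`. As `q` is not a child of `p`, the branching happens strictly
above `p`. -/
lemma IsCascadeLaw.lintegral_powNode_mul_powNode_mul_lebNode_le (h : IsCascadeLaw lam)
    (hs0 : 0 ≤ s) (hs1 : s ≤ 1) (hν : IsFlow ν) (p q : List Bool) (b : Bool)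
    (hpq : q.length = p.length + 1) (hq : q ≠ p ++ [b]) (hq' : q ≠ p ++ [!b]) :
    ∫⁻ w, powNode lam s ν w (p ++ [b]) * powNode lam s ν w q *
        lebNode w (p ++ [!b]) ^ (-s) ∂treeLaw lam ≤
      growth lam s ^ (p.length + 1) *
        (ν (p ++ [b]) * ν q * ∫⁻ w, lebMass w ^ (-s) ∂treeLaw lam) := by
  have hf : Measurable fun a : ℝ≥0∞ =>
    powWeight lam s a * powWeight lam s a * (a * 2⁻¹) ^ (-s) := by fun_prop
  induction p generalizing ν q with
  | nil =>
    obtain ⟨c, rfl⟩ := List.length_eq_one_iff.1 hpq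
    cases b <;> cases c <;> simp at hq hq'
  | cons c p ih =>
    rcases q with _ | ⟨d, q⟩
    · simp at hpq
    have hm := measurable_powNode (lam := lam) (s := s) (sub c ν) (p ++ [b])
    have hmq := fun e => measurable_powNode (lam := lam) (s := s) (sub e ν) q
    have hm' := measurable_lebNode (p ++ [!b])
    rcases eq_or_ne d c with rfl | hdc
    · calc _ = ∫⁻ w, (powWeight lam s (w []) * powWeight lam s (w []) * (w [] * 2⁻¹) ^ (-s)) *
            (fun u => powNode lam s (sub d ν) u (p ++ [b]) * powNode lam s (sub d ν) u q *
              lebNode u (p ++ [!b]) ^ (-s)) (sub d w) ∂treeLaw lam := by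
            refine lintegral_congr_ae ?_
            filter_upwards [h.ae_lebNode_cons_rpow d (p ++ [!b]) (-s)] with w hw
            simp only [List.cons_append]
            rw [hw]
            simp only [powNode, nodeMass]
            ring
        _ ≤ _ := by
            have := hmq d
            refine (lintegral_tree_mul_sub lam hf (g := fun u => powNode lam s (sub d ν) u (p ++ [b]) *
              powNode lam s (sub d ν) u q * lebNode u (p ++ [!b]) ^ (-s))
              (by fun_prop) d).trans_le ?_
            rw [h.lintegral_powWeight_mul_powWeight_mul hs0 hs1, List.length_cons, pow_succ', mul_assoc]
            refine mul_le_mul_right (ih (hν.sub d) q (by simpa using hpq) ?_ ?_) _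
            · simpa using hq
            · simpa using hq'
    · obtain rfl : d = !c := by cases c <;> cases d <;> simp_all
      have hmc := hmq (!c)
      calc _ = ∫⁻ w, (powWeight lam s (w []) * powWeight lam s (w []) * (w [] * 2⁻¹) ^ (-s)) *
            ((fun u => powNode lam s (sub c ν) u (p ++ [b]) * lebNode u (p ++ [!b]) ^ (-s))
              (sub c w) * (fun u => powNode lam s (sub (!c) ν) u q) (sub (!c) w))
                ∂treeLaw lam := by
            refine lintegral_congr_ae ?_
            filter_upwards [h.ae_lebNode_cons_rpow c (p ++ [!b]) (-s)] with w hw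
            simp only [List.cons_append]
            rw [hw]
            simp only [powNode, nodeMass]
            ring
        _ ≤ growth lam s * ((growth lam s ^ (p.length + 1) *
              (sub c ν (p ++ [b]) * ∫⁻ w, lebMass w ^ (-s) ∂treeLaw lam)) * sub (!c) ν q) := by
            refine (lintegral_tree_mul_sub_sub lam hf
              (g := fun u => powNode lam s (sub c ν) u (p ++ [b]) * lebNode u (p ++ [!b]) ^ (-s))
              (h := fun u => powNode lam s (sub (!c) ν) u q) (by fun_prop) hmc c).trans_le ?_
            rw [h.lintegral_powWeight_mul_powWeight_mul hs0 hs1]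
            gcongr
            · exact h.lintegral_powNode_mul_lebNode_le hs0 hs1 (hν.sub c) p b
            · exact h.lintegral_powNode_le hs0 hs1 (hν.sub _) q
        _ = _ := by
            simp only [List.length_cons, List.cons_append, sub_eq]
            ring

end

end Cascade

/-! ### Weighted second moments and survival of the tilted cascade -/

namespace Cascade

lemma rpow_neg_eq_half_mul_half (x : ℝ≥0∞) (s : ℝ) :
    x ^ (-s) = x ^ (-(s / 2)) * x ^ (-(s / 2)) := by
  rw [← pow_two, ← ENNReal.rpow_mul_natCast]
  congr 1
  push_cast
  ring

section
variable {lam : Measure ℝ≥0∞} [IsProbabilityMeasure lam] {s : ℝ} {ν : List Bool → ℝ≥0∞}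

/-- The total mass of the approximations in the cascade with weights `powWeight lam s`. -/
abbrev powApprox (lam : Measure ℝ≥0∞) (s : ℝ) (ν : List Bool → ℝ≥0∞) (n : ℕ)
    (w : Weights) : ℝ≥0∞ := approxMass (powWeight lam s) ν n w

omit [IsProbabilityMeasure lam] in
lemma measurable_powApprox (ν : List Bool → ℝ≥0∞) (n : ℕ) : Measurable (powApprox lam s ν n) :=
  measurable_approxMass (by fun_prop) ν n

lemma IsCascadeLaw.ae_lebMass_rpow (h : IsCascadeLaw lam) (t : ℝ) :
    ∀ᵐ w ∂treeLaw lam, lebMass w ^ t =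
      (w [] * 2⁻¹) ^ t * (lebMass (sub false w) + lebMass (sub true w)) ^ t := by
  filter_upwards [ae_forall_weight lam h.ae_pos, ae_isRegular_leb lam h.mean,
    ae_subAt lam h.ae_lebMass_pos [false]] with w hw hreg hm
  change 0 < lebMass (sub false w) at hm
  rw [lebMass_eq hreg, ENNReal.mul_rpow_of_ne_zero (mul_ne_zero (hw []).ne' (by simp))
    (by simp [hm.ne'])]

/-- A bound for the cross terms of the second moment. No induction is needed: after one splitting,
the tilted mass of each subtree is paired with the negative power of `Y` for the other subtree,
which is independent of it and has finite mean. -/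
lemma IsCascadeLaw.exists_lintegral_powApprox_mul_le (h : IsCascadeLaw lam) (hs0 : 0 ≤ s)
    (hs1 : s < 1) : ∃ C : ℝ≥0∞, C ≠ ∞ ∧ ∀ ν : List Bool → ℝ≥0∞, IsFlow ν → ∀ n,
      ∫⁻ w, powApprox lam s ν n w * lebMass w ^ (-(s / 2)) ∂treeLaw lam ≤ C * ν [] := by
  set N := ∫⁻ w, lebMass w ^ (-(s / 2)) ∂treeLaw lam with hN
  set k := ∫⁻ a, powWeight lam s a * (a * 2⁻¹) ^ (-(s / 2)) ∂lam with hk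
  have hNfin : N ≠ ∞ := h.lintegral_lebMass_rpow_neg_ne_top (by linarith) (by linarith)
  have hkfin : k ≠ ∞ := by
    have e : k = moment lam (s / 2) * ((moment lam s)⁻¹ * 2 ^ (s / 2)) := by
      rw [moment, ← lintegral_mul_const _ (by fun_prop)]
      refine lintegral_congr_ae ?_
      filter_upwards [h.ae_pos, h.ae_lt_top] with a ha ha'
      have : a ^ s * a ^ (-(s / 2)) = a ^ (s / 2) := by
        rw [← ENNReal.rpow_add _ _ ha.ne' ha'.ne]; ring_nf
      rw [ENNReal.mul_rpow_of_ne_zero ha.ne' (by simp), half_rpow_neg, powWeight, ← this]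
      ring
    rw [e]
    exact ENNReal.mul_ne_top (h.moment_ne_top (by linarith) (by linarith))
      (ENNReal.mul_ne_top (ENNReal.inv_ne_top.2 h.moment_ne_zero)
        (ENNReal.rpow_ne_top_of_nonneg (by linarith) (by simp)))
  refine ⟨max 1 k * N, ENNReal.mul_ne_top (by simp [hkfin]) hNfin, fun ν hν n => ?_⟩
  cases n with
  | zero =>
    simp only [powApprox, approxMass]
    rw [lintegral_const_mul _ (by fun_prop), mul_comm]
    exact mul_le_mul_left (le_trans (by rw [one_mul]) (mul_le_mul_left (le_max_left 1 k) N)) _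
  | succ n =>
    have hm := fun b => measurable_powApprox (lam := lam) (s := s) (sub b ν) n
    have hm0 := hm false
    have hm1 := hm true
    have hf : Measurable fun a : ℝ≥0∞ => powWeight lam s a * (a * 2⁻¹) ^ (-(s / 2)) := by fun_prop
    have hint := fun b => lintegral_approxMass lam (measurable_powWeight lam s)
      (h.lintegral_powWeight hs0 hs1.le) (hν.sub b) n
    calc _ ≤ ∫⁻ w, (powWeight lam s (w []) * (w [] * 2⁻¹) ^ (-(s / 2)) *
            (powApprox lam s (sub false ν) n (sub false w) * lebMass (sub true w) ^ (-(s / 2))) +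
          powWeight lam s (w []) * (w [] * 2⁻¹) ^ (-(s / 2)) *
            (lebMass (sub false w) ^ (-(s / 2)) * powApprox lam s (sub true ν) n (sub true w)))
            ∂treeLaw lam := by
          refine lintegral_mono_ae ?_
          filter_upwards [h.ae_lebMass_rpow (-(s / 2))] with w hw
          rw [hw]
          simp only [powApprox, approxMass]
          rw [← mul_add]
          calc _ = powWeight lam s (w []) * (w [] * 2⁻¹) ^ (-(s / 2)) *
                (powApprox lam s (sub false ν) n (sub false w) *
                  (lebMass (sub false w) + lebMass (sub true w)) ^ (-(s / 2)) +
                (lebMass (sub false w) + lebMass (sub true w)) ^ (-(s / 2)) *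
                  powApprox lam s (sub true ν) n (sub true w)) := by ring
            _ ≤ _ := by
                exact mul_le_mul_right (add_le_add
                  (mul_le_mul_right (rpow_neg_le_rpow_neg le_add_self (by linarith)) _)
                  (mul_le_mul_left (rpow_neg_le_rpow_neg le_self_add (by linarith)) _)) _
      _ = k * (sub false ν [] * N) + k * (N * sub true ν []) := by
          rw [lintegral_add_left (by fun_prop), lintegral_tree_mul lam hf hm0
            (h := fun u => lebMass u ^ (-(s / 2))) (by fun_prop), lintegral_tree_mul lam hf
            (g := fun u => lebMass u ^ (-(s / 2))) (by fun_prop) hm1, hint, hint]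
      _ = k * N * ν [] := by rw [hν.root]; ring
      _ ≤ _ := mul_le_mul_left (mul_le_mul_left (le_max_right 1 k) N) _

/-- Expanding the square at the root gives two diagonal terms of the same kind, each with a factor
`growth`, and a cross term bounded through `(p + q) ^ (-s) ≤ p ^ (-s/2) q ^ (-s/2)` by independent
factors. Passing to a child replaces `B` by `B * a`, so the diagonal contracts by `r = growth * a <
1`. -/
lemma IsCascadeLaw.exists_lintegral_powApprox_sq_le (h : IsCascadeLaw lam) (hs0 : 0 ≤ s)
    (hs1 : s < 1) {a : ℝ≥0∞} (ha : growth lam s * a < 1) :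
    ∃ C : ℝ≥0∞, C ≠ ∞ ∧ ∀ (ν : List Bool → ℝ≥0∞) (B : ℝ≥0∞), IsFlow ν →
      (∀ l, ν l ≤ B * a ^ l.length) → ∀ n,
      ∫⁻ w, powApprox lam s ν n w ^ 2 * lebMass w ^ (-s) ∂treeLaw lam ≤ C * (ν [] * B) := by
  obtain ⟨C1, hC1, hd⟩ := h.exists_lintegral_powApprox_mul_le hs0 hs1
  set N := ∫⁻ w, lebMass w ^ (-s) ∂treeLaw lam with hN
  have hNfin : N ≠ ∞ := h.lintegral_lebMass_rpow_neg_ne_top hs0 hs1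
  set r := growth lam s * a with hr
  set C := N + growth lam s * (2 * (C1 * C1)) with hC
  have hCfin : C ≠ ∞ := ENNReal.add_ne_top.2 ⟨hNfin, ENNReal.mul_ne_top h.growth_ne_top
    (ENNReal.mul_ne_top (by simp) (ENNReal.mul_ne_top hC1 hC1))⟩
  have hrfin : (1 - r)⁻¹ ≠ ∞ := by
    rw [ENNReal.inv_ne_top]
    exact (tsub_pos_of_lt ha).ne'
  -- The constant `C / (1 - r)` is the fixed point of the recursion `x ↦ r x + C` for the second
  -- moments.
  have hgeom : r * (1 - r)⁻¹ + 1 = (1 - r)⁻¹ := by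
    have h1 : (1 - r) + r = 1 := tsub_add_cancel_of_le ha.le
    have h2 : (1 - r) * (1 - r)⁻¹ = 1 := ENNReal.mul_inv_cancel (tsub_pos_of_lt ha).ne' (by simp)
    calc r * (1 - r)⁻¹ + 1 = r * (1 - r)⁻¹ + (1 - r) * (1 - r)⁻¹ := by rw [h2]
      _ = ((1 - r) + r) * (1 - r)⁻¹ := by ring
      _ = _ := by rw [h1, one_mul]
  refine ⟨C * (1 - r)⁻¹, ENNReal.mul_ne_top hCfin hrfin, fun ν B hν hB n => ?_⟩
  induction n generalizing ν B with
  | zero =>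
    simp only [powApprox, approxMass]
    rw [lintegral_const_mul _ (by fun_prop), ← hN]
    have h1 : ν [] ≤ B := by simpa using hB []
    calc ν [] ^ 2 * N = N * (ν [] * ν []) := by ring
      _ ≤ C * (1 - r)⁻¹ * (ν [] * B) := by
          gcongr
          rw [← hgeom, mul_add, mul_one, hC]
          exact le_self_add.trans le_add_self
  | succ n ih =>
    have hm := fun b => measurable_powApprox (lam := lam) (s := s) (sub b ν) n
    have hm0 := hm false
    have hm1 := hm true
    have hf : Measurable fun a : ℝ≥0∞ =>
      powWeight lam s a * powWeight lam s a * (a * 2⁻¹) ^ (-s) := by fun_prop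
    have hsub : ∀ b, ∫⁻ w, powApprox lam s (sub b ν) n w ^ 2 * lebMass w ^ (-s) ∂treeLaw lam ≤
        C * (1 - r)⁻¹ * (sub b ν [] * (B * a)) := fun b => ih _ _ (hν.sub b) fun l => by
      have := hB (b :: l)
      rw [List.length_cons, pow_succ'] at this
      rw [mul_assoc]; exact this
    have hb : ∀ b, sub b ν [] ≤ ν [] := fun b => by
      rw [hν.root]; cases b
      · exact le_self_add
      · exact le_add_self
    have hνB : ν [] ≤ B := by simpa using hB []
    set t := -(s / 2)
    calc _ ≤ ∫⁻ w, (powWeight lam s (w []) * powWeight lam s (w []) * (w [] * 2⁻¹) ^ (-s) *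
            (powApprox lam s (sub false ν) n (sub false w) ^ 2 * lebMass (sub false w) ^ (-s)) +
          powWeight lam s (w []) * powWeight lam s (w []) * (w [] * 2⁻¹) ^ (-s) *
            (powApprox lam s (sub true ν) n (sub true w) ^ 2 * lebMass (sub true w) ^ (-s)) +
          2 * (powWeight lam s (w []) * powWeight lam s (w []) * (w [] * 2⁻¹) ^ (-s) *
            ((powApprox lam s (sub false ν) n (sub false w) * lebMass (sub false w) ^ t) *
              (powApprox lam s (sub true ν) n (sub true w) * lebMass (sub true w) ^ t))))
            ∂treeLaw lam := by
          refine lintegral_mono_ae ?_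
          filter_upwards [h.ae_lebMass_rpow (-s)] with w hw
          rw [hw]
          simp only [powApprox, approxMass]
          set x := approxMass (powWeight lam s) (sub false ν) n (sub false w)
          set y := approxMass (powWeight lam s) (sub true ν) n (sub true w)
          set p := lebMass (sub false w)
          set q := lebMass (sub true w)
          have e1 : (p + q) ^ (-s) ≤ p ^ (-s) := rpow_neg_le_rpow_neg le_self_add hs0
          have e2 : (p + q) ^ (-s) ≤ q ^ (-s) := rpow_neg_le_rpow_neg le_add_self hs0
          have e3 : (p + q) ^ (-s) ≤ p ^ t * q ^ t := by
            rw [rpow_neg_eq_half_mul_half]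
            exact mul_le_mul' (rpow_neg_le_rpow_neg le_self_add (by linarith))
              (rpow_neg_le_rpow_neg le_add_self (by linarith))
          calc _ = powWeight lam s (w []) * powWeight lam s (w []) * (w [] * 2⁻¹) ^ (-s) *
                (x ^ 2 * (p + q) ^ (-s) + y ^ 2 * (p + q) ^ (-s) +
                  2 * (x * y * (p + q) ^ (-s))) := by ring
            _ ≤ powWeight lam s (w []) * powWeight lam s (w []) * (w [] * 2⁻¹) ^ (-s) *
                (x ^ 2 * p ^ (-s) + y ^ 2 * q ^ (-s) + 2 * (x * y * (p ^ t * q ^ t))) := by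
                gcongr
            _ = _ := by ring
      _ = growth lam s * (∫⁻ w, powApprox lam s (sub false ν) n w ^ 2 * lebMass w ^ (-s)
              ∂treeLaw lam) +
          growth lam s * (∫⁻ w, powApprox lam s (sub true ν) n w ^ 2 * lebMass w ^ (-s)
              ∂treeLaw lam) +
          2 * (growth lam s *
            ((∫⁻ w, powApprox lam s (sub false ν) n w * lebMass w ^ t ∂treeLaw lam) *
            ∫⁻ w, powApprox lam s (sub true ν) n w * lebMass w ^ t ∂treeLaw lam)) := by
          have hmul := h.lintegral_powWeight_mul_powWeight_mul hs0 hs1.le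
          have i1 := lintegral_tree_mul_sub lam hf (g := fun u =>
            powApprox lam s (sub false ν) n u ^ 2 * lebMass u ^ (-s)) (by fun_prop) false
          have i2 := lintegral_tree_mul_sub lam hf (g := fun u =>
            powApprox lam s (sub true ν) n u ^ 2 * lebMass u ^ (-s)) (by fun_prop) true
          have i3 := lintegral_tree_mul lam hf
            (g := fun u => powApprox lam s (sub false ν) n u * lebMass u ^ t)
            (h := fun u => powApprox lam s (sub true ν) n u * lebMass u ^ t)
            (by fun_prop) (by fun_prop)
          rw [hmul] at i1 i2 i3
          rw [lintegral_add_left (by fun_prop), lintegral_add_left (by fun_prop),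
            lintegral_const_mul _ (by fun_prop), i1, i2, i3]
      _ ≤ growth lam s * (C * (1 - r)⁻¹ * (sub false ν [] * (B * a))) +
          growth lam s * (C * (1 - r)⁻¹ * (sub true ν [] * (B * a))) +
          2 * (growth lam s * ((C1 * sub false ν []) * (C1 * sub true ν []))) := by
          gcongr
          · exact hsub false
          · exact hsub true
          · exact hd _ (hν.sub false) n
          · exact hd _ (hν.sub true) n
      _ = C * (r * (1 - r)⁻¹) * ((sub false ν [] + sub true ν []) * B) +
          growth lam s * (2 * (C1 * C1)) * (sub false ν [] * sub true ν []) := by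
          rw [hr]; ring
      _ ≤ C * (r * (1 - r)⁻¹) * (ν [] * B) + C * (ν [] * B) := by
          rw [← hν.root]
          gcongr
          · rw [hC]; exact le_add_self
          · exact hb false
          · exact (hb true).trans hνB
      _ = C * (1 - r)⁻¹ * (ν [] * B) := by
          conv_rhs => rw [← hgeom]
          ring

lemma IsCascadeLaw.ae_isRegular_pow (h : IsCascadeLaw lam) (hs0 : 0 ≤ s) (hs1 : s ≤ 1)
    (hν : IsFlow ν) (hν' : ν [] ≠ ∞) : ∀ᵐ w ∂treeLaw lam, IsRegular (powWeight lam s) ν w :=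
  ae_isRegular lam (by fun_prop) (h.lintegral_powWeight hs0 hs1) hν hν'

/-- At the root this is Fatou applied to the approximations. Each further ancestor contributes
`growth`, and the decay constant for the subtree supplies the matching factor `a`. -/
lemma IsCascadeLaw.exists_lintegral_powNode_sq_le (h : IsCascadeLaw lam) (hs0 : 0 ≤ s)
    (hs1 : s < 1) {a : ℝ≥0∞} (ha : growth lam s * a < 1) :
    ∃ C : ℝ≥0∞, C ≠ ∞ ∧ ∀ (ν : List Bool → ℝ≥0∞) (B : ℝ≥0∞), IsFlow ν → B ≠ ∞ →
      (∀ l, ν l ≤ B * a ^ l.length) → ∀ l,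
      ∫⁻ w, powNode lam s ν w l ^ 2 * lebNode w l ^ (-s) ∂treeLaw lam ≤
        C * ((growth lam s * a) ^ l.length * ν l * B) := by
  obtain ⟨C, hC, hb⟩ := h.exists_lintegral_powApprox_sq_le hs0 hs1 ha
  have hafin : growth lam s ≠ 0 → a ≠ ∞ := by
    rintro hg rfl
    rw [ENNReal.mul_top hg] at ha
    exact absurd ha (by simp)
  have hgrowth : growth lam s ≠ 0 := by
    refine mul_ne_zero (ENNReal.rpow_pos (by simp) (by simp)).ne' ?_
    simp [h.moment_ne_top hs0 hs1.le]
  refine ⟨C, hC, fun ν B hν hBfin hB l => ?_⟩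
  have hνB : ν [] ≤ B := by simpa using hB []
  induction l generalizing ν B with
  | nil =>
    simp only [List.length_nil, pow_zero, one_mul]
    calc _ = ∫⁻ w, liminf (fun n => powApprox lam s ν n w ^ 2 * lebMass w ^ (-s)) atTop
            ∂treeLaw lam := by
          refine lintegral_congr_ae ?_
          filter_upwards [h.ae_isRegular_pow hs0 hs1.le hν (ne_top_of_le_ne_top hBfin hνB),
            h.ae_lebMass_pos, ae_isRegular_leb lam h.mean] with w hw hpos hreg
          have h1 : Tendsto (fun n => powApprox lam s ν n w) atTop
            (𝓝 (limitMass (powWeight lam s) ν w)) := hw.3 []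
          have h2 := ((ENNReal.continuous_pow 2).tendsto _).comp h1
          exact (ENNReal.Tendsto.mul_const h2
            (Or.inr (ENNReal.rpow_ne_top_of_ne_zero hpos.ne' (hreg.2 []).ne))).liminf_eq.symm
      _ ≤ liminf (fun n => ∫⁻ w, powApprox lam s ν n w ^ 2 * lebMass w ^ (-s) ∂treeLaw lam)
            atTop := by
          refine lintegral_liminf_le fun n => ?_
          have := measurable_powApprox (lam := lam) (s := s) ν n
          fun_prop
      _ ≤ _ := liminf_le_of_frequently_le' (Frequently.of_forall fun n => hb ν B hν hB n)
  | cons b l ih =>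
    have hm := measurable_powNode (lam := lam) (s := s) (sub b ν) l
    have hm' := measurable_lebNode l
    have hf : Measurable fun a : ℝ≥0∞ =>
      powWeight lam s a * powWeight lam s a * (a * 2⁻¹) ^ (-s) := by fun_prop
    have hsub : ∀ l, sub b ν l ≤ B * a * a ^ l.length := fun l => by
      have := hB (b :: l)
      rw [List.length_cons, pow_succ'] at this
      rw [mul_assoc]; exact this
    calc _ = ∫⁻ w, powWeight lam s (w []) * powWeight lam s (w []) * (w [] * 2⁻¹) ^ (-s) *
          (powNode lam s (sub b ν) (sub b w) l ^ 2 * lebNode (sub b w) l ^ (-s)) ∂treeLaw lam := by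
          refine lintegral_congr_ae ?_
          filter_upwards [h.ae_lebNode_cons_rpow b l (-s)] with w hw
          rw [hw]
          simp only [powNode, nodeMass]
          ring
      _ ≤ growth lam s * (C * ((growth lam s * a) ^ l.length * sub b ν l * (B * a))) := by
          refine (lintegral_tree_mul_sub lam hf
            (g := fun u => powNode lam s (sub b ν) u l ^ 2 * lebNode u l ^ (-s))
            (by fun_prop) b).trans_le ?_
          rw [h.lintegral_powWeight_mul_powWeight_mul hs0 hs1.le]
          exact mul_le_mul_right (ih (sub b ν) (B * a) (hν.sub b)
            (ENNReal.mul_ne_top hBfin (hafin hgrowth)) hsub (by simpa using hsub [])) _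
      _ = _ := by
          rw [List.length_cons, pow_succ', sub_eq]
          ring

/-- Extinction is insensitive to the positive weights of the first levels: its indicator is the
product of the indicators for the two subtrees, without the root weight. It is therefore
uncorrelated with the approximations, whose mean is `ν []`. -/
lemma IsCascadeLaw.lintegral_indicator_powApprox (h : IsCascadeLaw lam) (hs0 : 0 ≤ s)
    (hs1 : s ≤ 1) (hν : IsFlow ν) (hν' : ν [] ≠ ∞) (n : ℕ) :
    ∫⁻ w, ({0} : Set ℝ≥0∞).indicator 1 (limitMass (powWeight lam s) ν w) * powApprox lam s ν n w
        ∂treeLaw lam =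
      (∫⁻ w, ({0} : Set ℝ≥0∞).indicator 1 (limitMass (powWeight lam s) ν w) ∂treeLaw lam) *
        ν [] := by
  set Z : ℝ≥0∞ → ℝ≥0∞ := ({0} : Set ℝ≥0∞).indicator 1 with hZ
  have hZm : Measurable Z := measurable_one.indicator (measurableSet_singleton 0)
  have hZadd : ∀ x y, Z (x + y) = Z x * Z y := fun x y => by
    simp only [hZ, Set.indicator, Set.mem_singleton_iff, add_eq_zero, Pi.one_apply]
    split_ifs <;> simp_all
  have hZmul : ∀ x y, x ≠ 0 → Z (x * y) = Z y := fun x y hx => by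
    simp only [hZ, Set.indicator, Set.mem_singleton_iff, mul_eq_zero, hx, false_or, Pi.one_apply]
  have hL : ∀ ν, Measurable (limitMass (powWeight lam s) ν) := measurable_limitMass (by fun_prop)
  have hpw : ∀ᵐ w ∂treeLaw lam, powWeight lam s (w []) ≠ 0 := by
    filter_upwards [ae_forall_weight lam h.ae_pos, ae_forall_weight lam h.ae_lt_top] with w h1 h2
    refine mul_ne_zero (ENNReal.rpow_pos (h1 []) (h2 []).ne).ne' ?_
    simp [h.moment_ne_top hs0 hs1]
  have hrec : ∀ ν : List Bool → ℝ≥0∞, IsFlow ν → ν [] ≠ ∞ → ∀ᵐ w ∂treeLaw lam,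
      Z (limitMass (powWeight lam s) ν w) =
        Z (limitMass (powWeight lam s) (sub false ν) (sub false w)) *
          Z (limitMass (powWeight lam s) (sub true ν) (sub true w)) := by
    intro ν hν hν'
    filter_upwards [h.ae_isRegular_pow hs0 hs1 hν hν', hpw] with w hw hg
    rw [hw.limitMass_eq, hZmul _ _ hg, hZadd]
  induction n generalizing ν with
  | zero =>
    simp only [powApprox, approxMass]
    have := hZm.comp (hL ν)
    simp only [Function.comp_def] at this
    rw [lintegral_mul_const _ this]
  | succ n ih =>
    have hm := fun b => measurable_powApprox (lam := lam) (s := s) (sub b ν) n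
    have hm0 := hm false
    have hm1 := hm true
    have hL0 := hZm.comp (hL (sub false ν))
    have hL1 := hZm.comp (hL (sub true ν))
    have hg := h.lintegral_powWeight hs0 hs1
    have hpm := measurable_powWeight lam s
    have hfin : ∀ b, sub b ν [] ≠ ∞ := fun b => hν.ne_top hν' [b]
    have hP : ∫⁻ w, Z (limitMass (powWeight lam s) ν w) ∂treeLaw lam =
        (∫⁻ w, Z (limitMass (powWeight lam s) (sub false ν) w) ∂treeLaw lam) *
          ∫⁻ w, Z (limitMass (powWeight lam s) (sub true ν) w) ∂treeLaw lam := by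
      rw [lintegral_congr_ae (hrec ν hν hν')]
      have := lintegral_tree_mul lam (f := fun _ => 1) measurable_const hL0 hL1
      simpa using this
    have i1 := lintegral_tree_mul lam hpm (g := fun u => Z (limitMass (powWeight lam s) (sub false ν)
      u) * powApprox lam s (sub false ν) n u) (hL0.mul hm0) hL1
    have i2 := lintegral_tree_mul lam hpm hL0 (h := fun u => Z (limitMass (powWeight lam s)
      (sub true ν) u) * powApprox lam s (sub true ν) n u) (hL1.mul hm1)
    simp only [Function.comp_def] at i1 i2 hL0 hL1
    rw [hg, one_mul, ih (hν.sub _) (hfin _)] at i1 i2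
    calc _ = ∫⁻ w, (powWeight lam s (w []) *
            (Z (limitMass (powWeight lam s) (sub false ν) (sub false w)) *
              powApprox lam s (sub false ν) n (sub false w) *
              Z (limitMass (powWeight lam s) (sub true ν) (sub true w))) +
          powWeight lam s (w []) *
            (Z (limitMass (powWeight lam s) (sub false ν) (sub false w)) *
              (Z (limitMass (powWeight lam s) (sub true ν) (sub true w)) *
              powApprox lam s (sub true ν) n (sub true w)))) ∂treeLaw lam := by
          refine lintegral_congr_ae ?_
          filter_upwards [hrec ν hν hν'] with w hw
          rw [hw]
          simp only [powApprox, approxMass]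
          ring
      _ = _ := by
          rw [lintegral_add_left (by fun_prop), i1, i2, hP, hν.root]
          ring

/-- A uniform integrability argument with weight `Y`. Let `Z_n` be the approximations and `H = Y ^ s
/ η`. Then `Z_n ≤ min(Z_n, H) + η Z_n² Y ^ (-s)`, because `Z_n ≥ H` means `1 ≤ η Z_n Y ^ (-s)`. On
extinction the first term tends to zero, dominated by the integrable `H`, and the second has mean at
most `η C ν []`. Since `Z_n` has mean `P(extinction) ν []` there, letting `η → 0` excludes
extinction. -/
lemma IsCascadeLaw.ae_limitMass_ne_zero (h : IsCascadeLaw lam) (hs0 : 0 < s)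
    (hs1 : s < 1) {a : ℝ≥0∞} (ha : growth lam s * a < 1) (hν : IsFlow ν) (hν0 : ν [] ≠ 0)
    (hνa : ∀ l, ν l ≤ a ^ l.length) :
    ∀ᵐ w ∂treeLaw lam, limitMass (powWeight lam s) ν w ≠ 0 := by
  obtain ⟨C, hC, hb⟩ := h.exists_lintegral_powApprox_sq_le hs0.le hs1 ha
  have hν1 : ν [] ≤ 1 := by simpa using hνa []
  have hν' : ν [] ≠ ∞ := ne_top_of_le_ne_top ENNReal.one_ne_top hν1
  have hb' := fun n => hb ν 1 hν (fun l => by simpa using hνa l) n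
  simp only [mul_one] at hb'
  set Z : ℝ≥0∞ → ℝ≥0∞ := ({0} : Set ℝ≥0∞).indicator 1 with hZ
  have hZm : Measurable Z := measurable_one.indicator (measurableSet_singleton 0)
  have hZ1 : ∀ x, Z x ≤ 1 := fun x => Set.indicator_le_self' (by simp) x
  have hLm : Measurable (limitMass (powWeight lam s) ν) := measurable_limitMass (by fun_prop) ν
  have hZL := hZm.comp hLm
  simp only [Function.comp_def] at hZL
  set P := ∫⁻ w, Z (limitMass (powWeight lam s) ν w) ∂treeLaw lam with hP
  have hm := fun n => measurable_powApprox (lam := lam) (s := s) ν n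
  have key : ∀ η : ℝ≥0, 0 < η → P * ν [] ≤ η * (C * ν []) := by
    intro η hη
    have hη0 : (η : ℝ≥0∞) ≠ 0 := by simpa using hη.ne'
    set H : Weights → ℝ≥0∞ := fun w => lebMass w ^ s * (η : ℝ≥0∞)⁻¹ with hH
    have hHm : Measurable H := by fun_prop
    have hHfin : ∫⁻ w, H w ∂treeLaw lam ≠ ∞ := by
      rw [hH, lintegral_mul_const _ (by fun_prop)]
      refine ENNReal.mul_ne_top (ne_top_of_le_ne_top ENNReal.one_ne_top ?_) (by simpa using hη.ne')
      exact (lintegral_rpow_le _ measurable_lebMass hs0.le hs1.le).trans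
        (ENNReal.rpow_le_one (lintegral_lebMass_le lam h.mean) hs0.le)
    have hlim : Tendsto (fun n => ∫⁻ w, Z (limitMass (powWeight lam s) ν w) *
        min (powApprox lam s ν n w) (H w) ∂treeLaw lam) atTop (𝓝 (∫⁻ _w, 0 ∂treeLaw lam)) := by
      refine tendsto_lintegral_of_dominated_convergence H (fun n => ?_)
        (fun n => Eventually.of_forall fun w => ?_) hHfin ?_
      · have := hm n
        fun_prop
      · calc _ ≤ 1 * H w := mul_le_mul' (hZ1 _) (min_le_right _ _)
          _ = H w := one_mul _
      · filter_upwards [h.ae_isRegular_pow hs0.le hs1.le hν hν'] with w hw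
        have h1 : Tendsto (fun n => powApprox lam s ν n w) atTop
            (𝓝 (limitMass (powWeight lam s) ν w)) := hw.3 []
        by_cases h0 : limitMass (powWeight lam s) ν w = 0
        · rw [h0] at h1 ⊢
          have h2 := h1.min (tendsto_const_nhds (x := H w))
          have h3 := ENNReal.Tendsto.const_mul h2 (a := Z 0)
            (Or.inr ((hZ1 0).trans_lt ENNReal.one_lt_top).ne)
          simpa using h3
        · have : Z (limitMass (powWeight lam s) ν w) = 0 := Set.indicator_of_notMem (by simpa) _
          simp [this]
    have hle : ∀ n, P * ν [] ≤ (∫⁻ w, Z (limitMass (powWeight lam s) ν w) *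
        min (powApprox lam s ν n w) (H w) ∂treeLaw lam) + η * (C * ν []) := by
      intro n
      have := hm n
      rw [hP, ← h.lintegral_indicator_powApprox hs0.le hs1.le hν hν' n]
      calc _ ≤ ∫⁻ w, (Z (limitMass (powWeight lam s) ν w) * min (powApprox lam s ν n w) (H w) +
            η * (powApprox lam s ν n w ^ 2 * lebMass w ^ (-s))) ∂treeLaw lam := by
            refine lintegral_mono_ae ?_
            filter_upwards [h.ae_lebMass_pos, ae_isRegular_leb lam h.mean] with w hpos hreg
            rcases le_total (powApprox lam s ν n w) (H w) with hc | hc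
            · rw [min_eq_left hc]; exact le_self_add
            · refine le_add_of_nonneg_of_le zero_le ?_
              have hone : η * (H w * lebMass w ^ (-s)) = 1 := by
                have e1 : lebMass w ^ s * lebMass w ^ (-s) = 1 := by
                  rw [← ENNReal.rpow_add _ _ hpos.ne' (hreg.2 []).ne]; simp
                calc _ = (η * (η : ℝ≥0∞)⁻¹) * (lebMass w ^ s * lebMass w ^ (-s)) := by
                      rw [hH]; ring
                  _ = 1 := by rw [e1, ENNReal.mul_inv_cancel hη0 (by simp), mul_one]
              calc _ ≤ 1 * powApprox lam s ν n w := mul_le_mul_left (hZ1 _) _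
                _ = η * (H w * lebMass w ^ (-s)) * powApprox lam s ν n w := by rw [hone]
                _ ≤ η * (powApprox lam s ν n w * lebMass w ^ (-s)) * powApprox lam s ν n w := by
                    gcongr
                _ = _ := by ring
        _ = (∫⁻ w, Z (limitMass (powWeight lam s) ν w) * min (powApprox lam s ν n w) (H w)
              ∂treeLaw lam) +
              η * ∫⁻ w, powApprox lam s ν n w ^ 2 * lebMass w ^ (-s) ∂treeLaw lam := by
            rw [lintegral_add_left (by fun_prop), lintegral_const_mul _ (by fun_prop)]
        _ ≤ _ := by
            gcongr
            exact hb' n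
    have := ge_of_tendsto' (hlim.add (tendsto_const_nhds (x := η * (C * ν [])))) hle
    simpa using this
  have hP0 : P = 0 := by
    have h1 : P * ν [] ≤ 0 := by
      refine ENNReal.le_of_forall_pos_le_add fun ε hε _ => ?_
      have hCν : C * ν [] ≠ ∞ := ENNReal.mul_ne_top hC hν'
      obtain ⟨η, hη, hη'⟩ : ∃ η : ℝ≥0, 0 < η ∧ η * (C * ν []) ≤ ε := by
        lift C * ν [] to ℝ≥0 using hCν with c
        refine ⟨ε / (c + 1), by positivity, ?_⟩
        norm_cast
        rw [div_mul_eq_mul_div]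
        exact div_le_of_le_mul₀ (by positivity) (by positivity)
          (mul_le_mul_of_nonneg_left (by simp) (by positivity))
      rw [zero_add]
      exact (key η hη).trans hη'
    have := le_antisymm h1 zero_le
    simpa [hν0] using this
  filter_upwards [(lintegral_eq_zero_iff hZL).1 hP0] with w hw h0
  rw [h0] at hw
  simp [hZ] at hw

/-- Almost surely the limit of the cascade with weights `powWeight lam s` started from a flow which
decreases quickly enough is a nonzero flow with finite energy. -/
theorem IsCascadeLaw.ae_energy (h : IsCascadeLaw lam) (hs0 : 0 < s)
    (hs1 : s < 1) {a : ℝ≥0∞} (ha : growth lam s * a < 1) (hν : IsFlow ν) (hν0 : ν [] ≠ 0)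
    (hνa : ∀ l, ν l ≤ a ^ l.length) (nbr : List Bool → Bool → Finset (List Bool)) {m : ℕ}
    (hcard : ∀ p b, (nbr p b).card ≤ m)
    (hnbr : ∀ p b, ∀ q ∈ nbr p b, q.length = p.length + 1 ∧ q ≠ p ++ [b] ∧ q ≠ p ++ [!b]) :
    ∀ᵐ w ∂treeLaw lam, powNode lam s ν w [] ≠ 0 ∧ IsRegular (powWeight lam s) ν w ∧
      ∑' l, powNode lam s ν w l ^ 2 * lebNode w l ^ (-s) ≠ ∞ ∧
      ∑' p, ∑ b, ∑ q ∈ nbr p b, powNode lam s ν w (p ++ [b]) * powNode lam s ν w q *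
        lebNode w (p ++ [!b]) ^ (-s) ≠ ∞ := by
  have hν1 : ν [] ≤ 1 := by simpa using hνa []
  have hν' : ν [] ≠ ∞ := ne_top_of_le_ne_top ENNReal.one_ne_top hν1
  have hm := fun l => measurable_powNode (lam := lam) (s := s) ν l
  have hm' := measurable_lebNode
  have hgeom : ∀ c : ℝ≥0∞, c ≠ ∞ →
      c * ((1 - growth lam s * a)⁻¹ * ν []) ≠ ∞ := fun c hc =>
    ENNReal.mul_ne_top hc (ENNReal.mul_ne_top
      (ENNReal.inv_ne_top.2 (tsub_pos_of_lt ha).ne') hν')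
  have h1 : ∀ᵐ w ∂treeLaw lam, ∑' l, powNode lam s ν w l ^ 2 * lebNode w l ^ (-s) < ∞ := by
    obtain ⟨C, hC, hb⟩ := h.exists_lintegral_powNode_sq_le hs0.le hs1 ha
    have hml : ∀ l, Measurable fun w => powNode lam s ν w l ^ 2 * lebNode w l ^ (-s) := fun l => by
      have := hm l
      have := hm' l
      fun_prop
    refine MeasureTheory.ae_lt_top (Measurable.tsum hml) ?_
    rw [lintegral_tsum fun l => (hml l).aemeasurable]
    refine ne_top_of_le_ne_top (hgeom C hC) ?_
    rw [← hν.tsum_mul_pow, ← ENNReal.tsum_mul_left]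
    refine ENNReal.tsum_le_tsum fun l => ?_
    simpa using hb ν 1 hν (by simp) (fun l => by simpa using hνa l) l
  have h2 : ∀ᵐ w ∂treeLaw lam, ∑' p, ∑ b, ∑ q ∈ nbr p b, powNode lam s ν w (p ++ [b]) *
      powNode lam s ν w q * lebNode w (p ++ [!b]) ^ (-s) < ∞ := by
    set N := ∫⁻ w, lebMass w ^ (-s) ∂treeLaw lam with hN
    have hNfin : N ≠ ∞ := h.lintegral_lebMass_rpow_neg_ne_top hs0.le hs1
    have hml : ∀ p b q, Measurable fun w => powNode lam s ν w (p ++ [b]) * powNode lam s ν w q *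
        lebNode w (p ++ [!b]) ^ (-s) := fun p b q => by
      have := hm (p ++ [b])
      have := hm q
      have := hm' (p ++ [!b])
      fun_prop
    refine MeasureTheory.ae_lt_top (Measurable.tsum fun p => Finset.measurable_sum _ fun b _ =>
      Finset.measurable_sum _ fun q _ => hml p b q) ?_
    rw [lintegral_tsum fun p => (Finset.measurable_sum _ fun b _ =>
      Finset.measurable_sum _ fun q _ => hml p b q).aemeasurable]
    refine ne_top_of_le_ne_top (hgeom (m * N * (growth lam s * a)) ?_) ?_
    · refine ENNReal.mul_ne_top (ENNReal.mul_ne_top (by simp) hNfin) ?_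
      exact (ha.trans ENNReal.one_lt_top).ne
    rw [← hν.tsum_mul_pow, ← ENNReal.tsum_mul_left]
    refine ENNReal.tsum_le_tsum fun p => ?_
    rw [lintegral_finsetSum _ fun b _ => Finset.measurable_sum _ fun q _ => hml p b q]
    -- The decay hypothesis is spent on `ν q` alone; `ν (p ++ [b])` is kept, so that the flow
    -- property can sum it over each level.
    have hb : ∀ b, ∫⁻ w, ∑ q ∈ nbr p b, powNode lam s ν w (p ++ [b]) * powNode lam s ν w q *
        lebNode w (p ++ [!b]) ^ (-s) ∂treeLaw lam ≤
        m * N * (growth lam s * a) ^ (p.length + 1) * ν (p ++ [b]) := by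
      intro b
      rw [lintegral_finsetSum _ fun q _ => hml p b q]
      calc _ ≤ ∑ _q ∈ nbr p b, growth lam s ^ (p.length + 1) *
            (ν (p ++ [b]) * a ^ (p.length + 1) * N) := by
            refine Finset.sum_le_sum fun q hq => ?_
            obtain ⟨e1, e2, e3⟩ := hnbr p b q hq
            refine (h.lintegral_powNode_mul_powNode_mul_lebNode_le hs0.le hs1.le hν p q b
              e1 e2 e3).trans ?_
            gcongr
            rw [← e1]
            exact hνa q
        _ ≤ m * (growth lam s ^ (p.length + 1) * (ν (p ++ [b]) * a ^ (p.length + 1) * N)) := by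
            rw [Finset.sum_const, nsmul_eq_mul]
            gcongr
            exact hcard p b
        _ = _ := by rw [mul_pow]; ring
    calc _ ≤ ∑ b, m * N * (growth lam s * a) ^ (p.length + 1) * ν (p ++ [b]) :=
          Finset.sum_le_sum fun b _ => hb b
      _ = _ := by
          rw [Fintype.sum_bool, ← mul_add, add_comm (ν _), ← hν p, pow_succ]
          ring
  filter_upwards [h.ae_limitMass_ne_zero hs0 hs1 ha hν hν0 hνa,
    h.ae_isRegular_pow hs0.le hs1.le hν hν', h1, h2] with w a1 a2 a3 a4
  exact ⟨a1, a2, a3.ne, a4.ne⟩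

end

end Cascade

/-! ### Dyadic cells of the unit interval, and measures with prescribed cell masses -/

namespace Cascade

/-- The index of the dyadic interval of level `n` which contains `x`. -/
def pt (n : ℕ) (x : I) : ℕ := ⌈(x : ℝ) * 2 ^ n⌉₊ - 1

lemma pt_le_iff {n k : ℕ} {x : I} : pt n x ≤ k ↔ (x : ℝ) * 2 ^ n ≤ k + 1 := by
  rw [pt, Nat.sub_le_iff_le_add, Nat.ceil_le]
  push_cast
  rfl

lemma lt_pt_iff {n k : ℕ} {x : I} : k < pt n x ↔ (k : ℝ) + 1 < x * 2 ^ n := by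
  rw [← not_le, pt_le_iff, not_le]

lemma pt_lt (n : ℕ) (x : I) : pt n x < 2 ^ n := ceil_sub_one_lt_two_pow n x

/-- Truncated subtraction puts the point `0` into the first cell, and `pt_le_iff` covers this case
too, so the cells are nested without exception. -/
lemma pt_succ_div_two (n : ℕ) (x : I) : pt (n + 1) x / 2 = pt n x := by
  refine eq_of_forall_ge_iff fun k => ?_
  rw [Nat.div_le_iff_le_mul_add_pred two_pos, show 2 * k + (2 - 1) = 2 * k + 1 by omega, pt_le_iff,
    pt_le_iff]
  push_cast
  constructor <;> intro h <;> rw [pow_succ] at * <;> linarith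

lemma pt_mono (n : ℕ) : Monotone (pt n) := fun x y hxy => by
  have : (x : ℝ) ≤ y := hxy
  exact Nat.sub_le_sub_right (Nat.ceil_mono (by gcongr)) 1

lemma le_pt_add_one (n : ℕ) (x : I) : (x : ℝ) * 2 ^ n ≤ pt n x + 1 := pt_le_iff.1 le_rfl

lemma pt_le_mul (n : ℕ) (x : I) : (pt n x : ℝ) ≤ x * 2 ^ n := by
  rcases Nat.eq_zero_or_pos (pt n x) with h | h
  · rw [h]; have := x.2.1; push_cast; positivity
  · have := lt_pt_iff.1 (show pt n x - 1 < pt n x by omega)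
    rw [Nat.cast_sub (by omega)] at this
    push_cast at this
    linarith

lemma measurable_pt (n : ℕ) : Measurable (pt n) := by
  unfold pt
  fun_prop

/-- The number with the binary expansion `l`. -/
def num (l : List Bool) : ℕ := l.foldl (fun k b => 2 * k + b.toNat) 0

@[simp] lemma num_nil : num [] = 0 := rfl

@[simp] lemma num_append (l : List Bool) (b : Bool) : num (l ++ [b]) = 2 * num l + b.toNat := by
  simp [num]

/-- The word of length `n` which is the binary expansion of `k`. -/
def word : ℕ → ℕ → List Bool
  | 0, _ => []
  | n + 1, k => word n (k / 2) ++ [k.bodd]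

@[simp] lemma length_word (n k : ℕ) : (word n k).length = n := by
  induction n generalizing k with
  | zero => rfl
  | succ n ih => simp [word, ih]

lemma num_word {n k : ℕ} (hk : k < 2 ^ n) : num (word n k) = k := by
  induction n generalizing k with
  | zero => simp [word]; omega
  | succ n ih =>
    rw [word, num_append, ih (by omega)]
    have := Nat.bodd_add_div2 k
    rw [Nat.div2_val] at this
    omega

lemma word_num (l : List Bool) : word l.length (num l) = l := by
  induction l using List.reverseRecOn with
  | nil => rfl
  | append_singleton l b ih =>
    rw [List.length_append, List.length_singleton, word, num_append]
    have h1 : (2 * num l + b.toNat) / 2 = num l := by cases b <;> simp; omega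
    have h2 : (2 * num l + b.toNat).bodd = b := by cases b <;> simp
    rw [h1, h2, ih]

lemma num_lt (l : List Bool) : num l < 2 ^ l.length := by
  induction l using List.reverseRecOn with
  | nil => simp
  | append_singleton l b ih =>
    have : b.toNat ≤ 1 := Bool.toNat_le b
    rw [num_append, List.length_append, List.length_singleton, pow_succ]
    omega

lemma num_injOn {l l' : List Bool} (hl : l.length = l'.length) (h : num l = num l') : l = l' := by
  rw [← word_num l, ← word_num l', hl, h]

/-- The half open dyadic interval of the node `l` (closed if it contains `0`). -/
def cell (l : List Bool) : Set I := {x | pt l.length x = num l}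

/-- The node of level `n` whose cell contains `x`. -/
def code (n : ℕ) (x : I) : List Bool := word n (pt n x)

@[simp] lemma length_code (n : ℕ) (x : I) : (code n x).length = n := length_word _ _

lemma num_code (n : ℕ) (x : I) : num (code n x) = pt n x := num_word (pt_lt n x)

lemma mem_cell_iff {l : List Bool} {x : I} : x ∈ cell l ↔ code l.length x = l := by
  constructor
  · intro h
    have h' : pt l.length x = num l := h
    rw [code, h', word_num]
  · intro h
    have := num_code l.length x
    rw [h] at this
    exact this.symm

lemma mem_cell_code (n : ℕ) (x : I) : x ∈ cell (code n x) := by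
  rw [mem_cell_iff, length_code]

lemma code_succ (n : ℕ) (x : I) : ∃ b, code (n + 1) x = code n x ++ [b] := by
  refine ⟨(pt (n + 1) x).bodd, ?_⟩
  rw [code, word, pt_succ_div_two, code]

lemma measurableSet_cell (l : List Bool) : MeasurableSet (cell l) :=
  measurable_pt _ (measurableSet_singleton _)

@[simp] lemma cell_nil : cell [] = Set.univ := by
  ext x
  have := pt_lt 0 x
  simp [mem_cell_iff, code, word]

lemma mem_cell_append {l : List Bool} {b : Bool} {x : I} :
    x ∈ cell (l ++ [b]) ↔ x ∈ cell l ∧ (pt (l.length + 1) x).bodd = b := by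
  simp only [mem_cell_iff, List.length_append, List.length_singleton, code, word, pt_succ_div_two]
  simp

lemma cell_eq_union (l : List Bool) : cell l = cell (l ++ [false]) ∪ cell (l ++ [true]) := by
  ext x
  rw [Set.mem_union, mem_cell_append, mem_cell_append, ← and_or_left]
  simp

lemma disjoint_cell (l : List Bool) : Disjoint (cell (l ++ [false])) (cell (l ++ [true])) := by
  rw [Set.disjoint_left]
  intro x h h'
  simp_all [mem_cell_append]

lemma isFlow_cell (μ : Measure I) : IsFlow fun l => μ (cell l) := fun l => by
  dsimp only
  rw [cell_eq_union l]
  exact measure_union (disjoint_cell l) (measurableSet_cell _)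

lemma cell_prefix_subset {l l' : List Bool} (h : l <+: l') : cell l' ⊆ cell l := by
  obtain ⟨k, rfl⟩ := h
  induction k using List.reverseRecOn with
  | nil => simp
  | append_singleton k b ih =>
    rw [← List.append_assoc]
    exact fun x hx => ih (mem_cell_append.1 hx).1

lemma abs_sub_le_of_mem_cell {l : List Bool} {x y : I} (hx : x ∈ cell l) (hy : y ∈ cell l) :
    |(x : ℝ) - y| ≤ 2⁻¹ ^ l.length := by
  have hx1 := le_pt_add_one l.length x
  have hx2 := pt_le_mul l.length x
  have hy1 := le_pt_add_one l.length y
  have hy2 := pt_le_mul l.length y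
  rw [show pt l.length x = num l from hx] at hx1 hx2
  rw [show pt l.length y = num l from hy] at hy1 hy2
  have hp : (0 : ℝ) < 2 ^ l.length := by positivity
  rw [inv_pow, ← mul_le_mul_iff_left₀ hp, inv_mul_cancel₀ hp.ne', ← abs_of_pos hp, ← abs_mul,
    abs_le]
  constructor <;> linarith

/-- A flow is diffuse if it has no atoms. -/
def IsDiffuse (θ : List Bool → ℝ≥0∞) : Prop := ∀ ε, 0 < ε → ∃ n, ∀ l, n ≤ l.length → θ l < ε

/-- The mass of the first `k` nodes of level `n`. -/
def partialMass (θ : List Bool → ℝ≥0∞) (n k : ℕ) : ℝ := ∑ i ∈ Finset.range k, (θ (word n i)).toReal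

variable {θ : List Bool → ℝ≥0∞}

lemma partialMass_succ_two_mul (hθ : IsFlow θ) (hθ' : θ [] ≠ ∞) (n k : ℕ) :
    partialMass θ (n + 1) (2 * k) = partialMass θ n k := by
  induction k with
  | zero => simp [partialMass]
  | succ k ih =>
    have h1 : word (n + 1) (2 * k) = word n k ++ [false] := by simp [word]
    have h2 : word (n + 1) (2 * k + 1) = word n k ++ [true] := by
      rw [word]; congr 2
      · omega
      · simp
    rw [show 2 * (k + 1) = 2 * k + 1 + 1 by ring, partialMass, Finset.sum_range_succ,
      Finset.sum_range_succ, ← partialMass, ih, partialMass, partialMass, Finset.sum_range_succ,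
      hθ (word n k), ENNReal.toReal_add (hθ.ne_top hθ' _) (hθ.ne_top hθ' _), h1, h2, add_assoc]

lemma partialMass_add_mul (hθ : IsFlow θ) (hθ' : θ [] ≠ ∞) (n m k : ℕ) :
    partialMass θ (n + m) (2 ^ m * k) = partialMass θ n k := by
  induction m with
  | zero => simp
  | succ m ih =>
    rw [← add_assoc, pow_succ, mul_comm (2 ^ m) 2, mul_assoc, partialMass_succ_two_mul hθ hθ', ih]

lemma partialMass_mono (θ : List Bool → ℝ≥0∞) (n : ℕ) : Monotone (partialMass θ n) := fun _ _ h =>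
  Finset.sum_le_sum_of_subset_of_nonneg (Finset.range_mono h) fun _ _ _ => ENNReal.toReal_nonneg

lemma partialMass_zero (θ : List Bool → ℝ≥0∞) (n : ℕ) : partialMass θ n 0 = 0 := by
  simp [partialMass]

lemma partialMass_two_pow (hθ : IsFlow θ) (hθ' : θ [] ≠ ∞) (n : ℕ) :
    partialMass θ n (2 ^ n) = (θ []).toReal := by
  have := partialMass_add_mul hθ hθ' 0 n 1
  simpa [partialMass, word] using this

/-- The dyadic numbers to the left of which the flow has mass at most `u`. -/
def lowerDyadics (θ : List Bool → ℝ≥0∞) (u : ℝ) : Set ℝ :=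
  {x | ∃ n k : ℕ, k ≤ 2 ^ n ∧ partialMass θ n k ≤ u ∧ x = k / 2 ^ n}

lemma lowerDyadics_bound (θ : List Bool → ℝ≥0∞) (u : ℝ) :
    ∀ x ∈ lowerDyadics θ u, 0 ≤ x ∧ x ≤ 1 := by
  rintro x ⟨n, k, hk, -, rfl⟩
  refine ⟨by positivity, div_le_one_of_le₀ ?_ (by positivity)⟩
  exact_mod_cast hk

lemma bddAbove_lowerDyadics (θ : List Bool → ℝ≥0∞) (u : ℝ) : BddAbove (lowerDyadics θ u) :=
  ⟨1, fun x hx => (lowerDyadics_bound θ u x hx).2⟩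

/-- The quantile function of a flow. -/
def quantile (θ : List Bool → ℝ≥0∞) (u : ℝ) : I :=
  ⟨sSup (lowerDyadics θ u), Real.sSup_nonneg fun x hx => (lowerDyadics_bound θ u x hx).1,
    Real.sSup_le (fun x hx => (lowerDyadics_bound θ u x hx).2) zero_le_one⟩

lemma monotoneOn_quantile (θ : List Bool → ℝ≥0∞) : MonotoneOn (quantile θ) (Set.Ici 0) := by
  intro u hu v _ huv
  refine Subtype.mk_le_mk.2 (csSup_le_csSup (bddAbove_lowerDyadics θ v) ?_ ?_)
  · exact ⟨_, 0, 0, by simp, by simpa [partialMass_zero] using hu, rfl⟩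
  · rintro x ⟨n, k, hk, h, rfl⟩
    exact ⟨n, k, hk, h.trans huv, rfl⟩

/-- Partial masses at different levels are compared at a common finer level. The lower bound must be
strict because cells are open on the left: diffuseness provides a deep node just to the right of `k
/ 2 ^ n` with mass below `u - partialMass θ n k`, and the quantile lies beyond it. -/
lemma pt_quantile (hθ : IsFlow θ) (hθ' : θ [] ≠ ∞) (hd : IsDiffuse θ) {n k : ℕ} (hk : k < 2 ^ n)
    {u : ℝ} (h1 : partialMass θ n k < u) (h2 : u < partialMass θ n (k + 1)) :
    pt n (quantile θ u) = k := by
  have hne : (lowerDyadics θ u).Nonempty := ⟨_, n, k, hk.le, h1.le, rfl⟩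
  have hp : ∀ m : ℕ, (0 : ℝ) < 2 ^ m := fun m => by positivity
  refine le_antisymm (pt_le_iff.2 ?_) ?_
  · rw [← le_div_iff₀ (hp n)]
    refine csSup_le hne ?_
    rintro x ⟨m, j, hj, h, rfl⟩
    rw [div_le_div_iff₀ (hp m) (hp n)]
    by_contra! hlt
    have hlt' : 2 ^ m * (k + 1) ≤ 2 ^ n * j := by
      have : ((2 ^ m * (k + 1) : ℕ) : ℝ) ≤ (2 ^ n * j : ℕ) := by push_cast; linarith
      exact_mod_cast this
    have := partialMass_mono θ (n + m) hlt'
    rw [partialMass_add_mul hθ hθ', add_comm n m, partialMass_add_mul hθ hθ'] at this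
    linarith
  · obtain ⟨m, hm⟩ := hd (ENNReal.ofReal (u - partialMass θ n k)) (by simpa using h1)
    have hw := hm (word (n + m) (2 ^ m * k)) (by simp)
    have hw' : (θ (word (n + m) (2 ^ m * k))).toReal ≤ u - partialMass θ n k :=
      ENNReal.toReal_le_of_le_ofReal (by linarith) hw.le
    have hS : partialMass θ (n + m) (2 ^ m * k + 1) ≤ u := by
      rw [partialMass, Finset.sum_range_succ, ← partialMass, partialMass_add_mul hθ hθ']
      linarith
    have hle : ((2 ^ m * k + 1 : ℕ) : ℝ) / 2 ^ (n + m) ≤ quantile θ u := by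
      refine le_csSup (bddAbove_lowerDyadics θ u) ⟨n + m, _, ?_, hS, rfl⟩
      rw [pow_add, mul_comm (2 ^ n)]
      have : 2 ^ m * (k + 1) ≤ 2 ^ m * 2 ^ n := Nat.mul_le_mul_left _ hk
      have : 1 ≤ 2 ^ m := Nat.one_le_two_pow
      nlinarith
    have hlt : (k : ℝ) < quantile θ u * 2 ^ n := by
      rw [div_le_iff₀ (hp _), pow_add, ← mul_assoc] at hle
      push_cast at hle
      by_contra! hcon
      have := mul_le_mul_of_nonneg_right hcon (hp m).le
      linarith
    by_contra! hcon
    have := pt_le_iff.1 (Nat.le_sub_one_of_lt hcon)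
    rw [Nat.cast_sub (by omega)] at this
    push_cast at this
    linarith

/-- Both flows have the same finite sum over each level, so the termwise inequalities are
equalities. -/
lemma IsFlow.eq_of_le {θ' : List Bool → ℝ≥0∞} (hθ : IsFlow θ) (hθ₂ : IsFlow θ')
    (hle : ∀ l, θ l ≤ θ' l) (h : θ [] = θ' []) (hfin : θ [] ≠ ∞) : θ = θ' := by
  funext l
  have hs1 := hθ.sum_words l.length
  have hs2 := hθ₂.sum_words l.length
  rw [← h, ← hs1] at hs2
  refine le_antisymm (hle l) ?_
  rw [← Finset.add_sum_erase _ _ (mem_words.2 rfl : l ∈ words l.length),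
    ← Finset.add_sum_erase _ θ (mem_words.2 rfl : l ∈ words l.length)] at hs2
  have hfin : ∑ i ∈ (words l.length).erase l, θ i ≠ ∞ :=
    ENNReal.sum_ne_top.2 fun i _ => hθ.ne_top hfin i
  refine (ENNReal.add_le_add_iff_right hfin).1 (hs2 ▸ ?_)
  exact add_le_add le_rfl (Finset.sum_le_sum fun i _ => hle i)

/-- A diffuse flow of finite mass is the flow of the masses of the dyadic cells for some measure. -/
theorem exists_measure_cell_eq (hθ : IsFlow θ) (hθ' : θ [] ≠ ∞) (hd : IsDiffuse θ) :
    ∃ μ : Measure I, ∀ l, μ (cell l) = θ l := by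
  set T := (θ []).toReal with hT
  have hq : AEMeasurable (quantile θ) (volume.restrict (Set.Icc 0 T)) :=
    aemeasurable_restrict_of_monotoneOn measurableSet_Icc
      ((monotoneOn_quantile θ).mono fun x hx => hx.1)
  set μ := (volume.restrict (Set.Icc 0 T)).map (quantile θ) with hμ
  have huniv : μ (cell []) = θ [] := by
    rw [hμ, Measure.map_apply_of_aemeasurable hq (measurableSet_cell _)]
    simp [hT, ENNReal.ofReal_toReal hθ']
  -- One inequality suffices, the totals being equal. It only needs the open interval of `u` on
  -- which `pt_quantile` locates the quantile, so endpoints play no role.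
  have hle : ∀ l, θ l ≤ μ (cell l) := by
    intro l
    have hS : partialMass θ l.length (num l + 1) =
        partialMass θ l.length (num l) + (θ l).toReal := by
      rw [partialMass, Finset.sum_range_succ, word_num]
      rfl
    have h0 : 0 ≤ partialMass θ l.length (num l) := by
      rw [← partialMass_zero θ l.length]
      exact partialMass_mono _ _ (Nat.zero_le _)
    have h1 : partialMass θ l.length (num l + 1) ≤ T := by
      rw [hT, ← partialMass_two_pow hθ hθ' l.length]
      exact partialMass_mono _ _ (num_lt l)
    calc θ l = volume (Set.Ioo (partialMass θ l.length (num l))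
          (partialMass θ l.length (num l + 1))) := by
          rw [Real.volume_Ioo, hS, add_sub_cancel_left, ENNReal.ofReal_toReal (hθ.ne_top hθ' l)]
      _ ≤ volume.restrict (Set.Icc 0 T) (quantile θ ⁻¹' cell l) := by
          rw [← Measure.restrict_eq_self volume
            (fun u hu => ⟨h0.trans hu.1.le, hu.2.le.trans h1⟩ :
              Set.Ioo (partialMass θ l.length (num l)) (partialMass θ l.length (num l + 1)) ⊆
                Set.Icc 0 T)]
          exact measure_mono fun u hu => pt_quantile hθ hθ' hd (num_lt l) hu.1 hu.2
      _ = μ (cell l) := by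
          rw [hμ, Measure.map_apply_of_aemeasurable hq (measurableSet_cell _)]
  refine ⟨μ, fun l => ?_⟩
  exact (congrFun (hθ.eq_of_le (isFlow_cell μ) hle huniv.symm hθ') l).symm

end Cascade

/-! ### Weak convergence of the approximations, and the metric -/

namespace Cascade

lemma cell_subset_Ioo {n k : ℕ} (hk : k < 2 ^ n) {x y : I} (h1 : pt n x < k) (h2 : k < pt n y) :
    cell (word n k) ⊆ Set.Ioo x y := by
  intro z hz
  have hz' : pt n z = k := by
    have : pt (word n k).length z = num (word n k) := hz
    rwa [length_word, num_word hk] at this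
  constructor
  · by_contra! h
    have := pt_mono n h
    omega
  · by_contra! h
    have := pt_mono n h
    omega

lemma ordConnected_cell (l : List Bool) : (cell l).OrdConnected := by
  refine ⟨fun x hx y hy z hz => ?_⟩
  have h1 := pt_mono l.length hz.1
  have h2 := pt_mono l.length hz.2
  rw [show pt l.length x = num l from hx] at h1
  rw [show pt l.length y = num l from hy] at h2
  exact le_antisymm h2 h1

/-- A cell lies in a closed interval of length `2⁻ⁿ`; since the total masses agree, the upper bounds
are equalities by `IsFlow.eq_of_le`. -/
lemma volume_cell (l : List Bool) : (volume : Measure I) (cell l) = 2⁻¹ ^ l.length := by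
  have hf := isFlow_cell (volume : Measure I)
  refine congrFun (hf.eq_of_le isFlow_leb (fun l => ?_) (by simp [leb]) (by simp)) l
  have hp : (0 : ℝ) < 2 ^ l.length := by positivity
  have hn : ((num l + 1 : ℕ) : ℝ) ≤ (2 ^ l.length : ℕ) := by exact_mod_cast num_lt l
  push_cast at hn
  have ha : (num l : ℝ) / 2 ^ l.length ∈ I := by
    refine ⟨by positivity, div_le_one_of_le₀ ?_ hp.le⟩
    linarith
  have hb : ((num l : ℝ) + 1) / 2 ^ l.length ∈ I :=
    ⟨by positivity, div_le_one_of_le₀ hn hp.le⟩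
  calc (volume : Measure I) (cell l) ≤ volume (Set.Icc (⟨_, ha⟩ : I) ⟨_, hb⟩) := by
        refine measure_mono fun x hx => ?_
        have hx1 := le_pt_add_one l.length x
        have hx2 := pt_le_mul l.length x
        rw [show pt l.length x = num l from hx] at hx1 hx2
        exact ⟨Subtype.mk_le_mk.2 ((div_le_iff₀ hp).2 hx2), Subtype.mk_le_mk.2 ((le_div_iff₀ hp).2 hx1)⟩
    _ = leb l := by
        rw [unitInterval.volume_Icc, ← sub_div, add_sub_cancel_left, leb, one_div,
          ENNReal.ofReal_inv_of_pos hp, ENNReal.ofReal_pow (by simp), ENNReal.inv_pow]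
        simp

open Classical in
/-- A point of the cell of the node `l`, if there is one. -/
def cellPoint (l : List Bool) : I := if h : (cell l).Nonempty then h.some else 0

lemma cellPoint_mem {l : List Bool} {x : I} (hx : x ∈ cell l) : cellPoint l ∈ cell l := by
  have h : (cell l).Nonempty := ⟨x, hx⟩
  rw [cellPoint, dif_pos h]
  exact h.some_mem

lemma apply_code_eq_sum {M : Type*} [AddCommMonoid M] (c : List Bool → M) (n : ℕ) (x : I) :
    c (code n x) = ∑ l ∈ words n, (cell l).indicator (fun _ => c l) x := by
  rw [Finset.sum_eq_single (code n x)]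
  · rw [Set.indicator_of_mem (mem_cell_code n x)]
  · intro l hl hne
    refine Set.indicator_of_notMem (fun h => hne ?_) _
    rw [mem_cell_iff, mem_words.1 hl] at h
    exact h.symm
  · simp

lemma integral_apply_code (μ : Measure I) [IsFiniteMeasure μ] (c : List Bool → ℝ) (n : ℕ) :
    ∫ x, c (code n x) ∂μ = ∑ l ∈ words n, μ.real (cell l) * c l := by
  simp_rw [apply_code_eq_sum c n]
  rw [integral_finsetSum]
  · refine Finset.sum_congr rfl fun l _ => ?_
    rw [integral_indicator_const _ (measurableSet_cell l), smul_eq_mul]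
  · exact fun l _ => (integrable_const _).indicator (measurableSet_cell l)

lemma integrable_apply_code (μ : Measure I) [IsFiniteMeasure μ] (c : List Bool → ℝ) (n : ℕ) :
    Integrable (fun x => c (code n x)) μ := by
  simp_rw [apply_code_eq_sum c n]
  exact integrable_finsetSum _ fun l _ => (integrable_const _).indicator (measurableSet_cell l)

lemma exists_dist_cellPoint_le (f : I → ℝ) (hf : Continuous f) {ε : ℝ} (hε : 0 < ε) :
    ∃ n, ∀ x, |f x - f (cellPoint (code n x))| ≤ ε := by
  obtain ⟨δ, hδ, h⟩ := Metric.uniformContinuous_iff.1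
    (CompactSpace.uniformContinuous_of_continuous hf) ε hε
  obtain ⟨n, hn⟩ := exists_pow_lt_of_lt_one hδ (by norm_num : (2⁻¹ : ℝ) < 1)
  refine ⟨n, fun x => (h (lt_of_le_of_lt ?_ hn)).le⟩
  have := abs_sub_le_of_mem_cell (mem_cell_code n x) (cellPoint_mem (mem_cell_code n x))
  rwa [length_code] at this

/-- Convergence of the masses of the dyadic cells implies weak convergence. -/
theorem tendsto_of_tendsto_cell {μs : ℕ → FiniteMeasure I} {μ : FiniteMeasure I}
    (h : ∀ l, Tendsto (fun n => (μs n : Measure I) (cell l)) atTop (𝓝 ((μ : Measure I) (cell l)))) :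
    Tendsto μs atTop (𝓝 μ) := by
  have hr : ∀ l, Tendsto (fun n => (μs n : Measure I).real (cell l)) atTop
      (𝓝 ((μ : Measure I).real (cell l))) := fun l =>
    (ENNReal.tendsto_toReal (measure_ne_top _ _)).comp (h l)
  rw [FiniteMeasure.tendsto_iff_forall_integral_tendsto]
  intro f
  have hmass := hr []
  simp only [cell_nil] at hmass
  set M := (μ : Measure I).real Set.univ with hM
  have hM0 : 0 ≤ M := measureReal_nonneg
  rw [Metric.tendsto_atTop]
  intro ε hε
  -- The total masses are eventually below `M + 1`, so replacing `f` by a function constant on cells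
  -- costs at most `ε / 4` for each measure involved.
  obtain ⟨N, hN⟩ := exists_dist_cellPoint_le f f.continuous (ε := ε / (4 * (M + 1))) (by positivity)
  set c : List Bool → ℝ := fun l => f (cellPoint l) with hc
  have happrox : ∀ ν : FiniteMeasure I, (ν : Measure I).real Set.univ ≤ M + 1 →
      |∫ x, f x ∂(ν : Measure I) - ∫ x, c (code N x) ∂(ν : Measure I)| ≤ ε / 4 := by
    intro ν hν
    rw [← integral_sub (f.integrable _) (integrable_apply_code _ c N)]
    refine (norm_integral_le_of_norm_le_const (μ := (ν : Measure I)) (C := ε / (4 * (M + 1)))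
      (ae_of_all _ fun x => by rw [Real.norm_eq_abs]; exact hN x)).trans ?_
    calc ε / (4 * (M + 1)) * (ν : Measure I).real Set.univ ≤ ε / (4 * (M + 1)) * (M + 1) := by
          gcongr
      _ = ε / 4 := by field_simp
  have hstep : Tendsto (fun n => ∫ x, c (code N x) ∂(μs n : Measure I)) atTop
      (𝓝 (∫ x, c (code N x) ∂(μ : Measure I))) := by
    simp_rw [integral_apply_code]
    exact tendsto_finsetSum _ fun l _ => (hr l).mul_const _
  obtain ⟨n1, h1⟩ := eventually_atTop.1 (hmass.eventually (gt_mem_nhds (lt_add_one M)))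
  obtain ⟨n2, h2⟩ := Metric.tendsto_atTop.1 hstep (ε / 4) (by positivity)
  refine ⟨max n1 n2, fun n hn => ?_⟩
  have e1 := happrox (μs n) (h1 n (le_of_max_le_left hn)).le
  have e2 := happrox μ (by linarith)
  have e3 := h2 n (le_of_max_le_right hn)
  rw [Real.dist_eq] at e3 ⊢
  rw [abs_le] at e1 e2
  rw [abs_lt] at e3 ⊢
  constructor <;> linarith [e1.1, e1.2, e2.1, e2.2, e3.1, e3.2]

/-- The index of the dyadic interval of a node. -/
def toIndex (l : List Bool) : DyadicIndex := ⟨l.length, ⟨num l, num_lt l⟩⟩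

lemma toIndex_injective : Function.Injective toIndex := by
  intro l l' h
  have h1 : l.length = l'.length := congrArg Sigma.fst h
  have h2 : num l = num l' := congrArg (fun J : DyadicIndex => (J.2 : ℕ)) h
  exact num_injOn h1 h2

lemma dyadicAt_eq (n : ℕ) (x : I) : dyadicAt n x = toIndex (code n x) := by
  have h1 : (toIndex (code n x)).1 = n := length_code n x
  refine Sigma.ext h1.symm ?_
  refine (Fin.heq_ext_iff (by rw [h1]; rfl)).2 ?_
  exact (num_code n x).symm

/-- The weights of the nodes. -/
def nodeWeights (w : DyadicIndex → ℝ) : Weights := fun l => ENNReal.ofReal (w (toIndex l))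

/-- The product of the weights of the proper ancestors of the node `l`. -/
def pathWeight : Weights → List Bool → ℝ≥0∞
  | _, [] => 1
  | w, b :: l => w [] * pathWeight (sub b w) l

lemma pathWeight_append (w : Weights) (l : List Bool) (b : Bool) :
    pathWeight w (l ++ [b]) = pathWeight w l * w l := by
  induction l generalizing w with
  | nil => simp [pathWeight]
  | cons a l ih => simp [pathWeight, ih, mul_assoc]

lemma pathWeight_ne_top {w : Weights} (hw : ∀ l, w l < ∞) (l : List Bool) :
    pathWeight w l ≠ ∞ := by
  induction l generalizing w with
  | nil => simp [pathWeight]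
  | cons b l ih => exact ENNReal.mul_ne_top (hw []).ne (ih fun l => hw (b :: l))

lemma ofReal_cascadeDensity {w : DyadicIndex → ℝ} (hw : ∀ J, 0 ≤ w J) (n : ℕ) (x : I) :
    ENNReal.ofReal (cascadeDensity w n x) = pathWeight (nodeWeights w) (code n x) := by
  rw [cascadeDensity, ENNReal.ofReal_prod_of_nonneg fun _ _ => hw _]
  induction n with
  | zero => simp [code, word, pathWeight]
  | succ n ih =>
    obtain ⟨b, hb⟩ := code_succ n x
    rw [Finset.prod_range_succ, ih, hb, pathWeight_append, dyadicAt_eq]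
    rfl

lemma lebNode_eq (w : Weights) (l : List Bool) :
    lebNode w l = pathWeight w l * 2⁻¹ ^ l.length * lebMass (subAt l w) := by
  induction l generalizing w with
  | nil => simp [pathWeight, lebNode_nil]
  | cons b l ih =>
    rw [lebNode_cons, ih, pathWeight, List.length_cons, pow_succ, subAt_cons]
    ring

/-- At level `l.length` the density is constant on the cell and involves only proper ancestors of
`l`. Deeper levels follow by splitting the cell into its children. -/
lemma cascadeApprox_cell {w : DyadicIndex → ℝ} (hw : ∀ J, 0 ≤ w J) (l : List Bool) (k : ℕ) :
    (cascadeApprox w (l.length + k) : Measure I) (cell l) =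
      pathWeight (nodeWeights w) l * 2⁻¹ ^ l.length * lebApprox k (subAt l (nodeWeights w)) := by
  induction k generalizing l with
  | zero =>
    rw [lebApprox_zero, mul_one, add_zero]
    simp only [cascadeApprox, FiniteMeasure.toMeasure_mk]
    rw [withDensity_apply _ (measurableSet_cell l), ← volume_cell,
      setLIntegral_congr_fun (g := fun _ => pathWeight (nodeWeights w) l) (measurableSet_cell l)]
    · simp
    · intro x hx
      dsimp only
      rw [ofReal_cascadeDensity hw, mem_cell_iff.1 hx]
  | succ k ih =>
    have h := isFlow_cell (cascadeApprox w (l.length + (k + 1)) : Measure I) l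
    have h1 : ∀ b, l.length + (k + 1) = (l ++ [b]).length + k := fun b => by simp; ring
    dsimp only at h
    rw [h]
    nth_rw 1 [h1 false]
    rw [h1 true, ih, ih, pathWeight_append, pathWeight_append, lebApprox_succ, ← sub_subAt,
      ← sub_subAt, List.length_append, List.length_append, subAt_apply, List.append_nil]
    simp only [List.length_singleton, pow_succ]
    ring

/-- For nonnegative weights for which the cascade is regular and has no atoms, the weak limit exists
and the masses of the cells are the masses of the nodes. -/
theorem exists_cascadeMeasure_cell {w : DyadicIndex → ℝ} (hw : ∀ J, 0 ≤ w J)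
    (hreg : IsRegular id leb (nodeWeights w)) (hd : IsDiffuse (lebNode (nodeWeights w))) :
    Tendsto (fun n => cascadeApprox w n) atTop (𝓝 (cascadeMeasure w)) ∧
      ∀ l, (cascadeMeasure w : Measure I) (cell l) = lebNode (nodeWeights w) l := by
  obtain ⟨μ, hμ⟩ := exists_measure_cell_eq (θ := lebNode (nodeWeights w)) hreg.isFlow_nodeMass
    (hreg.nodeMass_lt_top []).ne hd
  have hfin : IsFiniteMeasure μ := ⟨by
    rw [← cell_nil, hμ]
    exact hreg.nodeMass_lt_top []⟩
  have ht : Tendsto (fun n => cascadeApprox w n) atTop (𝓝 (⟨μ, hfin⟩ : FiniteMeasure I)) := by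
    refine tendsto_of_tendsto_cell fun l => ?_
    rw [FiniteMeasure.toMeasure_mk, hμ, lebNode_eq, ← tendsto_add_atTop_iff_nat l.length]
    simp_rw [add_comm _ l.length, cascadeApprox_cell hw]
    have hsub : subAt l leb = fun l' => 2⁻¹ ^ l.length * leb l' := by
      funext l'
      simp [leb, pow_add]
    have ht := hreg.tendsto l
    have hc : (2⁻¹ : ℝ≥0∞) ^ l.length ≠ ∞ := by simp
    simp only [hsub, approxMass_const_mul, limitMass_const_mul id hc] at ht
    simp only [mul_assoc]
    exact ENNReal.Tendsto.const_mul ht (Or.inr (pathWeight_ne_top hreg.weight_lt_top l))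
  have he : cascadeMeasure w = ⟨μ, hfin⟩ := ht.limUnder_eq
  rw [he]
  exact ⟨ht, hμ⟩

lemma isDiffuse_of_tendsto {θ : List Bool → ℝ≥0∞} {f : ℕ → ℝ≥0∞} (hf : Tendsto f atTop (𝓝 0))
    (h : ∀ l, θ l ≤ f l.length) : IsDiffuse θ := by
  intro ε hε
  obtain ⟨n, hn⟩ := eventually_atTop.1 (hf.eventually (gt_mem_nhds hε))
  exact ⟨n, fun l hl => (h l).trans_lt (hn _ hl)⟩

section
variable (μ : Measure I)

/-- The distribution function of a measure on the unit interval. -/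
def distFun (x : I) : ℝ := μ.real (Set.Iic x)

variable {μ}

lemma measure_singleton_of_isDiffuse (hd : IsDiffuse fun l => μ (cell l)) (x : I) : μ {x} = 0 := by
  by_contra! h
  obtain ⟨n, hn⟩ := hd _ (pos_iff_ne_zero.2 h)
  have := hn (code n x) (by simp)
  exact absurd (measure_mono (Set.singleton_subset_iff.2 (mem_cell_code n x))) this.not_ge

variable [IsFiniteMeasure μ]

lemma distFun_sub {x y : I} (h : x ≤ y) : distFun μ y - distFun μ x = μ.real (Set.Ioc x y) := by
  have : Set.Iic y \ Set.Iic x = Set.Ioc x y := by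
    ext z; simp [and_comm]
  rw [distFun, distFun, ← this, measureReal_sdiff (Set.Iic_subset_Iic.2 h) measurableSet_Iic]

lemma abs_distFun_sub (hd : IsDiffuse fun l => μ (cell l)) (x y : I) :
    |distFun μ x - distFun μ y| = μ.real (Set.uIcc x y) := by
  wlog h : x ≤ y generalizing x y
  · rw [abs_sub_comm, Set.uIcc_comm]
    exact this y x (le_of_not_ge h)
  rw [abs_sub_comm, distFun_sub h, Set.uIcc_of_le h, abs_of_nonneg measureReal_nonneg,
    ← Set.Ioc_insert_left h]
  refine congrArg ENNReal.toReal (le_antisymm (measure_mono (Set.subset_insert _ _)) ?_)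
  rw [Set.insert_eq]
  refine (measure_union_le _ _).trans ?_
  rw [measure_singleton_of_isDiffuse hd, zero_add]

lemma exists_pt_gap {x y : I} (h : x < y) : ∃ n, pt n x + 1 < pt n y := by
  have h' : (0 : ℝ) < y - x := sub_pos.2 h
  obtain ⟨n, hn⟩ := exists_nat_gt (3 / ((y : ℝ) - x))
  refine ⟨n, ?_⟩
  rw [div_lt_iff₀ h'] at hn
  have h2 : (n : ℝ) < 2 ^ n := by exact_mod_cast Nat.lt_two_pow_self
  have h1 := le_pt_add_one n y
  have h3 := pt_le_mul n x
  have : (pt n x : ℝ) + 1 < pt n y := by nlinarith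
  exact_mod_cast this

lemma distFun_strictMono (hpos : ∀ l, 0 < μ (cell l)) : StrictMono (distFun μ) := by
  intro x y h
  obtain ⟨n, hn⟩ := exists_pt_gap h
  have hk : pt n x + 1 < 2 ^ n := hn.trans (pt_lt n y)
  rw [← sub_pos, distFun_sub h.le]
  refine ENNReal.toReal_pos ?_ (measure_ne_top _ _)
  refine ((hpos (word n (pt n x + 1))).trans_le (measure_mono ?_)).ne'
  exact (cell_subset_Ioo hk (Nat.lt_succ_self _) hn).trans Set.Ioo_subset_Ioc_self

lemma distFun_sub_le {l : List Bool} {x y : I} (hx : x ∈ cell l) (hy : y ∈ cell l) :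
    ENNReal.ofReal |distFun μ x - distFun μ y| ≤ μ (cell l) := by
  wlog h : x ≤ y generalizing x y
  · rw [abs_sub_comm]
    exact this hy hx (le_of_not_ge h)
  rw [abs_sub_comm, distFun_sub h, abs_of_nonneg measureReal_nonneg,
    ofReal_measureReal (measure_ne_top _ _)]
  exact measure_mono (Set.Ioc_subset_Icc_self.trans ((ordConnected_cell l).out hx hy))

/-- The metric `|F x - F y|` has the required distances and Hausdorff dimensions. -/
theorem exists_metricSpace_distFun (hd : IsDiffuse fun l => μ (cell l))
    (hpos : ∀ l, 0 < μ (cell l)) : ∃ m : MetricSpace I,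
      (∀ x y : I, m.dist x y = μ.real (Set.uIcc x y)) ∧
        ∀ K : Set I, @dimH I m.toEMetricSpace K = dimH (distFun μ '' K) := by
  -- Pulling back the metric of the line makes `distFun μ` an isometric embedding, so Hausdorff
  -- dimensions are those of images in `ℝ`. Atoms must be absent for `|F x - F y|` to be the mass of
  -- the closed interval.
  refine ⟨MetricSpace.induced (distFun μ) (distFun_strictMono hpos).injective inferInstance,
    fun x y => ?_, fun K => ?_⟩
  · rw [← abs_distFun_sub hd]
    rfl
  · let m := MetricSpace.induced (distFun μ) (distFun_strictMono hpos).injective inferInstance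
    exact (@Isometry.dimH_image I ℝ m.toEMetricSpace _ (distFun μ)
      (MetricSpace.isometry_induced (distFun μ) (distFun_strictMono hpos).injective) K).symm

end

end Cascade

/-! ### Net contents and the increasing sets lemma -/

namespace Cascade

lemma mem_cell_of_prefix {l p : List Bool} {x : I} (h : x ∈ cell l) (hp : p <+: l) : x ∈ cell p :=
  cell_prefix_subset hp h

lemma prefix_of_mem_cell {p l : List Bool} {x : I} (hp : x ∈ cell p) (hl : x ∈ cell l)
    (h : p.length ≤ l.length) : p <+: l := by
  have hx : x ∈ cell (l.take p.length) := cell_prefix_subset (List.take_prefix _ _) hl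
  rw [mem_cell_iff] at hp hx
  rw [List.length_take, min_eq_left h, hp] at hx
  rw [hx]
  exact List.take_prefix _ _

lemma sum_words_succ' {M : Type*} [AddCommMonoid M] (n : ℕ) (f : List Bool → M) :
    ∑ l ∈ words (n + 1), f l = ∑ l ∈ words n, (f (l ++ [false]) + f (l ++ [true])) := by
  induction n generalizing f with
  | zero => simp [words]
  | succ n ih =>
    rw [sum_words_succ, ih, ih, sum_words_succ]
    rfl

/-- The cost of the set `U` of nodes when a node of level `n` costs `a ^ n`. -/
def cost (a : ℝ≥0∞) (U : Set (List Bool)) : ℝ≥0∞ := ∑' l, U.indicator (fun l => a ^ l.length) l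

/-- The smallest cost of a covering of `E` by cells. -/
def netContent (a : ℝ≥0∞) (E : Set I) : ℝ≥0∞ :=
  ⨅ (U : Set (List Bool)) (_ : E ⊆ ⋃ l ∈ U, cell l), cost a U

variable {a : ℝ≥0∞} {E F : Set I}

lemma netContent_le_cost {U : Set (List Bool)} (h : E ⊆ ⋃ l ∈ U, cell l) :
    netContent a E ≤ cost a U := iInf₂_le U h

lemma exists_cost_lt {c : ℝ≥0∞} (h : netContent a E < c) :
    ∃ U : Set (List Bool), E ⊆ (⋃ l ∈ U, cell l) ∧ cost a U < c := by
  simpa only [netContent, iInf_lt_iff, exists_prop] using h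

lemma netContent_mono (h : E ⊆ F) : netContent a E ≤ netContent a F :=
  le_iInf₂ fun _ hU => netContent_le_cost (h.trans hU)

lemma pow_le_cost {U : Set (List Bool)} {l : List Bool} (h : l ∈ U) : a ^ l.length ≤ cost a U := by
  refine le_trans (le_of_eq ?_) (ENNReal.le_tsum l)
  rw [Set.indicator_of_mem h]

lemma cost_singleton (a : ℝ≥0∞) (l : List Bool) : cost a {l} = a ^ l.length := by
  rw [cost, tsum_eq_single l fun l' hl => by simp [hl]]
  simp

lemma cost_iUnion_le {ι : Type*} (U : ι → Set (List Bool)) : cost a (⋃ i, U i) ≤ ∑' i, cost a (U i) := by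
  simp only [cost]
  rw [ENNReal.tsum_comm]
  refine ENNReal.tsum_le_tsum fun l => ?_
  by_cases h : l ∈ ⋃ i, U i
  · obtain ⟨i, hi⟩ := Set.mem_iUnion.1 h
    rw [Set.indicator_of_mem h]
    refine le_trans ?_ (ENNReal.le_tsum i)
    rw [Set.indicator_of_mem hi]
  · rw [Set.indicator_of_notMem h]
    exact zero_le

lemma netContent_cell_le (a : ℝ≥0∞) (E : Set I) (l : List Bool) :
    netContent a (E ∩ cell l) ≤ a ^ l.length := by
  rw [← cost_singleton]
  exact netContent_le_cost (by simp)

lemma netContent_le_one (a : ℝ≥0∞) (E : Set I) : netContent a E ≤ 1 := by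
  simpa using netContent_cell_le a E []

@[simp] lemma netContent_empty (a : ℝ≥0∞) : netContent a ∅ = 0 :=
  le_antisymm ((netContent_le_cost (U := ∅) (by simp)).trans (by simp [cost])) zero_le

lemma netContent_iUnion_le {ι : Type*} [Countable ι] (E : ι → Set I) :
    netContent a (⋃ i, E i) ≤ ∑' i, netContent a (E i) := by
  refine ENNReal.le_of_forall_pos_le_add fun ε hε _ => ?_
  obtain ⟨ε', hε', hsum⟩ := ENNReal.exists_pos_sum_of_countable (ENNReal.coe_pos.2 hε).ne' ι
  have h : ∀ i, ∃ U : Set (List Bool), E i ⊆ (⋃ l ∈ U, cell l) ∧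
      cost a U < netContent a (E i) + ε' i := fun i => by
    refine exists_cost_lt (ENNReal.lt_add_right ?_ ?_)
    · exact ne_top_of_le_ne_top ENNReal.one_ne_top (netContent_le_one _ _)
    · exact (ENNReal.coe_pos.2 (hε' i)).ne'
  choose U hU hU' using h
  calc netContent a (⋃ i, E i) ≤ cost a (⋃ i, U i) := by
        refine netContent_le_cost (Set.iUnion_subset fun i => (hU i).trans ?_)
        exact Set.biUnion_subset_biUnion_left (Set.subset_iUnion U i)
    _ ≤ ∑' i, (netContent a (E i) + ε' i) :=
        (cost_iUnion_le U).trans (ENNReal.tsum_le_tsum fun i => (hU' i).le)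
    _ ≤ _ := by
        rw [ENNReal.tsum_add]
        exact add_le_add le_rfl hsum.le

lemma netContent_union_le (E F : Set I) :
    netContent a (E ∪ F) ≤ netContent a E + netContent a F := by
  rw [Set.union_eq_iUnion]
  refine (netContent_iUnion_le _).trans (le_of_eq ?_)
  rw [tsum_bool, add_comm]
  rfl

lemma netContent_le_of_children (a : ℝ≥0∞) (E : Set I) (l : List Bool) :
    netContent a (E ∩ cell l) ≤
      netContent a (E ∩ cell (l ++ [false])) + netContent a (E ∩ cell (l ++ [true])) := by
  rw [cell_eq_union l, Set.inter_union_distrib_left]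
  exact netContent_union_le _ _

/-- When the content is below the price of the cell itself, nearly optimal coverings use neither the
cell nor an ancestor. They may be restricted to strict descendants, which split between the two
children. -/
lemma netContent_children_le (ha : a ≤ 1) (E : Set I) {l : List Bool}
    (h : netContent a (E ∩ cell l) < a ^ l.length) :
    netContent a (E ∩ cell (l ++ [false])) + netContent a (E ∩ cell (l ++ [true])) ≤
      netContent a (E ∩ cell l) := by
  refine le_of_forall_gt_imp_ge_of_dense fun c hc => ?_
  obtain ⟨U, hU, hU'⟩ := exists_cost_lt (lt_min hc h)
  have hlen : ∀ p ∈ U, l.length < p.length := fun p hp => by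
    by_contra! hle
    exact absurd ((pow_le_pow_of_le_one zero_le ha hle).trans (pow_le_cost hp))
      (hU'.trans_le (min_le_right _ _)).not_ge
  have hcov : ∀ b, E ∩ cell (l ++ [b]) ⊆ ⋃ p ∈ {p | p ∈ U ∧ l ++ [b] <+: p}, cell p := by
    intro b x hx
    have hx' := hU ⟨hx.1, (mem_cell_append.1 hx.2).1⟩
    simp only [Set.mem_iUnion, exists_prop] at hx' ⊢
    obtain ⟨p, hp, hxp⟩ := hx'
    exact ⟨p, ⟨hp, prefix_of_mem_cell hx.2 hxp (by simpa using hlen p hp)⟩, hxp⟩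
  calc _ ≤ cost a {p | p ∈ U ∧ l ++ [false] <+: p} + cost a {p | p ∈ U ∧ l ++ [true] <+: p} :=
        add_le_add (netContent_le_cost (hcov false)) (netContent_le_cost (hcov true))
    _ ≤ cost a U := by
        simp only [cost]
        rw [← ENNReal.tsum_add]
        refine ENNReal.tsum_le_tsum fun p => ?_
        by_cases h0 : p ∈ {p | p ∈ U ∧ l ++ [false] <+: p}
        · have h1 : p ∉ {p | p ∈ U ∧ l ++ [true] <+: p} := fun h1 => by
            have := (List.prefix_of_prefix_length_le h0.2 h1.2 (by simp)).eq_of_length (by simp)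
            simp at this
          rw [Set.indicator_of_notMem h1, add_zero]
          exact Set.indicator_le_indicator_of_subset (fun _ hp => hp.1) (fun _ => zero_le) p
        · rw [Set.indicator_of_notMem h0, zero_add]
          exact Set.indicator_le_indicator_of_subset (fun _ hp => hp.1) (fun _ => zero_le) p
    _ ≤ c := (hU'.trans_le (min_le_left _ _)).le

/-- The minimal elements of a set of nodes. -/
def minimalNodes (B : Set (List Bool)) : Set (List Bool) :=
  {l | l ∈ B ∧ ∀ p, p <+: l → p ≠ l → p ∉ B}

lemma exists_prefix_mem_minimalNodes {B : Set (List Bool)} {l : List Bool} (h : l ∈ B) :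
    ∃ p, p <+: l ∧ p ∈ minimalNodes B := by
  induction hn : l.length using Nat.strong_induction_on generalizing l with
  | _ n ih =>
    by_cases h' : ∀ p, p <+: l → p ≠ l → p ∉ B
    · exact ⟨l, List.prefix_rfl, h, h'⟩
    · push Not at h'
      obtain ⟨p, hp, hne, hB⟩ := h'
      have hlt : p.length < n := by
        rw [← hn]
        exact lt_of_le_of_ne hp.length_le fun he => hne (hp.eq_of_length he)
      obtain ⟨q, hq, hq'⟩ := ih _ hlt hB rfl
      exact ⟨q, hq.trans hp, hq'⟩

/-- Send the amount `M []` down the tree and stop at the first visit to `B`. Superadditivity off `B`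
means that nothing is gained before stopping; `A` is the set of nodes reached before or at the
stopping time. -/
lemma tsum_minimalNodes_le {B : Set (List Bool)} {M : List Bool → ℝ≥0∞}
    (h : ∀ l, l ∉ B → M (l ++ [false]) + M (l ++ [true]) ≤ M l) :
    ∑' l, (minimalNodes B).indicator M l ≤ M [] := by
  set A : Set (List Bool) := {l | ∀ p, p <+: l → p ≠ l → p ∉ B} with hA
  have hA' : ∀ l b, l ++ [b] ∈ A ↔ l ∈ A ∧ l ∉ B := by
    intro l b
    simp only [hA, Set.mem_ofPred_eq, List.prefix_concat_iff]
    constructor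
    · refine fun H => ⟨fun p hp hne => H p (Or.inr hp) fun he => ?_, H l (Or.inr List.prefix_rfl) (by simp)⟩
      have := hp.length_le
      rw [he] at this
      simp at this
    · rintro ⟨H1, H2⟩ p (rfl | hp) hne
      · exact absurd rfl hne
      · by_cases hpl : p = l
        · rwa [hpl]
        · exact H1 p hp hpl
  have hstep : ∀ n, ∑ l ∈ words n, (minimalNodes B).indicator M l +
      ∑ l ∈ words (n + 1), A.indicator M l ≤ ∑ l ∈ words n, A.indicator M l := by
    intro n
    rw [sum_words_succ', ← Finset.sum_add_distrib]
    refine Finset.sum_le_sum fun l _ => ?_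
    have hnot : ∀ b, (l ∈ A → l ∈ B) → l ++ [b] ∉ A := fun b H hm =>
      ((hA' l b).1 hm).2 (H ((hA' l b).1 hm).1)
    by_cases hlA : l ∈ A
    · by_cases hlB : l ∈ B
      · rw [Set.indicator_of_notMem (hnot _ fun _ => hlB), Set.indicator_of_notMem (hnot _ fun _ => hlB),
          Set.indicator_of_mem hlA, add_zero, add_zero]
        exact Set.indicator_le_self _ _ _
      · have hm : l ∉ minimalNodes B := fun hm => hlB hm.1
        rw [Set.indicator_of_notMem hm, zero_add, Set.indicator_of_mem hlA,
          Set.indicator_of_mem ((hA' _ _).2 ⟨hlA, hlB⟩), Set.indicator_of_mem ((hA' _ _).2 ⟨hlA, hlB⟩)]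
        exact h l hlB
    · have hm : l ∉ minimalNodes B := fun hm => hlA hm.2
      rw [Set.indicator_of_notMem (hnot _ fun h => absurd h hlA),
        Set.indicator_of_notMem (hnot _ fun h => absurd h hlA), Set.indicator_of_notMem hm]
      simp
  have hsum : ∀ n, ∑ i ∈ Finset.range n, ∑ l ∈ words i, (minimalNodes B).indicator M l +
      ∑ l ∈ words n, A.indicator M l ≤ M [] := by
    intro n
    induction n with
    | zero =>
      simp only [Finset.range_zero, Finset.sum_empty, zero_add, words, Finset.sum_singleton]
      exact Set.indicator_le_self _ _ _
    | succ n ih =>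
      rw [Finset.sum_range_succ, add_assoc]
      exact (add_le_add le_rfl (hstep n)).trans ih
  rw [tsum_words]
  exact ENNReal.tsum_le_of_sum_range_le fun n => le_self_add.trans (hsum n)

lemma netContent_le_tsum {U : Set (List Bool)} {S : Set I} (hU : S ⊆ ⋃ l ∈ U, cell l) :
    netContent a S ≤ ∑' l, U.indicator (fun l => netContent a (S ∩ cell l)) l := by
  have hS : S ⊆ ⋃ l, {x | x ∈ S ∩ cell l ∧ l ∈ U} := fun x hx => by
    simpa [hx, and_comm] using hU hx
  refine (netContent_mono hS).trans ((netContent_iUnion_le _).trans ?_)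
  refine ENNReal.tsum_le_tsum fun l => ?_
  by_cases hl : l ∈ U
  · rw [Set.indicator_of_mem hl]
    exact netContent_mono fun x hx => hx.1
  · simp [hl]

/-- Every covering can be improved cell by cell by the factor `η`, so the content is at most `η`
times itself; being finite, it is zero. -/
lemma netContent_eq_zero_of_forall_le (S : Set I) {η : ℝ≥0∞} (hη0 : η ≠ 0) (hη : η < 1)
    (h : ∀ x ∈ S, ∀ l, x ∈ cell l → netContent a (S ∩ cell l) ≤ η * a ^ l.length) :
    netContent a S = 0 := by
  have hle : netContent a S ≤ η * netContent a S := by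
    conv_rhs => rw [netContent]
    simp only [ENNReal.mul_iInf_of_ne hη0 hη.ne_top]
    refine le_iInf₂ fun U hU => (netContent_le_tsum hU).trans ?_
    rw [cost, ← ENNReal.tsum_mul_left]
    refine ENNReal.tsum_le_tsum fun l => ?_
    by_cases hl : l ∈ U
    · rw [Set.indicator_of_mem hl, Set.indicator_of_mem hl]
      rcases (S ∩ cell l).eq_empty_or_nonempty with he | ⟨x, hx⟩
      · simp [he]
      · exact h x hx.1 l hx.2
    · simp [hl]
  by_contra h0
  have hfin : netContent a S ≠ ∞ := ne_top_of_le_ne_top ENNReal.one_ne_top (netContent_le_one _ _)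
  have : η * netContent a S < 1 * netContent a S := ENNReal.mul_lt_mul_left h0 hfin hη
  rw [one_mul] at this
  exact absurd hle this.not_ge

/-- The increasing sets lemma for net contents. -/
theorem netContent_iUnion_of_monotone (ha0 : a ≠ 0) (ha : a ≤ 1) {E : ℕ → Set I} (hE : Monotone E) :
    netContent a (⋃ n, E n) ≤ ⨆ n, netContent a (E n) := by
  have hat : a ≠ ∞ := ne_top_of_le_ne_top ENNReal.one_ne_top ha
  set M : List Bool → ℝ≥0∞ := fun l => ⨆ n, netContent a (E n ∩ cell l) with hM
  have hmono : ∀ l, Monotone fun n => netContent a (E n ∩ cell l) := fun l n m h =>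
    netContent_mono (Set.inter_subset_inter_left _ (hE h))
  have key : ∀ η : ℝ≥0∞, η ≠ 0 → η < 1 → η * netContent a (⋃ n, E n) ≤ M [] := by
    intro η hη0 hη
    -- Stop at cells whose price is less than `M l / η`. Off `B` the contents are below the price,
    -- so superadditivity over the children holds for each `E n` and passes to the supremum.
    set B : Set (List Bool) := {l | η * a ^ l.length < M l} with hB
    have hadd : ∀ l, l ∉ B → M (l ++ [false]) + M (l ++ [true]) ≤ M l := by
      intro l hl
      have hl' : M l ≤ η * a ^ l.length := not_lt.1 hl
      rw [hM, ENNReal.iSup_add_iSup_of_monotone (hmono _) (hmono _)]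
      refine iSup_mono fun n => netContent_children_le ha _ ?_
      have h1 : netContent a (E n ∩ cell l) ≤ η * a ^ l.length :=
        (le_iSup (fun n => netContent a (E n ∩ cell l)) n).trans hl'
      refine h1.trans_lt ?_
      calc η * a ^ l.length < 1 * a ^ l.length :=
            ENNReal.mul_lt_mul_left (pow_ne_zero _ ha0) (ENNReal.pow_ne_top hat) hη
        _ = _ := one_mul _
    -- The points never stopped; every cell containing one is priced too high by the factor `1 / η`,
    -- so they carry no content.
    set R : Set I := {x | ∀ l, x ∈ cell l → l ∉ B} with hR
    have hR0 : ∀ n, netContent a (E n ∩ R) = 0 := by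
      intro n
      refine netContent_eq_zero_of_forall_le _ hη0 hη fun x hx l hl => ?_
      refine le_trans ?_ (not_lt.1 (hx.2 l hl))
      refine (netContent_mono ?_).trans (le_iSup (fun n => netContent a (E n ∩ cell l)) n)
      exact Set.inter_subset_inter_left _ Set.inter_subset_left
    have hcov : (⋃ n, E n) ⊆ (⋃ l ∈ minimalNodes B, cell l) ∪ ⋃ n, E n ∩ R := by
      intro x hx
      by_cases hxR : x ∈ R
      · right
        rw [← Set.iUnion_inter]
        exact ⟨hx, hxR⟩
      · left
        simp only [hR, Set.mem_ofPred_eq, not_forall, not_not] at hxR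
        obtain ⟨l, hl, hlB⟩ := hxR
        obtain ⟨p, hp, hpB⟩ := exists_prefix_mem_minimalNodes hlB
        simp only [Set.mem_iUnion, exists_prop]
        exact ⟨p, hpB, mem_cell_of_prefix hl hp⟩
    have h1 : netContent a (⋃ n, E n) ≤ cost a (minimalNodes B) := by
      refine (netContent_mono hcov).trans ((netContent_union_le _ _).trans ?_)
      have : netContent a (⋃ n, E n ∩ R) = 0 :=
        le_antisymm ((netContent_iUnion_le _).trans (by simp [hR0])) zero_le
      rw [this, add_zero]
      exact netContent_le_cost le_rfl
    calc η * netContent a (⋃ n, E n) ≤ η * cost a (minimalNodes B) := mul_le_mul_right h1 _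
      _ = ∑' l, η * (minimalNodes B).indicator (fun l => a ^ l.length) l := by
          rw [cost, ENNReal.tsum_mul_left]
      _ ≤ ∑' l, (minimalNodes B).indicator M l := by
          refine ENNReal.tsum_le_tsum fun l => ?_
          by_cases hl : l ∈ minimalNodes B
          · rw [Set.indicator_of_mem hl, Set.indicator_of_mem hl]
            exact le_of_lt hl.1
          · simp [hl]
      _ ≤ M [] := tsum_minimalNodes_le hadd
  have hM0 : M [] = ⨆ n, netContent a (E n) := by simp [hM]
  rw [← hM0]
  refine ENNReal.le_of_forall_lt_one_mul_le fun η hη => ?_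
  rcases eq_or_ne η 0 with rfl | h0
  · simp
  · exact key η h0 hη

end Cascade

/-! ### Net content and Hausdorff dimension; Frostman's lemma -/

namespace Cascade

variable {a : ℝ≥0∞} {E K : Set I}

lemma rpow_pow_comm (x : ℝ≥0∞) (t : ℝ) (n : ℕ) : (x ^ n) ^ t = (x ^ t) ^ n := by
  rw [← ENNReal.rpow_natCast, ← ENNReal.rpow_natCast, ← ENNReal.rpow_mul, ← ENNReal.rpow_mul,
    mul_comm]

lemma ediam_cell_le (l : List Bool) : Metric.ediam (cell l) ≤ 2⁻¹ ^ l.length := by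
  refine Metric.ediam_le fun x hx y hy => ?_
  rw [Subtype.edist_eq, edist_dist, Real.dist_eq]
  refine (ENNReal.ofReal_le_ofReal (abs_sub_le_of_mem_cell hx hy)).trans (le_of_eq ?_)
  rw [ENNReal.ofReal_pow (by norm_num), ENNReal.ofReal_inv_of_pos two_pos]
  simp

/-- A set with coverings by cells of arbitrarily small cost has an image of measure zero. -/
lemma hausdorffMeasure_image_eq_zero {Y : Type*} [EMetricSpace Y] [MeasurableSpace Y] [BorelSpace Y]
    {F : I → Y} {m : List Bool → ℝ≥0∞} (hm : ∀ l, Metric.ediam (F '' cell l) ≤ m l) {s : ℝ}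
    (hs : 0 < s) (U : ℕ → Set (List Bool)) (hU : ∀ n, K ⊆ ⋃ l ∈ U n, cell l)
    (hsum : Tendsto (fun n => ∑' l, (U n).indicator (fun l => m l ^ s) l) atTop (𝓝 0)) :
    μH[s] (F '' K) = 0 := by
  set c : ℕ → ℝ≥0∞ := fun n => ∑' l, (U n).indicator (fun l => m l ^ s) l with hc
  -- A single term of the sum is at most `c n`, so the diameters in the `n`-th covering are at most
  -- `c n ^ (1 / s)` and tend to zero on their own.
  have hr : Tendsto (fun n => c n ^ s⁻¹) atTop (𝓝 0) := by
    have := (ENNReal.continuous_rpow_const (y := s⁻¹)).continuousAt.tendsto.comp hsum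
    rwa [ENNReal.zero_rpow_of_pos (inv_pos.2 hs)] at this
  have hle : ∀ n, ∑' l : U n, Metric.ediam (F '' cell l) ^ s ≤ c n := by
    intro n
    simp only [hc]
    rw [← tsum_subtype]
    exact ENNReal.tsum_le_tsum fun l => ENNReal.rpow_le_rpow (hm _) hs.le
  have h := Measure.hausdorffMeasure_le_liminf_tsum s (F '' K) (l := atTop) _ hr
    (fun n (l : U n) => F '' cell l) (Eventually.of_forall fun n l => ?_)
    (Eventually.of_forall fun n => ?_)
  · refine le_antisymm (h.trans ?_) zero_le
    rw [← hsum.liminf_eq]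
    exact liminf_le_liminf (Eventually.of_forall hle)
  · rw [ENNReal.le_rpow_inv_iff hs]
    refine le_trans ?_ (hle n)
    exact ENNReal.le_tsum l
  · rw [← Set.image_iUnion]
    refine Set.image_mono ((hU n).trans ?_)
    simp

lemma exists_cost_le_of_netContent_eq_zero (h : netContent a E = 0) (n : ℕ) :
    ∃ U : Set (List Bool), E ⊆ (⋃ l ∈ U, cell l) ∧ cost a U ≤ 2⁻¹ ^ n := by
  obtain ⟨U, hU, hU'⟩ := exists_cost_lt (c := 2⁻¹ ^ n) (h.trans_lt (ENNReal.pow_pos (by simp) n))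
  exact ⟨U, hU, hU'.le⟩

lemma tendsto_half_pow : Tendsto (fun n : ℕ => (2⁻¹ : ℝ≥0∞) ^ n) atTop (𝓝 0) :=
  ENNReal.tendsto_pow_atTop_nhds_zero_of_lt_one (by simp)

lemma netContent_ne_zero_of_lt_dimH {t : ℝ≥0} (ht : 0 < t) (h : t < dimH K) :
    netContent (2⁻¹ ^ (t : ℝ)) K ≠ 0 := by
  intro h0
  choose U hU hU' using fun n => exists_cost_le_of_netContent_eq_zero h0 n
  have h1 := hausdorffMeasure_image_eq_zero (F := (id : I → I)) (K := K)
    (m := fun l => 2⁻¹ ^ l.length) (by simpa using ediam_cell_le) (NNReal.coe_pos.2 ht) U hU ?_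
  · rw [Set.image_id, hausdorffMeasure_of_lt_dimH h] at h1
    exact ENNReal.top_ne_zero h1
  · refine tendsto_of_tendsto_of_tendsto_of_le_of_le tendsto_const_nhds tendsto_half_pow
      (fun _ => zero_le) fun n => ?_
    refine le_trans (le_of_eq ?_) (hU' n)
    simp only [cost, rpow_pow_comm]

/-- A set of diameter in `(2 ^ (-(n+1)), 2 ^ (-n)]` meets at most two adjacent cells of level `n`;
the factor `(2⁻¹ ^ t)⁻¹` pays for the rounding of the diameter. A single point lies in cells of
arbitrarily small price. -/
lemma netContent_le_ediam_rpow {t : ℝ} (ht : 0 < t) {V : Set I} (hV : V.Nonempty) :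
    netContent (2⁻¹ ^ t) V ≤ 2 * (2⁻¹ ^ t)⁻¹ * Metric.ediam V ^ t := by
  set a : ℝ≥0∞ := 2⁻¹ ^ t with ha
  have ha0 : a ≠ 0 := (ENNReal.rpow_pos (by simp) (by simp)).ne'
  have ha1 : a < 1 := ENNReal.rpow_lt_one (by simp) ht
  have hcell : ∀ n k, netContent a (V ∩ cell (word n k)) ≤ a ^ n := fun n k => by
    simpa using netContent_cell_le a V (word n k)
  rcases eq_or_ne (Metric.ediam V) 0 with hd | hd
  · have hsub : V.Subsingleton := Metric.ediam_eq_zero_iff.1 hd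
    obtain ⟨x, rfl⟩ := Set.exists_eq_singleton_iff_nonempty_subsingleton.2 ⟨hV, hsub⟩
    refine le_trans (ge_of_tendsto' (ENNReal.tendsto_pow_atTop_nhds_zero_of_lt_one ha1)
      fun n => ?_) zero_le
    refine (netContent_mono ?_).trans (hcell n (pt n x))
    exact Set.singleton_subset_iff.2 ⟨rfl, mem_cell_code n x⟩
  · have hd1 : Metric.ediam V ≤ 1 := by
      refine (Metric.ediam_mono (Set.subset_univ V)).trans ?_
      simpa using ediam_cell_le []
    have hdt : Metric.ediam V ≠ ∞ := ne_top_of_le_ne_top ENNReal.one_ne_top hd1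
    obtain ⟨n, hn1, hn2⟩ := exists_nat_pow_near_of_lt_one (ENNReal.toReal_pos hd hdt)
      (ENNReal.toReal_le_of_le_ofReal zero_le_one (by simpa using hd1))
      (by norm_num : (0 : ℝ) < 2⁻¹) (by norm_num)
    have hne : (pt n '' V).Nonempty := hV.image _
    obtain ⟨x, hx, hxk⟩ := Nat.sInf_mem hne
    have hcov : V ⊆ V ∩ cell (word n (pt n x)) ∪ V ∩ cell (word n (pt n x + 1)) := by
      intro y hy
      have h1 : pt n x ≤ pt n y := hxk ▸ Nat.sInf_le ⟨y, hy, rfl⟩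
      have h2 : pt n y ≤ pt n x + 1 := by
        rw [pt_le_iff]
        have h3 : |(y : ℝ) - x| ≤ 2⁻¹ ^ n := by
          refine le_trans ?_ hn2
          have := ENNReal.toReal_mono hdt (Metric.edist_le_ediam_of_mem hy hx)
          rwa [edist_dist, ENNReal.toReal_ofReal dist_nonneg] at this
        have h4 := le_pt_add_one n x
        have h5 : ((y : ℝ) - x) * 2 ^ n ≤ 1 := by
          calc ((y : ℝ) - x) * 2 ^ n ≤ 2⁻¹ ^ n * 2 ^ n := by
                gcongr
                exact (le_abs_self _).trans h3
            _ = 1 := by rw [← mul_pow]; norm_num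
        push_cast
        linarith
      rcases (by omega : pt n y = pt n x ∨ pt n y = pt n x + 1) with h | h
      · exact Or.inl ⟨hy, h ▸ mem_cell_code n y⟩
      · exact Or.inr ⟨hy, h ▸ mem_cell_code n y⟩
    have hpow : a ^ (n + 1) ≤ Metric.ediam V ^ t := by
      rw [ha, ← rpow_pow_comm]
      refine ENNReal.rpow_le_rpow ?_ ht.le
      rw [← ENNReal.ofReal_toReal hdt]
      refine le_trans (le_of_eq ?_) (ENNReal.ofReal_le_ofReal hn1.le)
      rw [ENNReal.ofReal_pow (by norm_num), ENNReal.ofReal_inv_of_pos two_pos]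
      simp
    calc netContent a V ≤ a ^ n + a ^ n := by
          refine (netContent_mono hcov).trans ((netContent_union_le _ _).trans ?_)
          exact add_le_add (hcell _ _) (hcell _ _)
      _ = 2 * a⁻¹ * a ^ (n + 1) := by
          rw [pow_succ, ← two_mul, mul_assoc, mul_comm (a ^ n), ← mul_assoc a⁻¹,
            ENNReal.inv_mul_cancel ha0 ha1.ne_top, one_mul]
      _ ≤ _ := mul_le_mul_right hpow _

lemma netContent_eq_zero_of_dimH_lt {t : ℝ≥0} (ht : 0 < t) (h : dimH K < t) :
    netContent (2⁻¹ ^ (t : ℝ)) K = 0 := by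
  have h0 := hausdorffMeasure_of_dimH_lt h
  set C : ℝ≥0∞ := 2 * (2⁻¹ ^ (t : ℝ))⁻¹ with hC
  have ha0 : (2⁻¹ : ℝ≥0∞) ^ (t : ℝ) ≠ 0 := (ENNReal.rpow_pos (by simp) (by simp)).ne'
  have hC' : C ≠ ∞ := ENNReal.mul_ne_top (by simp) (ENNReal.inv_ne_top.2 ha0)
  have hC0 : C ≠ 0 := mul_ne_zero two_ne_zero (ENNReal.inv_ne_zero.2
    (ENNReal.rpow_lt_one (by simp) (NNReal.coe_pos.2 ht)).ne_top)
  rw [Measure.hausdorffMeasure_apply] at h0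
  -- The supremum over scales vanishes, so the infimum at scale `1` already does; no restriction on
  -- diameters is needed afterwards.
  have h1 := le_antisymm ((le_iSup₂ (f := fun (r : ℝ≥0∞) (_ : 0 < r) =>
    ⨅ (T : ℕ → Set I) (_ : K ⊆ ⋃ n, T n) (_ : ∀ n, Metric.ediam (T n) ≤ r),
      ∑' n, ⨆ _ : (T n).Nonempty, Metric.ediam (T n) ^ (t : ℝ)) 1 one_pos).trans h0.le) zero_le
  by_contra hne
  have hlt : (0 : ℝ≥0∞) < netContent (2⁻¹ ^ (t : ℝ)) K / C :=
    ENNReal.div_pos hne hC'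
  rw [← h1] at hlt
  simp only [iInf_lt_iff] at hlt
  obtain ⟨T, hT, -, hlt⟩ := hlt
  rw [ENNReal.lt_div_iff_mul_lt (Or.inl hC0) (Or.inl hC')] at hlt
  refine absurd hlt (not_lt.2 ?_)
  rw [← ENNReal.tsum_mul_right]
  refine (netContent_mono hT).trans ((netContent_iUnion_le T).trans
    (ENNReal.tsum_le_tsum fun n => ?_))
  rcases (T n).eq_empty_or_nonempty with he | hn
  · simp [he]
  · rw [iSup_pos hn, mul_comm]
    exact netContent_le_ediam_rpow (NNReal.coe_pos.2 ht) hn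

/-- The flow of strength `v` which fills the left edges first, with capacities `M`. -/
def greedyFlow : (List Bool → ℝ≥0∞) → ℝ≥0∞ → List Bool → ℝ≥0∞
  | _, v, [] => v
  | M, v, false :: l => greedyFlow (sub false M) (min v (M [false])) l
  | M, v, true :: l => greedyFlow (sub true M) (v - min v (M [false])) l

lemma isFlow_greedyFlow (M : List Bool → ℝ≥0∞) (v : ℝ≥0∞) : IsFlow (greedyFlow M v) := by
  intro l
  induction l generalizing M v with
  | nil => exact (add_tsub_cancel_of_le (min_le_left _ _)).symm
  | cons b l ih => cases b <;> exact ih _ _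

/-- What does not fit into the left child fits into the right one, because capacities are
subadditive and the inflow respects the capacity of the parent. -/
lemma greedyFlow_le {M : List Bool → ℝ≥0∞} (hM : ∀ l, M l ≤ M (l ++ [false]) + M (l ++ [true]))
    {v : ℝ≥0∞} (hv : v ≤ M []) (l : List Bool) : greedyFlow M v l ≤ M l := by
  induction l generalizing M v with
  | nil => exact hv
  | cons b l ih =>
    have h0 : v ≤ M [false] + M [true] := hv.trans (hM [])
    cases b
    · exact ih (M := sub false M) (fun l => hM (false :: l)) (min_le_right _ _)
    · refine ih (M := sub true M) (fun l => hM (true :: l)) ?_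
      rw [tsub_le_iff_right]
      rcases le_total v (M [false]) with h | h
      · rw [min_eq_left h]; exact le_add_self
      · rw [min_eq_right h, add_comm]; exact h0

/-- Frostman's lemma for flows on the dyadic tree. -/
theorem exists_isFlow_of_netContent_ne_zero (ha0 : a ≠ 0) (ha : a ≤ 1) (hK : AnalyticSet K)
    (h : netContent a K ≠ 0) : ∃ (C : Set I) (ν : List Bool → ℝ≥0∞), IsCompact C ∧ C ⊆ K ∧
      IsFlow ν ∧ ν [] ≠ 0 ∧ (∀ l, ν l ≤ a ^ l.length) ∧
        ∀ l, ν l ≠ 0 → (closure (cell l) ∩ C).Nonempty := by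
  rw [AnalyticSet] at hK
  rcases hK with rfl | ⟨f, hf, rfl⟩
  · simp at h
  obtain ⟨c, hc0, hc⟩ := exists_between (pos_iff_ne_zero.2 h)
  -- An analytic set is a continuous image of Baire space. Coordinates are bounded one after the
  -- other; the increasing sets lemma provides each bound without the content of the image falling
  -- to `c`.
  set S : List ℕ → Set (ℕ → ℕ) := fun L => {z | ∀ i (hi : i < L.length), z i ≤ L[i]} with hS
  have hext : ∀ L : {L : List ℕ // c < netContent a (f '' S L)},
      ∃ n, c < netContent a (f '' S (L.1 ++ [n])) := by
    rintro ⟨L, hL⟩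
    have hun : f '' S L = ⋃ n, f '' S (L ++ [n]) := by
      rw [← Set.image_iUnion]
      congr 1
      ext z
      simp only [hS, Set.mem_iUnion, Set.mem_ofPred_eq, List.length_append, List.length_singleton]
      constructor
      · refine fun H => ⟨z L.length, fun i hi => ?_⟩
        rcases Nat.lt_succ_iff_lt_or_eq.1 hi with h | rfl
        · rw [List.getElem_append_left h]; exact H i h
        · simp
      · rintro ⟨n, H⟩ i hi
        have := H i (by omega)
        rwa [List.getElem_append_left hi] at this
    have hmono : Monotone fun n => f '' S (L ++ [n]) := by
      intro n m hnm
      refine Set.image_mono fun z hz i hi => (hz i (by simpa using hi)).trans ?_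
      simp only [List.getElem_append]
      split_ifs <;> simp [hnm]
    have := netContent_iUnion_of_monotone ha0 ha hmono
    rw [← hun] at this
    exact lt_iSup_iff.1 (hL.trans_le this)
  choose g hg using hext
  have h0 : c < netContent a (f '' S []) := by
    have : S [] = Set.univ := by ext; simp [hS]
    rwa [this, Set.image_univ]
  let L : ℕ → {L : List ℕ // c < netContent a (f '' S L)} := fun k =>
    Nat.rec ⟨[], h0⟩ (fun _ L => ⟨L.1 ++ [g L], hg L⟩) k
  have hlen : ∀ k, (L k).1.length = k := fun k => by
    induction k with
    | zero => rfl
    | succ k ih => simp only [L, List.length_append, List.length_singleton] at ih ⊢; rw [ih]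
  have hLsucc : ∀ k, (L (k + 1)).1 = (L k).1 ++ [g (L k)] := fun k => rfl
  set n : ℕ → ℕ := fun i => g (L i) with hn
  have hLn : ∀ k i (hi : i < (L k).1.length), (L k).1[i] = n i := by
    intro k
    induction k with
    | zero => intro i hi; simp [hlen] at hi
    | succ k ih =>
      intro i hi
      simp only [hLsucc]
      rw [List.getElem_append]
      split_ifs with h
      · exact ih i h
      · have : i = k := by
          have h1 := hlen k
          have h2 := hlen (k + 1)
          omega
        subst this
        simp [hn, hlen]
  have hSL : ∀ k z, z ∈ S (L k).1 ↔ ∀ i < k, z i ≤ n i := by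
    intro k z
    simp only [hS, Set.mem_ofPred_eq, hLn]
    rw [hlen]
  -- All bounds together give a compact box. The content of `f '' Z` is not estimated: greedy flows
  -- of strength `c` exist for the sets with `k` bounded coordinates, and `ν` is their limit along
  -- an ultrafilter, which preserves the flow equations and the bounds.
  set Z : Set (ℕ → ℕ) := Set.univ.pi fun i => Set.Iic (n i) with hZ
  have hZc : IsCompact Z := isCompact_univ_pi fun i => (Set.finite_Iic _).isCompact
  let M : ℕ → List Bool → ℝ≥0∞ := fun k l => netContent a (f '' S (L k).1 ∩ cell l)
  have hMv : ∀ k, c ≤ M k [] := fun k => by simpa [M] using (L k).2.le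
  have hle := fun k => greedyFlow_le (M := M k) (fun l => netContent_le_of_children a _ l) (hMv k)
  let U : Ultrafilter ℕ := hyperfilter ℕ
  obtain ⟨ν, -, hν⟩ := isCompact_univ.ultrafilter_le_nhds (U.map fun k => greedyFlow (M k) c)
    (by simp)
  have hν' : ∀ l, Tendsto (fun k => greedyFlow (M k) c l) U (𝓝 (ν l)) := fun l =>
    (tendsto_pi_nhds.1 (show Tendsto (fun k => greedyFlow (M k) c) U (𝓝 ν) from hν)) l
  refine ⟨f '' Z, ν, hZc.image hf, Set.image_subset_range _ _, fun l => ?_, ?_, fun l => ?_, fun l hl => ?_⟩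
  · refine tendsto_nhds_unique (hν' l) ?_
    simp_rw [isFlow_greedyFlow (M _) c l]
    exact (hν' _).add (hν' _)
  · have : ν [] = c := tendsto_nhds_unique (hν' []) tendsto_const_nhds
    rw [this]; exact hc0.ne'
  · exact le_of_tendsto' (hν' l) fun k => (hle k l).trans (netContent_cell_le _ _ _)
  · have hev : ∀ᶠ k in (U : Filter ℕ), ∃ z, (∀ i < k, z i ≤ n i) ∧ f z ∈ cell l := by
      filter_upwards [(hν' l).eventually (isOpen_ne.mem_nhds hl)] with k hk
      by_contra! hcon
      refine hk (le_antisymm ((hle k l).trans (le_of_eq ?_)) zero_le)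
      have : f '' S (L k).1 ∩ cell l = ∅ := by
        ext x
        simp only [Set.mem_inter_iff, Set.mem_image, Set.mem_empty_iff_false, iff_false, not_and]
        rintro ⟨z, hz, rfl⟩
        exact hcon z ((hSL k z).1 hz)
      simp only [M, this, netContent_empty]
    obtain ⟨z, hz⟩ : ∃ z : ℕ → ℕ → ℕ, ∀ᶠ k in (U : Filter ℕ),
        (∀ i < k, z k i ≤ n i) ∧ f (z k) ∈ cell l := by
      classical
      refine ⟨fun k => if h : ∃ z, (∀ i < k, z i ≤ n i) ∧ f z ∈ cell l then h.choose else 0, ?_⟩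
      filter_upwards [hev] with k hk
      rw [dif_pos hk]
      exact hk.choose_spec
    -- Only the first `k` coordinates of `z k` obey the bounds. Truncation moves the points into
    -- `Z`, and each coordinate is eventually unchanged, so `z` has the same limit.
    obtain ⟨y, hyZ, hy⟩ := hZc.ultrafilter_le_nhds (U.map fun k i => min (z k i) (n i)) (by
      rw [le_principal_iff]
      exact Filter.mem_map.2 (Filter.univ_mem' fun k i _ => min_le_right (z k i) (n i)))
    have hy' : Tendsto z U (𝓝 y) := by
      refine tendsto_pi_nhds.2 fun i => ?_
      have h1 := (tendsto_pi_nhds.1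
        (show Tendsto (fun k i => min (z k i) (n i)) U (𝓝 y) from hy)) i
      refine h1.congr' ?_
      have h2 : ∀ᶠ k in (U : Filter ℕ), i < k :=
        (Nat.hyperfilter_le_atTop : (U : Filter ℕ) ≤ atTop) (eventually_gt_atTop i)
      filter_upwards [hz, h2] with k hk hik
      exact min_eq_left (hk.1 i hik)
    refine ⟨f y, ?_, Set.mem_image_of_mem f hyZ⟩
    exact mem_closure_of_tendsto ((hf.tendsto y).comp hy') (hz.mono fun k hk => hk.2)

end Cascade

/-! ### The energy method -/

namespace Cascade

/-- The nodes of the level below `p` which are at most three steps away from the child `p ++ [b]`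
and are not children of `p`. -/
def nearby (p : List Bool) (b : Bool) : Finset (List Bool) :=
  ((Finset.Icc (num (p ++ [b]) - 3) (num (p ++ [b]) + 3)).image (word (p.length + 1))).filter
    fun q => q ≠ p ++ [b] ∧ q ≠ p ++ [!b]

lemma card_nearby_le (p : List Bool) (b : Bool) : (nearby p b).card ≤ 7 := by
  refine (Finset.card_filter_le _ _).trans (Finset.card_image_le.trans ?_)
  rw [Nat.card_Icc]
  omega

lemma nearby_spec {p q : List Bool} {b : Bool} (h : q ∈ nearby p b) :
    q.length = p.length + 1 ∧ q ≠ p ++ [b] ∧ q ≠ p ++ [!b] := by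
  rw [nearby, Finset.mem_filter, Finset.mem_image] at h
  obtain ⟨⟨k, -, rfl⟩, h⟩ := h
  exact ⟨length_word _ _, h⟩

lemma mem_nearby {p q : List Bool} {b : Bool} (hl : q.length = p.length + 1)
    (h1 : num q ≤ num (p ++ [b]) + 3) (h2 : num (p ++ [b]) ≤ num q + 3)
    (h3 : num q / 2 ≠ num p) : q ∈ nearby p b := by
  have hne : ∀ c, q ≠ p ++ [c] := by
    rintro c rfl
    apply h3
    rw [num_append]
    have := Bool.toNat_le c
    omega
  refine Finset.mem_filter.2 ⟨Finset.mem_image.2 ⟨num q, Finset.mem_Icc.2 ⟨by omega, h1⟩, ?_⟩,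
    hne _, hne _⟩
  rw [← hl, word_num]

/-- Two points are separated by a sibling of a cell which contains one of them and is near the
other one. -/
lemma exists_separating_cell {x y : I} (h : x < y) : ∃ p b, ∃ q ∈ nearby p b,
    cell (p ++ [!b]) ⊆ Set.Ioo x y ∧
      ((x ∈ cell (p ++ [b]) ∧ y ∈ cell q) ∨ (x ∈ cell q ∧ y ∈ cell (p ++ [b]))) := by
  classical
  have hex := exists_pt_gap h
  -- At the first level with a cell between `x` and `y`, the indices of the preceding level differ
  -- by at most one, so the present ones differ by at most `3`; this is the range in `nearby`.
  obtain ⟨n, hn, hmin⟩ : ∃ n, pt n x + 1 < pt n y ∧ ∀ k < n, ¬ pt k x + 1 < pt k y :=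
    ⟨Nat.find hex, Nat.find_spec hex, fun k hk => Nat.find_min hex hk⟩
  obtain ⟨k, rfl⟩ : ∃ k, n = k + 1 := by
    rcases n with _ | k
    · have := pt_lt 0 y
      simp at this
      omega
    · exact ⟨k, rfl⟩
  have hk := hmin k (Nat.lt_succ_self k)
  have hx2 := pt_succ_div_two k x
  have hy2 := pt_succ_div_two k y
  have hylt := pt_lt (k + 1) y
  obtain ⟨bx, hbx⟩ := code_succ k x
  obtain ⟨b', hb'⟩ := code_succ k y
  have nx := num_code (k + 1) x
  have ny := num_code (k + 1) y
  have nx' := num_code k x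
  have ny' := num_code k y
  have cx := mem_cell_code (k + 1) x
  have cy := mem_cell_code (k + 1) y
  have hword : ∀ {l : List Bool} {b : Bool}, l.length = k →
      l ++ [b] = word (k + 1) (2 * num l + b.toNat) := fun {l b} hl => by
    rw [← hl]
    simpa using (word_num (l ++ [b])).symm
  rw [hbx, num_append] at nx
  rw [hb', num_append] at ny
  -- If `x` lies in a left child, the sibling on its right separates the points. If it lies in a
  -- right child, the index bounds force `y` into the right child of the adjacent parent, and the
  -- sibling on the left of `y` separates them.
  cases bx
  · refine ⟨code k x, false, code (k + 1) y, mem_nearby (by simp) ?_ ?_ ?_, ?_, Or.inl ⟨?_, cy⟩⟩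
    · rw [num_code, num_append]
      simp only [Bool.toNat_false] at nx ⊢
      omega
    · rw [num_code, num_append]
      simp only [Bool.toNat_false] at nx ⊢
      omega
    · rw [num_code, num_code]
      simp only [Bool.toNat_false] at nx
      omega
    · rw [hword (length_code k x)]
      simp only [Bool.not_false, Bool.toNat_true, Bool.toNat_false] at nx ⊢
      exact cell_subset_Ioo (by omega) (by omega) (by omega)
    · rwa [hbx] at cx
  · cases b'
    · simp only [Bool.toNat_true, Bool.toNat_false] at nx ny
      omega
    · simp only [Bool.toNat_true] at nx ny
      refine ⟨code k y, true, code (k + 1) x, mem_nearby (by simp) ?_ ?_ ?_, ?_, Or.inr ⟨cx, ?_⟩⟩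
      · rw [num_code, num_append]
        simp only [Bool.toNat_true]
        omega
      · rw [num_code, num_append]
        simp only [Bool.toNat_true]
        omega
      · rw [num_code, num_code]
        omega
      · rw [hword (length_code k y)]
        simp only [Bool.not_true, Bool.toNat_false]
        exact cell_subset_Ioo (by omega) (by omega) (by omega)
      · rwa [hb'] at cy

/-- The kernel which bounds the Riesz kernel of the distance of a cascade. -/
def energyKernel (m : List Bool → ℝ≥0∞) (s : ℝ) (x y : I) : ℝ≥0∞ :=
  ∑' p, ∑ b, ∑ q ∈ nearby p b, m (p ++ [!b]) ^ (-s) *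
    ((cell (p ++ [b])).indicator 1 x * (cell q).indicator 1 y +
      (cell q).indicator 1 x * (cell (p ++ [b])).indicator 1 y)

lemma rpow_neg_le_energyKernel {m : List Bool → ℝ≥0∞} {s : ℝ} {x y : I} {p q : List Bool} {b : Bool}
    (hq : q ∈ nearby p b)
    (h : (x ∈ cell (p ++ [b]) ∧ y ∈ cell q) ∨ (x ∈ cell q ∧ y ∈ cell (p ++ [b]))) :
    m (p ++ [!b]) ^ (-s) ≤ energyKernel m s x y := by
  refine le_trans ?_ (ENNReal.le_tsum p)
  refine le_trans ?_ (Finset.single_le_sum (fun _ _ => zero_le) (Finset.mem_univ b))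
  refine le_trans ?_ (Finset.single_le_sum (fun _ _ => zero_le) hq)
  conv_lhs => rw [← mul_one (m (p ++ [!b]) ^ (-s))]
  refine mul_le_mul_right ?_ _
  rcases h with ⟨h1, h2⟩ | ⟨h1, h2⟩ <;> simp [h1, h2]

lemma energyKernel_comm (m : List Bool → ℝ≥0∞) (s : ℝ) (x y : I) :
    energyKernel m s x y = energyKernel m s y x := by
  refine tsum_congr fun p => Finset.sum_congr rfl fun b _ => Finset.sum_congr rfl fun q _ => ?_
  ring

/-- The potential of a flow for the kernel `energyKernel`. -/
def energyPotential (θ m : List Bool → ℝ≥0∞) (s : ℝ) (x : I) : ℝ≥0∞ :=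
  ∑' p, ∑ b, ∑ q ∈ nearby p b, m (p ++ [!b]) ^ (-s) *
    ((cell (p ++ [b])).indicator 1 x * θ q + (cell q).indicator 1 x * θ (p ++ [b]))

lemma measurable_cell_indicator (l : List Bool) :
    Measurable ((cell l).indicator (1 : I → ℝ≥0∞)) :=
  measurable_one.indicator (measurableSet_cell l)

lemma measurable_energyPotential (θ m : List Bool → ℝ≥0∞) (s : ℝ) :
    Measurable (energyPotential θ m s) := by
  refine Measurable.tsum fun p => Finset.measurable_sum _ fun b _ =>
    Finset.measurable_sum _ fun q _ => ?_
  have h1 := measurable_cell_indicator (p ++ [b])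
  have h2 := measurable_cell_indicator q
  fun_prop

lemma lintegral_energyKernel {τ : Measure I} {θ : List Bool → ℝ≥0∞} (hτ : ∀ l, τ (cell l) = θ l)
    (m : List Bool → ℝ≥0∞) (s : ℝ) (x : I) :
    ∫⁻ y, energyKernel m s x y ∂τ = energyPotential θ m s x := by
  have hi := measurable_cell_indicator
  have hint : ∀ l, ∫⁻ y, (cell l).indicator 1 y ∂τ = θ l := fun l => by
    rw [lintegral_indicator_one (measurableSet_cell l), hτ]
  have hm : ∀ p b q, Measurable fun y => m (p ++ [!b]) ^ (-s) *
      ((cell (p ++ [b])).indicator 1 x * (cell q).indicator 1 y +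
        (cell q).indicator 1 x * (cell (p ++ [b])).indicator 1 y) := fun p b q => by
    have h1 := hi (p ++ [b])
    have h2 := hi q
    fun_prop
  simp only [energyKernel, energyPotential]
  rw [lintegral_tsum fun p => (Finset.measurable_sum _ fun b _ =>
    Finset.measurable_sum _ fun q _ => hm p b q).aemeasurable]
  refine tsum_congr fun p => ?_
  rw [lintegral_finsetSum _ fun b _ => Finset.measurable_sum _ fun q _ => hm p b q]
  refine Finset.sum_congr rfl fun b _ => ?_
  rw [lintegral_finsetSum _ fun q _ => hm p b q]
  refine Finset.sum_congr rfl fun q _ => ?_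
  have h1 := hi (p ++ [b])
  have h2 := hi q
  rw [lintegral_const_mul _ (by fun_prop), lintegral_add_left (by fun_prop),
    lintegral_const_mul _ h2, lintegral_const_mul _ h1, hint, hint]

lemma lintegral_energyPotential {τ : Measure I} {θ : List Bool → ℝ≥0∞}
    (hτ : ∀ l, τ (cell l) = θ l) (m : List Bool → ℝ≥0∞) (s : ℝ) :
    ∫⁻ x, energyPotential θ m s x ∂τ =
      2 * ∑' p, ∑ b, ∑ q ∈ nearby p b, θ (p ++ [b]) * θ q * m (p ++ [!b]) ^ (-s) := by
  have hi := measurable_cell_indicator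
  have hint : ∀ l, ∫⁻ y, (cell l).indicator 1 y ∂τ = θ l := fun l => by
    rw [lintegral_indicator_one (measurableSet_cell l), hτ]
  have hm : ∀ p b q, Measurable fun x => m (p ++ [!b]) ^ (-s) *
      ((cell (p ++ [b])).indicator 1 x * θ q + (cell q).indicator 1 x * θ (p ++ [b])) :=
    fun p b q => by
      have h1 := hi (p ++ [b])
      have h2 := hi q
      fun_prop
  simp only [energyPotential]
  rw [lintegral_tsum fun p => (Finset.measurable_sum _ fun b _ =>
    Finset.measurable_sum _ fun q _ => hm p b q).aemeasurable, ← ENNReal.tsum_mul_left]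
  refine tsum_congr fun p => ?_
  rw [lintegral_finsetSum _ fun b _ => Finset.measurable_sum _ fun q _ => hm p b q,
    Finset.mul_sum]
  refine Finset.sum_congr rfl fun b _ => ?_
  rw [lintegral_finsetSum _ fun q _ => hm p b q, Finset.mul_sum]
  refine Finset.sum_congr rfl fun q _ => ?_
  have h1 := hi (p ++ [b])
  have h2 := hi q
  rw [lintegral_const_mul _ (by fun_prop), lintegral_add_left (by fun_prop),
    lintegral_mul_const _ h2, lintegral_mul_const _ h1, hint, hint]
  ring

/-- The summands tend to zero and the weights `m l ^ (-s)` are bounded below by `c ^ (-s)`, so only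
finitely many nodes have mass at least `ε`. -/
lemma isDiffuse_of_tsum_ne_top {θ m : List Bool → ℝ≥0∞} {s : ℝ} (hs : 0 ≤ s) {c : ℝ≥0∞}
    (hc : c ≠ ∞) (hm : ∀ l, m l ≤ c) (h : ∑' l, θ l ^ 2 * m l ^ (-s) ≠ ∞) : IsDiffuse θ := by
  intro ε hε
  have ht := ENNReal.tendsto_cofinite_zero_of_tsum_ne_top h
  set δ : ℝ≥0∞ := min ε 1 ^ 2 * c ^ (-s) with hδ
  have hε' : min ε 1 ≠ 0 := (lt_min hε one_pos).ne'
  have hδ0 : 0 < δ := by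
    refine pos_iff_ne_zero.2 (mul_ne_zero (pow_ne_zero _ hε') ?_)
    intro h0
    rcases ENNReal.rpow_eq_zero_iff.1 h0 with ⟨-, h1⟩ | ⟨h1, -⟩
    · linarith
    · exact hc h1
  have hfin : {l | ¬ θ l ^ 2 * m l ^ (-s) < δ}.Finite := ht.eventually (gt_mem_nhds hδ0)
  obtain ⟨n, hn⟩ := (hfin.image List.length).bddAbove
  refine ⟨n + 1, fun l hl => ?_⟩
  by_contra! hle
  have hmem : l ∈ {l | ¬ θ l ^ 2 * m l ^ (-s) < δ} := by
    refine not_lt.2 (mul_le_mul' ?_ (rpow_neg_le_rpow_neg (hm l) hs))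
    gcongr
    exact (min_le_left _ _).trans hle
  have := hn (Set.mem_image_of_mem _ hmem)
  omega

variable {μ : Measure I} [IsFiniteMeasure μ]

/-- The distance is the mass between the points, hence at least the mass of a separating cell, and
that cell contributes a term to the kernel. -/
lemma ofReal_distFun_sub_rpow_neg_le {s : ℝ} (hs : 0 ≤ s) {x y : I} (h : x ≠ y) :
    ENNReal.ofReal |distFun μ x - distFun μ y| ^ (-s) ≤ energyKernel (fun l => μ (cell l)) s x y := by
  wlog hlt : x < y generalizing x y
  · rw [abs_sub_comm, energyKernel_comm]
    exact this h.symm (lt_of_le_of_ne (not_lt.1 hlt) h.symm)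
  obtain ⟨p, b, q, hq, hsub, hxy⟩ := exists_separating_cell hlt
  refine le_trans (rpow_neg_le_rpow_neg ?_ hs) (rpow_neg_le_energyKernel hq hxy)
  rw [abs_sub_comm, distFun_sub hlt.le, abs_of_nonneg measureReal_nonneg,
    ofReal_measureReal (measure_ne_top _ _)]
  exact measure_mono (hsub.trans Set.Ioo_subset_Ioc_self)

/-- Off the diagonal the kernel is at least the `(-s)`-th power of the diameter. The diagonal point
`x` is ignored because it has no mass. -/
lemma mul_measure_le_lintegral_energyKernel (τ : Measure I) {s : ℝ} (hs : 0 ≤ s) (x : I)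
    (hx : τ {x} = 0) {V : Set I} (hxV : x ∈ V) :
    Metric.ediam (distFun μ '' V) ^ (-s) * τ V ≤
      ∫⁻ y, energyKernel (fun l => μ (cell l)) s x y ∂τ := by
  set d := Metric.ediam (distFun μ '' V) with hd
  have hm : Measurable fun y => energyKernel (fun l => μ (cell l)) s x y := by
    refine Measurable.tsum fun p => Finset.measurable_sum _ fun b _ =>
      Finset.measurable_sum _ fun q _ => ?_
    have h1 := measurable_cell_indicator (p ++ [b])
    have h2 := measurable_cell_indicator q
    fun_prop
  refine le_trans (mul_le_mul_right ?_ _) (mul_meas_ge_le_lintegral hm (d ^ (-s)))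
  have hV : V ⊆ {x} ∪ {y | d ^ (-s) ≤ energyKernel (fun l => μ (cell l)) s x y} := by
    intro y hy
    by_cases hxy : x = y
    · exact Or.inl hxy.symm
    · refine Or.inr (le_trans (rpow_neg_le_rpow_neg ?_ hs) (ofReal_distFun_sub_rpow_neg_le hs hxy))
      rw [← Real.dist_eq, ← edist_dist]
      exact Metric.edist_le_ediam_of_mem (Set.mem_image_of_mem _ hxV) (Set.mem_image_of_mem _ hy)
  refine (measure_mono hV).trans ((measure_union_le _ _).trans ?_)
  rw [hx, zero_add]

lemma monotone_distFun : Monotone (distFun μ) := fun _ _ h =>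
  measureReal_mono (Set.Iic_subset_Iic.2 h)

/-- The energy method: a flow of finite energy on a compact set bounds the dimension from below. -/
theorem le_dimH_image_of_energy {K C : Set I} {θ : List Bool → ℝ≥0∞} {s : ℝ≥0}
    (hC : IsCompact C) (hCK : C ⊆ K) (hθ : IsFlow θ) (hθ0 : θ [] ≠ 0) (hθ1 : θ [] ≠ ∞)
    (hsupp : ∀ l, θ l ≠ 0 → (closure (cell l) ∩ C).Nonempty)
    (h1 : ∑' l, θ l ^ 2 * μ (cell l) ^ (-(s : ℝ)) ≠ ∞)
    (h2 : ∑' p, ∑ b, ∑ q ∈ nearby p b, θ (p ++ [b]) * θ q * μ (cell (p ++ [!b])) ^ (-(s : ℝ)) ≠ ∞) :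
    s ≤ dimH (distFun μ '' K) := by
  have hd : IsDiffuse θ := isDiffuse_of_tsum_ne_top s.2 (measure_ne_top μ Set.univ)
    (fun l => measure_mono (Set.subset_univ _)) h1
  obtain ⟨τ, hτ⟩ := exists_measure_cell_eq hθ hθ1 hd
  have hτfin : IsFiniteMeasure τ := ⟨by rw [← cell_nil, hτ]; exact hθ1.lt_top⟩
  have hτpt : ∀ x, τ {x} = 0 := measure_singleton_of_isDiffuse (by simpa only [hτ] using hd)
  -- A point off the closed set `C` lies in a small cell whose closure misses `C`; such cells carry
  -- no flow, and there are countably many.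
  have hτC : τ Cᶜ = 0 := by
    have hsub : Cᶜ ⊆ ⋃ l ∈ {l | θ l = 0}, cell l := by
      intro x hx
      obtain ⟨ε, hε, hball⟩ := Metric.isOpen_iff.1 hC.isClosed.isOpen_compl x hx
      obtain ⟨n, hn⟩ := exists_pow_lt_of_lt_one hε (by norm_num : (2⁻¹ : ℝ) < 1)
      have hcl : closure (cell (code n x)) ⊆ Metric.closedBall x (2⁻¹ ^ n) := by
        refine closure_minimal (fun y hy => ?_) Metric.isClosed_closedBall
        have := abs_sub_le_of_mem_cell hy (mem_cell_code n x)
        rwa [length_code] at this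
      simp only [Set.mem_iUnion, exists_prop]
      refine ⟨code n x, ?_, mem_cell_code n x⟩
      by_contra hne
      obtain ⟨y, hy, hyC⟩ := hsupp _ hne
      exact hball (Metric.closedBall_subset_ball hn (hcl hy)) hyC
    refine measure_mono_null hsub ((measure_biUnion_null_iff (Set.to_countable _)).2 fun l hl => ?_)
    rw [hτ]; exact hl
  set U := energyPotential θ (fun l => μ (cell l)) s with hU
  have hUm : Measurable U := measurable_energyPotential _ _ _
  have hUfin : ∀ᵐ x ∂τ, U x < ∞ := by
    refine MeasureTheory.ae_lt_top hUm ?_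
    rw [lintegral_energyPotential hτ]
    exact ENNReal.mul_ne_top (by simp) h2
  -- Finite energy makes the potential finite almost everywhere, hence bounded on a set of positive
  -- mass. There `τ` obeys the mass distribution principle; `M + 1` is used so that the bound can be
  -- inverted.
  obtain ⟨M, hM⟩ : ∃ M : ℕ, τ {x | U x ≤ (M + 1 : ℕ)} ≠ 0 := by
    by_contra! hcon
    have hall : τ (⋃ M : ℕ, {x | U x ≤ (M + 1 : ℕ)}) = 0 := measure_iUnion_null hcon
    have huniv : ∀ᵐ x ∂τ, x ∈ ⋃ M : ℕ, {x | U x ≤ (M + 1 : ℕ)} := by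
      filter_upwards [hUfin] with x hx
      obtain ⟨n, hn⟩ := ENNReal.exists_nat_gt hx.ne
      refine Set.mem_iUnion.2 ⟨n, hn.le.trans ?_⟩
      exact_mod_cast Nat.le_succ n
    have : τ Set.univ = 0 := by
      rw [← Set.union_compl_self (⋃ M : ℕ, {x | U x ≤ (M + 1 : ℕ)})]
      exact measure_union_null hall huniv
    rw [← cell_nil, hτ] at this
    exact hθ0 this
  set c : ℝ≥0∞ := ((M + 1 : ℕ) : ℝ≥0∞) with hc
  have hc0 : c ≠ 0 := by simp [hc]
  have hct : c ≠ ∞ := ENNReal.natCast_ne_top _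
  set A := {x | U x ≤ c} with hA
  have hAm : MeasurableSet A := hUm measurableSet_Iic
  have hFm : Measurable (distFun μ) := monotone_distFun.measurable
  have hbound : ∀ V : Set I, τ.restrict A V ≤ c * Metric.ediam (distFun μ '' V) ^ (s : ℝ) := by
    intro V
    rw [Measure.restrict_apply' hAm]
    rcases (V ∩ A).eq_empty_or_nonempty with he | ⟨x, hx⟩
    · simp [he]
    have h := mul_measure_le_lintegral_energyKernel (μ := μ) τ s.2 x (hτpt x) hx
    rw [lintegral_energyKernel hτ] at h
    have h' : Metric.ediam (distFun μ '' (V ∩ A)) ^ (-(s : ℝ)) * τ (V ∩ A) ≤ c := h.trans hx.2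
    have h3 : τ (V ∩ A) ≤ c * Metric.ediam (distFun μ '' (V ∩ A)) ^ (s : ℝ) := by
      rw [mul_comm, ← ENNReal.le_div_iff_mul_le (Or.inr hc0) (Or.inr hct), div_eq_mul_inv,
        ← ENNReal.rpow_neg, neg_neg] at h'
      exact h'
    refine h3.trans (mul_le_mul_right (ENNReal.rpow_le_rpow ?_ s.2) _)
    exact Metric.ediam_mono (Set.image_mono Set.inter_subset_left)
  set lam : Measure ℝ := c⁻¹ • (τ.restrict A).map (distFun μ) with hlam
  have hle : lam ≤ μH[s] := by
    refine Measure.le_hausdorffMeasure s lam 1 one_pos fun T _ => ?_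
    -- The closure is measurable and has the same diameter, whereas `T` is arbitrary.
    calc lam T ≤ lam (closure T) := measure_mono subset_closure
      _ = c⁻¹ * τ.restrict A (distFun μ ⁻¹' closure T) := by
          rw [hlam, Measure.smul_apply, Measure.map_apply hFm measurableSet_closure, smul_eq_mul]
      _ ≤ c⁻¹ * (c * Metric.ediam (distFun μ '' (distFun μ ⁻¹' closure T)) ^ (s : ℝ)) :=
          mul_le_mul_right (hbound _) _
      _ = Metric.ediam (distFun μ '' (distFun μ ⁻¹' closure T)) ^ (s : ℝ) := by
          rw [← mul_assoc, ENNReal.inv_mul_cancel hc0 hct, one_mul]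
      _ ≤ Metric.ediam T ^ (s : ℝ) := by
          refine ENNReal.rpow_le_rpow ?_ s.2
          rw [← Metric.ediam_closure T]
          exact Metric.ediam_mono (Set.image_preimage_subset _ _)
  refine le_dimH_of_hausdorffMeasure_ne_zero fun h0 => ?_
  have h3 : lam (distFun μ '' C) = 0 :=
    le_antisymm ((hle _).trans ((measure_mono (Set.image_mono hCK)).trans h0.le)) zero_le
  rw [hlam, Measure.smul_apply, smul_eq_mul, mul_eq_zero] at h3
  have h4 := h3.resolve_left (ENNReal.inv_ne_zero.2 hct)
  have h5 : τ.restrict A C = 0 := by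
    refine le_antisymm ((measure_mono (Set.subset_preimage_image (distFun μ) C)).trans ?_) zero_le
    exact (Measure.le_map_apply hFm.aemeasurable _).trans h4.le
  rw [Measure.restrict_apply' hAm] at h5
  refine hM (measure_mono_null (t := (C ∩ A) ∪ Cᶜ) (fun x hx => ?_) (measure_union_null h5 hτC))
  by_cases hxC : x ∈ C
  · exact Or.inl ⟨hxC, hx⟩
  · exact Or.inr hxC

end Cascade

/-! ### The two dimension bounds -/

namespace Cascade

lemma IsFlow.eq_zero {ν : List Bool → ℝ≥0∞} (hν : IsFlow ν) (h : ν [] = 0) (l : List Bool) :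
    ν l = 0 := by
  induction l generalizing ν with
  | nil => exact h
  | cons b l ih =>
    rw [hν.root, add_eq_zero] at h
    refine ih (hν.sub b) ?_
    cases b
    · exact h.1
    · exact h.2

lemma approxMass_eq_zero (g : ℝ≥0∞ → ℝ≥0∞) {ν : List Bool → ℝ≥0∞} (hν : ∀ l, ν l = 0) (n : ℕ)
    (w : Weights) : approxMass g ν n w = 0 := by
  have : ν = fun l => 0 * ν l := by funext l; simp [hν]
  rw [this, approxMass_const_mul, zero_mul]

/-- The random flow lives on the nodes charged by `ν`, so its mass stays on the deterministic
compact set given by Frostman's lemma. -/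
lemma nodeMass_eq_zero (g : ℝ≥0∞ → ℝ≥0∞) {ν : List Bool → ℝ≥0∞} (hν : IsFlow ν) {l : List Bool}
    (h : ν l = 0) (w : Weights) : nodeMass g ν w l = 0 := by
  induction l generalizing ν w with
  | nil => simp [nodeMass, limitMass, approxMass_eq_zero g (hν.eq_zero h)]
  | cons b l ih =>
    rw [nodeMass, ih (hν.sub b) h, mul_zero]

variable {lam : Measure ℝ≥0∞} [IsProbabilityMeasure lam] {K : Set I}

/-- Frostman's flow decays like `2 ^ (-t n)`, and `hst` is the subcriticality needed for survival
and finite energy of its tilted cascade. Quantifying over all `μ` with the given cell masses inside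
the almost sure event avoids any measurability of the limit measure in `w`. -/
theorem IsCascadeLaw.ae_le_dimH (h : IsCascadeLaw lam) (hK : AnalyticSet K) {s t : ℝ≥0} (hs0 : 0 < s)
    (hs1 : s < 1) (ht : 0 < t) (htK : t < dimH K) (hst : growth lam s * 2⁻¹ ^ (t : ℝ) < 1) :
    ∀ᵐ w ∂treeLaw lam, ∀ (μ : Measure I) [IsFiniteMeasure μ], (∀ l, μ (cell l) = lebNode w l) →
      s ≤ dimH (distFun μ '' K) := by
  obtain ⟨C, ν, hC, hCK, hν, hν0, hνa, hsupp⟩ := exists_isFlow_of_netContent_ne_zero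
    (ENNReal.rpow_pos (by simp) (by simp)).ne'
    (ENNReal.rpow_lt_one (by simp) (NNReal.coe_pos.2 ht)).le hK (netContent_ne_zero_of_lt_dimH ht htK)
  filter_upwards [h.ae_energy (s := s) (NNReal.coe_pos.2 hs0) hs1 hst hν hν0 hνa nearby
    card_nearby_le fun p b q hq => nearby_spec hq] with w hw μ _ hμ
  obtain ⟨hw0, hreg, hw1, hw2⟩ := hw
  refine le_dimH_image_of_energy hC hCK hreg.isFlow_nodeMass hw0 (hreg.nodeMass_lt_top []).ne
    (fun l hl => hsupp l fun h0 => hl (nodeMass_eq_zero _ hν h0 w)) ?_ ?_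
  · simpa only [hμ] using hw1
  · simpa only [hμ] using hw2

/-- The first moment method: coverings of cost at most `2⁻¹ ^ n` have expected `∑ μ(I) ^ s` at most
`2⁻¹ ^ n`. These are summable in `n`, so the random sums tend to zero almost surely. -/
theorem IsCascadeLaw.ae_dimH_le (h : IsCascadeLaw lam) {s t : ℝ≥0} (hs0 : 0 < s) (hs1 : s ≤ 1)
    (ht : 0 < t) (htK : dimH K < t) (hst : (growth lam s)⁻¹ ≤ 2⁻¹ ^ (t : ℝ)) :
    ∀ᵐ w ∂treeLaw lam, ∀ (μ : Measure I) [IsFiniteMeasure μ], (∀ l, μ (cell l) = lebNode w l) →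
      dimH (distFun μ '' K) ≤ s := by
  choose U hU hU' using fun n => exists_cost_le_of_netContent_eq_zero
    (netContent_eq_zero_of_dimH_lt ht htK) n
  have hm : ∀ n l, Measurable fun w => (U n).indicator (fun l => lebNode w l ^ (s : ℝ)) l := by
    intro n l
    by_cases hl : l ∈ U n
    · simp only [Set.indicator_of_mem hl]
      have := measurable_lebNode l
      fun_prop
    · simp only [Set.indicator_of_notMem hl]
      fun_prop
  have hint : ∀ n, ∫⁻ w, ∑' l, (U n).indicator (fun l => lebNode w l ^ (s : ℝ)) l ∂treeLaw lam ≤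
      2⁻¹ ^ n := by
    intro n
    rw [lintegral_tsum fun l => (hm n l).aemeasurable]
    refine le_trans (ENNReal.tsum_le_tsum fun l => ?_) (hU' n)
    by_cases hl : l ∈ U n
    · simp only [Set.indicator_of_mem hl]
      exact (h.lintegral_lebNode_rpow_le s.2 hs1 l).trans (pow_le_pow_left' hst _)
    · simp only [Set.indicator_of_notMem hl, lintegral_zero, le_refl]
  have hfin : ∀ᵐ w ∂treeLaw lam,
      ∑' n, ∑' l, (U n).indicator (fun l => lebNode w l ^ (s : ℝ)) l < ∞ := by
    refine MeasureTheory.ae_lt_top (Measurable.tsum fun n => Measurable.tsum fun l => hm n l) ?_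
    rw [lintegral_tsum fun n => (Measurable.tsum fun l => hm n l).aemeasurable]
    refine ne_top_of_le_ne_top ?_ (ENNReal.tsum_le_tsum hint)
    rw [ENNReal.tsum_geometric]
    simp
  filter_upwards [hfin] with w hw μ _ hμ
  have h0 : μH[s] (distFun μ '' K) = 0 := by
    refine hausdorffMeasure_image_eq_zero (m := fun l => lebNode w l) (fun l => ?_)
      (NNReal.coe_pos.2 hs0) U hU (ENNReal.tendsto_atTop_zero_of_tsum_ne_top hw.ne)
    refine Metric.ediam_le ?_
    rintro _ ⟨x, hx, rfl⟩ _ ⟨y, hy, rfl⟩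
    rw [edist_dist, Real.dist_eq, ← hμ]
    exact distFun_sub_le hx hy
  exact dimH_le_of_hausdorffMeasure_ne_top (by rw [h0]; simp)

/-- The dimension formula in terms of the exponent `φ` of the function `growth`. -/
theorem IsCascadeLaw.ae_dimH_eq (h : IsCascadeLaw lam) (hK : AnalyticSet K) {φ : ℝ → ℝ}
    (hφ : ∀ s ∈ Set.Icc (0 : ℝ) 1, growth lam s = 2 ^ φ s) (hmono : StrictMonoOn φ (Set.Icc 0 1))
    (hφ0 : φ 0 = 0) {ζ ζ₀ : ℝ≥0} (hζ : ζ ≤ 1) (hζ₀ : φ ζ = ζ₀) (hdim : dimH K = ζ₀) :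
    ∀ᵐ w ∂treeLaw lam, ∀ (μ : Measure I) [IsFiniteMeasure μ], (∀ l, μ (cell l) = lebNode w l) →
      dimH (distFun μ '' K) = ζ := by
  have hpow : ∀ x y : ℝ, x < y → (2 : ℝ≥0∞) ^ x * 2⁻¹ ^ y < 1 := by
    intro x y hxy
    rw [ENNReal.inv_rpow, ← ENNReal.rpow_neg, ← ENNReal.rpow_add _ _ two_ne_zero (by simp)]
    exact ENNReal.rpow_lt_one_of_one_lt_of_neg (by simp) (by linarith)
  have hmemζ : (ζ : ℝ) ∈ Set.Icc (0 : ℝ) 1 := ⟨ζ.2, hζ⟩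
  have hlower : ∀ s : ℝ≥0, 0 < s → s < ζ → ∀ᵐ w ∂treeLaw lam, ∀ (μ : Measure I) [IsFiniteMeasure μ],
      (∀ l, μ (cell l) = lebNode w l) → s ≤ dimH (distFun μ '' K) := by
    intro s hs0 hs
    have hs1 : s < 1 := hs.trans_le hζ
    have hmem : (s : ℝ) ∈ Set.Icc (0 : ℝ) 1 := ⟨s.2, hs1.le⟩
    have h1 : φ s < ζ₀ := hζ₀ ▸ hmono hmem hmemζ hs
    have h2 : 0 < φ s := hφ0 ▸ hmono (by simp) hmem hs0
    obtain ⟨t, ht1, ht2⟩ := exists_between h1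
    lift t to ℝ≥0 using (h2.trans ht1).le
    refine h.ae_le_dimH hK hs0 hs1 (t := t) (NNReal.coe_pos.1 (h2.trans ht1)) ?_ ?_
    · rw [hdim]; exact_mod_cast ht2
    · rw [hφ s hmem]; exact hpow _ _ ht1
  have hupper : ∀ s : ℝ≥0, ζ < s → s ≤ 1 → ∀ᵐ w ∂treeLaw lam, ∀ (μ : Measure I) [IsFiniteMeasure μ],
      (∀ l, μ (cell l) = lebNode w l) → dimH (distFun μ '' K) ≤ s := by
    intro s hs hs1
    have hmem : (s : ℝ) ∈ Set.Icc (0 : ℝ) 1 := ⟨s.2, hs1⟩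
    have h1 : ζ₀ < φ s := hζ₀ ▸ hmono hmemζ hmem hs
    obtain ⟨t, ht1, ht2⟩ := exists_between h1
    have ht0 : 0 < t := ζ₀.2.trans_lt ht1
    lift t to ℝ≥0 using ht0.le
    refine h.ae_dimH_le (bot_le.trans_lt hs) hs1 (t := t) (NNReal.coe_pos.1 ht0) ?_ ?_
    · rw [hdim]; exact_mod_cast ht1
    · rw [hφ s hmem, ← ENNReal.inv_rpow]
      exact ENNReal.rpow_le_rpow_of_exponent_ge (by simp) ht2.le
  -- Rational exponents make the exceptional null sets countable in number.
  have hl : ∀ᵐ w ∂treeLaw lam, ∀ q : ℚ, 0 < Real.toNNReal q → Real.toNNReal q < ζ →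
      ∀ (μ : Measure I) [IsFiniteMeasure μ], (∀ l, μ (cell l) = lebNode w l) →
        (Real.toNNReal q : ℝ≥0∞) ≤ dimH (distFun μ '' K) :=
    ae_all_iff.2 fun q => by
      by_cases h1 : 0 < Real.toNNReal q <;> by_cases h2 : Real.toNNReal q < ζ
      · filter_upwards [hlower _ h1 h2] with w hw _ _ using hw
      all_goals exact Eventually.of_forall fun w h1' h2' => by contradiction
  have hu : ∀ᵐ w ∂treeLaw lam, ∀ q : ℚ, ζ < Real.toNNReal q → Real.toNNReal q ≤ 1 →
      ∀ (μ : Measure I) [IsFiniteMeasure μ], (∀ l, μ (cell l) = lebNode w l) →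
        dimH (distFun μ '' K) ≤ (Real.toNNReal q : ℝ≥0∞) :=
    ae_all_iff.2 fun q => by
      by_cases h1 : ζ < Real.toNNReal q <;> by_cases h2 : Real.toNNReal q ≤ 1
      · filter_upwards [hupper _ h1 h2] with w hw _ _ using hw
      all_goals exact Eventually.of_forall fun w h1' h2' => by contradiction
  filter_upwards [hl, hu] with w hwl hwu μ _ hμ
  refine le_antisymm (le_of_not_gt fun hlt => ?_) (le_of_not_gt fun hlt => ?_)
  · obtain ⟨q, -, h1, h2⟩ := ENNReal.lt_iff_exists_rat_btwn.1 hlt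
    -- The upper bound is available only for exponents up to `1`, and `q` lies below the dimension
    -- of a subset of the line.
    have hq1 : (Real.toNNReal q : ℝ≥0∞) < 1 := by
      refine h2.trans_le ?_
      refine (dimH_mono (Set.subset_univ _)).trans ?_
      rw [Real.dimH_univ]
    exact absurd (hwu q (ENNReal.coe_lt_coe.1 h1) (by exact_mod_cast hq1.le) μ hμ) (not_le.2 h2)
  · obtain ⟨q, -, h1, h2⟩ := ENNReal.lt_iff_exists_rat_btwn.1 hlt
    exact absurd (hwl q (ENNReal.coe_pos.1 (bot_le.trans_lt h1)) (ENNReal.coe_lt_coe.1 h2) μ hμ)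
      (not_le.2 h1)

end Cascade

/-! ### From the law of `W` to the abstract hypotheses; properties of `φ` -/

namespace Cascade

section
variable {Ω₀ : Type*} [MeasurableSpace Ω₀] (P₀ : Measure Ω₀) (W : Ω₀ → ℝ)

/-- The law of a weight, as a measure on `[0, ∞]`. -/
def weightLaw : Measure ℝ≥0∞ := P₀.map fun ω => ENNReal.ofReal (W ω)

variable {P₀ W}

lemma isProbabilityMeasure_weightLaw [IsProbabilityMeasure P₀] (hW : Measurable W) :
    IsProbabilityMeasure (weightLaw P₀ W) :=
  Measure.isProbabilityMeasure_map (by fun_prop)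

lemma lintegral_weightLaw (hW : Measurable W) {f : ℝ≥0∞ → ℝ≥0∞} (hf : Measurable f) :
    ∫⁻ a, f a ∂weightLaw P₀ W = ∫⁻ ω, f (ENNReal.ofReal (W ω)) ∂P₀ :=
  lintegral_map hf (by fun_prop)

lemma lintegral_weightLaw_rpow (hW : Measurable W) (hWpos : ∀ᵐ ω ∂P₀, 0 < W ω) {s : ℝ}
    (hs : Integrable (fun ω => W ω ^ s) P₀) :
    ∫⁻ a, a ^ s ∂weightLaw P₀ W = ENNReal.ofReal (∫ ω, W ω ^ s ∂P₀) := by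
  rw [lintegral_weightLaw hW (by fun_prop), ofReal_integral_eq_lintegral_ofReal hs]
  · refine lintegral_congr_ae ?_
    filter_upwards [hWpos] with ω hω
    exact ENNReal.ofReal_rpow_of_pos hω
  · filter_upwards [hWpos] with ω hω
    exact Real.rpow_nonneg hω.le _

lemma rpow_le_one_add {x s : ℝ} (hx : 0 < x) (hs : s ∈ Set.Icc (0 : ℝ) 1) : x ^ s ≤ 1 + x := by
  rcases le_total x 1 with h | h
  · have := Real.rpow_le_one hx.le h hs.1
    linarith
  · have := Real.rpow_le_rpow_of_exponent_le h hs.2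
    rw [Real.rpow_one] at this
    linarith

lemma integrable_rpow [IsProbabilityMeasure P₀] (hW : Measurable W) (hWpos : ∀ᵐ ω ∂P₀, 0 < W ω)
    (hWint : Integrable W P₀) {s : ℝ} (hs : s ∈ Set.Icc (0 : ℝ) 1) :
    Integrable (fun ω => W ω ^ s) P₀ := by
  refine Integrable.mono' ((integrable_const (1 : ℝ)).add hWint)
    (hW.pow_const s).aestronglyMeasurable ?_
  filter_upwards [hWpos] with ω hω
  rw [Real.norm_of_nonneg (Real.rpow_nonneg hω.le _)]
  exact rpow_le_one_add hω hs

/-- Jensen's inequality for the measure with density `W`. -/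
lemma two_rpow_le_integral_rpow [IsProbabilityMeasure P₀] (hW : Measurable W)
    (hWpos : ∀ᵐ ω ∂P₀, 0 < W ω) (hWint : Integrable W P₀) (hWmean : ∫ ω, W ω ∂P₀ = 1)
    (hWlogint : Integrable (fun ω => W ω * Real.logb 2 (W ω)) P₀) {h : ℝ}
    (hh : h ∈ Set.Icc (0 : ℝ) 1) :
    (2 : ℝ) ^ (-((1 - h) * ∫ ω, W ω * Real.logb 2 (W ω) ∂P₀)) ≤ ∫ ω, W ω ^ h ∂P₀ := by
  set m := ∫ ω, W ω * Real.logb 2 (W ω) ∂P₀ with hm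
  set c : ℝ := -((1 - h) * m) with hc
  set d : ℝ := Real.log 2 with hd
  -- Jensen in its tangent line form: `W ^ h = 2 ^ c W exp(z)` with `z` of mean zero under the
  -- density `W`, and `exp z ≥ 1 + z`.
  have hpt : ∀ᵐ ω ∂P₀, (2 : ℝ) ^ c * ((1 - c * d) * W ω - (1 - h) * d * (W ω * Real.logb 2 (W ω)))
      ≤ W ω ^ h := by
    filter_upwards [hWpos] with ω hω
    have hlog : Real.logb 2 (W ω) * d = Real.log (W ω) := by
      rw [Real.logb, hd, div_mul_cancel₀]
      exact (Real.log_pos one_lt_two).ne'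
    have e1 : W ω ^ h = (2 : ℝ) ^ c * (W ω * Real.exp (-(1 - h) * Real.log (W ω) - c * d)) := by
      rw [Real.rpow_def_of_pos two_pos, Real.rpow_def_of_pos hω]
      nth_rw 2 [← Real.exp_log hω]
      rw [← Real.exp_add, ← Real.exp_add]
      congr 1
      ring
    rw [e1]
    refine mul_le_mul_of_nonneg_left ?_ (Real.rpow_nonneg two_pos.le _)
    have e2 := Real.add_one_le_exp (-(1 - h) * Real.log (W ω) - c * d)
    have e3 := mul_le_mul_of_nonneg_left e2 hω.le
    refine le_trans (le_of_eq ?_) e3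
    rw [← hlog]
    ring
  have hi1 : Integrable (fun ω => (1 - c * d) * W ω) P₀ := hWint.const_mul _
  have hi2 : Integrable (fun ω => (1 - h) * d * (W ω * Real.logb 2 (W ω))) P₀ :=
    hWlogint.const_mul _
  have h1 := integral_mono_ae ((hi1.sub hi2).const_mul ((2 : ℝ) ^ c))
    (integrable_rpow hW hWpos hWint hh) hpt
  refine le_trans (le_of_eq ?_) h1
  simp only [Pi.sub_apply]
  rw [integral_const_mul, integral_sub hi1 hi2, integral_const_mul, integral_const_mul, hWmean, ← hm,
    hc]
  ring

lemma isCascadeLaw_weightLaw [IsProbabilityMeasure P₀] (hW : Measurable W)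
    (hWpos : ∀ᵐ ω ∂P₀, 0 < W ω) (hWint : Integrable W P₀) (hWmean : ∫ ω, W ω ∂P₀ = 1)
    (hWlogint : Integrable (fun ω => W ω * Real.logb 2 (W ω)) P₀)
    (hWlog : ∫ ω, W ω * Real.logb 2 (W ω) ∂P₀ < 1)
    (hWneg : ∀ s : ℝ, 0 ≤ s → s < 1 → Integrable (fun ω => W ω ^ (-s)) P₀) :
    IsCascadeLaw (weightLaw P₀ W) where
  ae_pos := by
    rw [weightLaw, ae_map_iff (by fun_prop) measurableSet_Ioi]
    filter_upwards [hWpos] with ω hω using ENNReal.ofReal_pos.2 hω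
  mean := by
    have := lintegral_weightLaw_rpow hW hWpos (s := 1) (by simpa using hWint)
    simpa [hWmean] using this
  entropy := by
    set m := ∫ ω, W ω * Real.logb 2 (W ω) ∂P₀ with hm
    -- The entropy deficit `1 - m` is positive by hypothesis; capping at `1` is harmless because a
    -- smaller `κ` only weakens the claim.
    refine ⟨min (1 - m) 1, lt_min (by linarith) one_pos, min_le_right _ _, fun h h0 h1 => ?_⟩
    have hh : h ∈ Set.Icc (0 : ℝ) 1 := ⟨h0.le, h1.le⟩
    rw [lintegral_weightLaw_rpow hW hWpos (integrable_rpow hW hWpos hWint hh)]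
    refine ENNReal.ofReal_le_ofReal (le_trans ?_
      (two_rpow_le_integral_rpow hW hWpos hWint hWmean hWlogint hh))
    refine Real.rpow_le_rpow_of_exponent_le one_le_two (neg_le_neg ?_)
    refine mul_le_mul_of_nonneg_left ?_ (by linarith)
    have := min_le_left (1 - m) 1
    linarith
  neg_moment s hs0 hs1 := by
    rw [lintegral_weightLaw_rpow hW hWpos (hWneg s hs0 hs1)]
    exact ENNReal.ofReal_ne_top

lemma integral_rpow_pos [IsProbabilityMeasure P₀] (hW : Measurable W)
    (hWpos : ∀ᵐ ω ∂P₀, 0 < W ω) (hWint : Integrable W P₀) {s : ℝ} (hs : s ∈ Set.Icc (0 : ℝ) 1) :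
    0 < ∫ ω, W ω ^ s ∂P₀ := by
  rw [integral_pos_iff_support_of_nonneg_ae]
  · have : ∀ᵐ ω ∂P₀, ω ∈ Function.support fun ω => W ω ^ s := by
      filter_upwards [hWpos] with ω hω using (Real.rpow_pos_of_pos hω s).ne'
    rw [measure_eq_measure_of_null_sdiff (Set.subset_univ _)]
    · simp
    · rw [← Set.compl_eq_univ_sdiff]
      exact this
  · filter_upwards [hWpos] with ω hω using Real.rpow_nonneg hω.le _
  · exact integrable_rpow hW hWpos hWint hs

lemma two_rpow_cascadePhi [IsProbabilityMeasure P₀] (hW : Measurable W)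
    (hWpos : ∀ᵐ ω ∂P₀, 0 < W ω) (hWint : Integrable W P₀) {s : ℝ} (hs : s ∈ Set.Icc (0 : ℝ) 1) :
    (2 : ℝ) ^ cascadePhi P₀ W s = 2 ^ s / ∫ ω, W ω ^ s ∂P₀ := by
  rw [cascadePhi, Real.rpow_sub two_pos, Real.rpow_logb two_pos (by norm_num)
    (integral_rpow_pos hW hWpos hWint hs)]

lemma growth_weightLaw [IsProbabilityMeasure P₀] (hW : Measurable W)
    (hWpos : ∀ᵐ ω ∂P₀, 0 < W ω) (hWint : Integrable W P₀) {s : ℝ} (hs : s ∈ Set.Icc (0 : ℝ) 1) :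
    growth (weightLaw P₀ W) s = 2 ^ cascadePhi P₀ W s := by
  have h2 : ∀ x : ℝ, (2 : ℝ≥0∞) ^ x = ENNReal.ofReal (2 ^ x) := fun x => by
    rw [← ENNReal.ofReal_rpow_of_pos two_pos]
    simp
  rw [growth, moment, lintegral_weightLaw_rpow hW hWpos (integrable_rpow hW hWpos hWint hs), h2, h2,
    two_rpow_cascadePhi hW hWpos hWint hs, ← div_eq_mul_inv,
    ENNReal.ofReal_div_of_pos (integral_rpow_pos hW hWpos hWint hs)]

lemma cascadePhi_zero [IsProbabilityMeasure P₀] : cascadePhi P₀ W 0 = 0 := by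
  simp [cascadePhi]

lemma cascadePhi_one (hWmean : ∫ ω, W ω ∂P₀ = 1) : cascadePhi P₀ W 1 = 1 := by
  simp [cascadePhi, hWmean]

/-- With `m = E[W log₂ W]`, Jensen gives `φ(s) ≤ s + (1 - s) m`, which is below `1` because `m < 1`.
-/
lemma cascadePhi_lt_one [IsProbabilityMeasure P₀] (hW : Measurable W)
    (hWpos : ∀ᵐ ω ∂P₀, 0 < W ω) (hWint : Integrable W P₀) (hWmean : ∫ ω, W ω ∂P₀ = 1)
    (hWlogint : Integrable (fun ω => W ω * Real.logb 2 (W ω)) P₀)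
    (hWlog : ∫ ω, W ω * Real.logb 2 (W ω) ∂P₀ < 1) {s : ℝ} (hs0 : 0 ≤ s) (hs1 : s < 1) :
    cascadePhi P₀ W s < 1 := by
  have hs : s ∈ Set.Icc (0 : ℝ) 1 := ⟨hs0, hs1.le⟩
  have h := two_rpow_le_integral_rpow hW hWpos hWint hWmean hWlogint hs
  rw [← Real.le_logb_iff_rpow_le one_lt_two (integral_rpow_pos hW hWpos hWint hs)] at h
  rw [cascadePhi]
  nlinarith

lemma integral_rpow_le [IsProbabilityMeasure P₀] (hW : Measurable W)
    (hWpos : ∀ᵐ ω ∂P₀, 0 < W ω) (hWint : Integrable W P₀) (hWmean : ∫ ω, W ω ∂P₀ = 1) {s t : ℝ}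
    (hs : s ∈ Set.Icc (0 : ℝ) 1) (ht : t ∈ Set.Icc (0 : ℝ) 1) :
    ∫ ω, W ω ^ ((1 - t) * s + t) ∂P₀ ≤ (∫ ω, W ω ^ s ∂P₀) ^ (1 - t) := by
  have hst : (1 - t) * s + t ∈ Set.Icc (0 : ℝ) 1 := by
    obtain ⟨h1, h2⟩ := hs
    obtain ⟨h3, h4⟩ := ht
    constructor <;> nlinarith
  have hmean : ∫⁻ a, a ∂weightLaw P₀ W = 1 := by
    have := lintegral_weightLaw_rpow hW hWpos (s := 1) (by simpa using hWint)
    simpa [hWmean] using this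
  have hle : ∫⁻ a, a ^ ((1 - t) * s + t) ∂weightLaw P₀ W ≤
      (∫⁻ a, a ^ s ∂weightLaw P₀ W) ^ (1 - t) * (∫⁻ a, a ∂weightLaw P₀ W) ^ t := by
    refine le_trans (le_of_eq (lintegral_congr fun a => ?_))
      (ENNReal.lintegral_mul_norm_pow_le (f := fun a : ℝ≥0∞ => a ^ s) (g := fun a => a)
        (by fun_prop) (by fun_prop) (by linarith [ht.2] : (0 : ℝ) ≤ 1 - t) ht.1 (by ring))
    rw [← ENNReal.rpow_mul, ← ENNReal.rpow_add_of_nonneg _ _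
      (mul_nonneg hs.1 (by linarith [ht.2])) ht.1, mul_comm s]
  rw [hmean, ENNReal.one_rpow, mul_one,
    lintegral_weightLaw_rpow hW hWpos (integrable_rpow hW hWpos hWint hst),
    lintegral_weightLaw_rpow hW hWpos (integrable_rpow hW hWpos hWint hs),
    ENNReal.ofReal_rpow_of_pos (integral_rpow_pos hW hWpos hWint hs)] at hle
  exact (ENNReal.ofReal_le_ofReal_iff (Real.rpow_nonneg
    (integral_rpow_pos hW hWpos hWint hs).le _)).1 hle

/-- Hölder between the exponents `s` and `1`, with `E[W] = 1`, gives the concavity inequality `φ((1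
- t) s + t) ≥ (1 - t) φ(s) + t`. The right side exceeds `φ(s)` because `φ(s) < 1`. -/
lemma strictMonoOn_cascadePhi [IsProbabilityMeasure P₀] (hW : Measurable W)
    (hWpos : ∀ᵐ ω ∂P₀, 0 < W ω) (hWint : Integrable W P₀) (hWmean : ∫ ω, W ω ∂P₀ = 1)
    (hWlogint : Integrable (fun ω => W ω * Real.logb 2 (W ω)) P₀)
    (hWlog : ∫ ω, W ω * Real.logb 2 (W ω) ∂P₀ < 1) :
    StrictMonoOn (cascadePhi P₀ W) (Set.Icc 0 1) := by
  intro s hs s' hs' hlt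
  have hs1 : s < 1 := hlt.trans_le hs'.2
  have hφ := cascadePhi_lt_one hW hWpos hWint hWmean hWlogint hWlog hs.1 hs1
  set t := (s' - s) / (1 - s) with ht
  have hpos : 0 < 1 - s := by linarith
  have ht0 : 0 < t := div_pos (by linarith) hpos
  have ht1 : t ≤ 1 := (div_le_one hpos).2 (by linarith [hs'.2])
  have he : (1 - t) * s + t = s' := by
    rw [ht]
    field_simp
    ring
  have h := integral_rpow_le hW hWpos hWint hWmean hs (t := t) ⟨ht0.le, ht1⟩
  rw [he] at h
  have h' := Real.logb_le_logb_of_le one_lt_two (integral_rpow_pos hW hWpos hWint hs') h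
  rw [Real.logb_rpow_eq_mul_logb_of_pos (integral_rpow_pos hW hWpos hWint hs)] at h'
  rw [cascadePhi] at hφ ⊢
  rw [cascadePhi]
  nlinarith

lemma continuousOn_cascadePhi [IsProbabilityMeasure P₀] (hW : Measurable W)
    (hWpos : ∀ᵐ ω ∂P₀, 0 < W ω) (hWint : Integrable W P₀) :
    ContinuousOn (cascadePhi P₀ W) (Set.Icc 0 1) := by
  have hR : ContinuousOn (fun s : ℝ => ∫ ω, W ω ^ s ∂P₀) (Set.Icc 0 1) := by
    refine continuousOn_of_dominated (bound := fun ω => 1 + W ω) (fun s _ =>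
      (hW.pow_const s).aestronglyMeasurable) ?_
      ((integrable_const (1 : ℝ)).add hWint) ?_
    · intro s hs
      filter_upwards [hWpos] with ω hω
      rw [Real.norm_of_nonneg (Real.rpow_nonneg hω.le _)]
      exact rpow_le_one_add hω hs
    · filter_upwards [hWpos] with ω hω
      exact (Real.continuous_const_rpow hω.ne').continuousOn
  unfold cascadePhi Real.logb
  exact continuousOn_id.sub ((hR.log fun s hs =>
    (integral_rpow_pos hW hWpos hWint hs).ne').div_const _)

lemma map_nodeWeights_eq_treeLaw {Ω : Type*} [MeasurableSpace Ω] {P : Measure Ω}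
    [IsProbabilityMeasure P] [IsProbabilityMeasure (weightLaw P₀ W)]
    {X : DyadicIndex → Ω → ℝ} (hX : ∀ J, Measurable (X J)) (hXindep : iIndepFun X P)
    (hXlaw : ∀ J, IdentDistrib (X J) W P P₀) :
    P.map (fun ω => nodeWeights fun J => X J ω) = treeLaw (weightLaw P₀ W) := by
  have h1 : iIndepFun (fun (l : List Bool) ω => ENNReal.ofReal (X (toIndex l) ω)) P :=
    (hXindep.precomp toIndex_injective).comp (fun _ => ENNReal.ofReal) fun _ => by fun_prop
  have h2 := h1.map_fun_eq_infinitePi_map₀ (by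
    refine Measurable.aemeasurable (measurable_pi_lambda _ fun l => ?_)
    have := hX (toIndex l)
    fun_prop)
  have h3 : ∀ l : List Bool, P.map (fun ω => ENNReal.ofReal (X (toIndex l) ω)) = weightLaw P₀ W :=
    fun l => ((hXlaw (toIndex l)).comp ENNReal.measurable_ofReal).map_eq
  simp only [h3] at h2
  exact h2

end

lemma dimH_le_one (K : Set I) : dimH K ≤ 1 := by
  rw [← (isometry_subtype_coe (s := I)).dimH_image K]
  exact (dimH_mono (Set.subset_univ _)).trans (by rw [Real.dimH_univ])

end Cascade

end

/-! ### The theorem -/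

open Cascade in
theorem theorem3p1 {Ω₀ Ω : Type*} [MeasurableSpace Ω₀] [MeasurableSpace Ω]
    (P₀ : Measure Ω₀) [IsProbabilityMeasure P₀] (P : Measure Ω) [IsProbabilityMeasure P]
    -- the random variable `W`
    (W : Ω₀ → ℝ) (hW : Measurable W) (hWpos : ∀ᵐ ω ∂P₀, 0 < W ω)
    (hWint : Integrable W P₀) (hWmean : ∫ ω, W ω ∂P₀ = 1)
    (hWlogint : Integrable (fun ω => W ω * Real.logb 2 (W ω)) P₀)
    (hWlog : ∫ ω, W ω * Real.logb 2 (W ω) ∂P₀ < 1)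
    (hWneg : ∀ s : ℝ, 0 ≤ s → s < 1 → Integrable (fun ω => W ω ^ (-s)) P₀)
    -- the independent weights, each with the law of `W`
    (X : DyadicIndex → Ω → ℝ) (hX : ∀ J, Measurable (X J)) (hXindep : iIndepFun X P)
    (hXlaw : ∀ J, IdentDistrib (X J) W P P₀)
    -- the deterministic set and its Euclidean Hausdorff dimension
    (K : Set I) (hKne : K.Nonempty) (hK : AnalyticSet K)
    (ζ₀ : ℝ≥0) (hζ₀ : dimH K = ζ₀) :
    ∀ᵐ ω ∂P,
      -- the weak limit exists
      Tendsto (fun n => cascadeApprox (fun J => X J ω) n) atTop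
        (𝓝 (cascadeMeasure fun J => X J ω)) ∧
      -- `ρ` is a metric on `[0,1]`
      ∃ m : MetricSpace I, (∀ x y : I, m.dist x y = cascadeDist (fun J => X J ω) x y) ∧
        -- the Hausdorff dimension with respect to `ρ` is the unique solution in `[0,1]`
        ∃ ζ : ℝ≥0, @dimH I m.toEMetricSpace K = ζ ∧ ζ ≤ 1 ∧
          ∀ s : ℝ, s ∈ Set.Icc (0 : ℝ) 1 →
            (((2 : ℝ) ^ (ζ₀ : ℝ) = (2 : ℝ) ^ s / ∫ ω', W ω' ^ s ∂P₀ ↔ s = ζ) ∧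
              ((ζ₀ : ℝ) = cascadePhi P₀ W s ↔ s = ζ)) := by
  have hlaw := isCascadeLaw_weightLaw hW hWpos hWint hWmean hWlogint hWlog hWneg
  have hprob := isProbabilityMeasure_weightLaw (P₀ := P₀) hW
  have hmono := strictMonoOn_cascadePhi hW hWpos hWint hWmean hWlogint hWlog
  have hζ₀1 : (ζ₀ : ℝ) ≤ 1 := by
    have := dimH_le_one K
    rw [hζ₀] at this
    exact_mod_cast this
  obtain ⟨ζ, hζmem, hζ⟩ : ∃ ζ ∈ Set.Icc (0 : ℝ) 1, cascadePhi P₀ W ζ = ζ₀ := by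
    refine intermediate_value_Icc zero_le_one (continuousOn_cascadePhi hW hWpos hWint) ?_
    rw [cascadePhi_zero, cascadePhi_one hWmean]
    exact ⟨ζ₀.2, hζ₀1⟩
  lift ζ to ℝ≥0 using hζmem.1
  have hdim := hlaw.ae_dimH_eq hK (fun s hs => growth_weightLaw hW hWpos hWint hs) hmono
    cascadePhi_zero hζmem.2 hζ hζ₀
  have hpos : ∀ᵐ ω ∂P, ∀ J, 0 < X J ω := ae_all_iff.2 fun J =>
    (hXlaw J).symm.ae_snd measurableSet_Ioi hWpos
  -- The almost sure statements about the tree are pulled back to `Ω` together, along the map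
  -- sending `ω` to its family of node weights, whose law is `treeLaw`.
  have htree : ∀ᵐ ω ∂P, _ :=
    ae_of_ae_map (f := fun ω => nodeWeights fun J => X J ω) (by
      refine Measurable.aemeasurable (measurable_pi_lambda _ fun l => ?_)
      have := hX (toIndex l)
      unfold nodeWeights
      fun_prop)
    (by
      rw [map_nodeWeights_eq_treeLaw hX hXindep hXlaw]
      exact (hdim.and (ae_isRegular_leb _ hlaw.mean)).and
        (hlaw.ae_tendsto_maxNode.and hlaw.ae_lebNode_pos))
  filter_upwards [hpos, htree] with ω hω hw
  obtain ⟨⟨hwdim, hreg⟩, hmax, hwpos⟩ := hw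
  have hdiff := isDiffuse_of_tendsto hmax (lebNode_le_maxNode _)
  obtain ⟨hlim, hcell⟩ := exists_cascadeMeasure_cell (fun J => (hω J).le) hreg hdiff
  obtain ⟨m, hm, hmdim⟩ := exists_metricSpace_distFun
    (μ := (cascadeMeasure fun J => X J ω : Measure I)) (by simpa only [hcell] using hdiff)
    (by simpa only [hcell] using hwpos)
  refine ⟨hlim, m, hm, ζ, ?_, hζmem.2, fun s hs => ?_⟩
  · rw [hmdim]
    exact hwdim _ hcell
  · have hiff : (ζ₀ : ℝ) = cascadePhi P₀ W s ↔ s = ζ := by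
      rw [← hζ]
      exact ⟨fun h => (hmono.injOn hζmem hs h).symm, fun h => by rw [h]⟩
    refine ⟨?_, hiff⟩
    rw [← hiff, ← two_rpow_cascadePhi hW hWpos hWint hs]
    exact (Real.strictMono_rpow_of_base_gt_one one_lt_two).injective.eq_iff
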